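/- **Setting.** Let $\Bbbk$ be a field of characteristic $0$, $\Bbbk[[\hbar]]$ the ring of formal power series, $I$ a finite set, $A=(a_{ij})_{i,j\in I}$ a symmetrizable generalized Cartan matrix and $d_i$ $(i\in I)$ positive integers with $d_ia_{ij}=d_ja_{ji}$. Let $P=(p_{ij})$ be a matrix over $\Bbbk[[\hbar]]$ with $p_{ij}+p_{ji}=2d_ia_{ij}$ for all $i,j\in I$. Let $\mathcal R$ be a realization of $P$: a free $\Bbbk[[\hbar]]$-module $\mathfrak h$ of finite rank with elements $T_i^{+},T_i^-\in\mathfrak h$ and functionals $\alpha_i\in\operatorname{Hom}_{\Bbbk[[\hbar]]}(\mathfrak h,\Bbbk[[\hbar]])$ such that $\alpha_j(T_i^+)=p_{ij}$, $\alpha_j(T_i^-)=p_{ji}$, and the classes of $S_i=\tfrac12(T_i^++T_i^-)$, $i\in I$, in $\mathfrak h/\hbar\mathfrak h$ are linearly independent over $\Bbbk$. Put $q_i=e^{\hbar d_i}$, $q_{ij}^{\pm1/2}=e^{\pm\hbar p_{ij}/2}$, $[n]_q=\sum_{s=0}^{n-1}q^{2s-n+1}$ for $n\ge1$, $[n]_q!=\prod_{s=1}^n[s]_q$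 and $\left[{n\atop m}\right]_q=\frac{[n]_q!}{[m]_q!\,[n-m]_q!}$. Let $U=U^{\mathcal R}_{P,\hbar}(\mathfrak g)$ be the unital associative $\hbar$-adically complete $\Bbbk[[\hbar]]$-algebra generated by the $\Bbbk[[\hbar]]$-module $\mathfrak h$ and elements $E_i,F_i$ $(i\in I)$ with the relations, for $T,T',T''\in\mathfrak h$ and $i,j\in I$, $$TE_j-E_jT=\alpha_j(T)E_j,\quad TF_j-F_jT=-\alpha_j(T)F_j,\quad T'T''=T''T',\quad E_iF_j-F_jE_i=\delta_{ij}\frac{e^{\hbar T_i^+}-e^{-\hbar T_i^-}}{q_i-q_i^{-1}},$$ $$\sum_{m=0}^{1-a_{ij}}(-1)^m\left[{1-a_{ij}\atop m}\right]_{q_i}q_{ij}^{m/2}q_{ji}^{-m/2}\,E_i^{1-a_{ij}-m}E_jE_i^m=0\quad(i\ne j),\tag{S$^+$}$$ $$\sum_{m=0}^{1-a_{ij}}(-1)^m\left[{1-a_{ij}\atop m}\right]_{q_i}q_{ij}^{m/2}q_{ji}^{-m/2}\,F_i^{m}F_jF_i^{1-a_{ij}-m}=0\quad(i\ne j).\tag{S$^-$}$$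 In the fourth relation the numerator and the denominator are first divided by $\hbar$, that is, the right-hand side for $i=j$ is $\left(\frac{q_i-q_i^{-1}}{\hbar}\right)^{-1}\sum_{m\ge0}\hbar^m\,\frac{(T_i^+)^{m+1}-(-T_i^-)^{m+1}}{(m+1)!}$. Let $U_\hbar(\mathfrak h)$, $U(\mathfrak n_+)$, $U(\mathfrak n_-)$, $U(\mathfrak b_+)$, $U(\mathfrak b_-)$ be the $\hbar$-adically closed unital $\Bbbk[[\hbar]]$-subalgebras of $U$ generated, respectively, by $\mathfrak h$, by all $E_i$, by all $F_i$, by $\mathfrak h$ and all $E_i$, by $\mathfrak h$ and all $F_i$; they carry the topology induced by the $\hbar$-adic topology of $U$. Let $\widehat\otimes$ be the $\hbar$-adically completed tensor product over $\Bbbk[[\hbar]]$, with its $\hbar$-adic topology. **Theorem.** 1. There are isomorphisms of topological $\Bbbk[[\hbar]]$-modules $$U(\mathfrak n_-)\,\widehat\otimes\,U_\hbar(\mathfrak h)\,\widehat\otimes\,U(\mathfrak n_+)\;\cong\;U,\qquad U(\mathfrak n_+)\,\widehat\otimes\,U_\hbar(\mathfrak h)\,\widehat\otimes\,U(\mathfrak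 n_-)\;\cong\;U$$ sending $x\otimes t\otimes y$ to the product $x\,t\,y$ in $U$. 2. There are isomorphisms of topological $\Bbbk[[\hbar]]$-modules, for both choices of the sign, $$U(\mathfrak n_\pm)\,\widehat\otimes\,U_\hbar(\mathfrak h)\;\cong\;U(\mathfrak b_\pm),\qquad U_\hbar(\mathfrak h)\,\widehat\otimes\,U(\mathfrak n_\pm)\;\cong\;U(\mathfrak b_\pm)$$ sending a pure tensor to the product of its factors, in the same order, in $U$. 3. Let $\widehat U^+$ (resp. $\widehat U^-$) be the unital associative $\hbar$-adically complete $\Bbbk[[\hbar]]$-algebra with generators $E_i$ (resp. $F_i$), $i\in I$, and the relations (S$^+$) (resp. (S$^-$)) only, and let $\widehat U^0$ be the $\hbar$-adic completion of the symmetric algebra of the $\Bbbk[[\hbar]]$-module $\mathfrak h$, all with the $\hbar$-adic topology. There are isomorphisms of topological $\Bbbk[[\hbar]]$-algebras $\widehat U^+\cong U(\mathfrak n_+)$, $\widehat U^-\cong U(\mathfrak n_-)$, $\widehat U^0\cong U_\hbar(\mathfrak h)$ that send $E_i\mapsto E_i$, $F_i\mapsto F_i$ and $T\mapsto T$ $(T\in\mathfrak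 h)$, respectively. -/

import Mathlib

open scoped TensorProduct PowerSeries

noncomputable section

namespace MpQUEA

/-! ### `ħ`-adic topology and `ħ`-adic completion

The formal variable `ħ` is `PowerSeries.X : k⟦X⟧`. -/

/-- The ideal `(ħ)` of `k[[ħ]]`. -/
abbrev hIdeal (k : Type*) [Field k] : Ideal k⟦X⟧ := Ideal.span {PowerSeries.X}

/-- The `ħ`-adic completion `lim_n M / ħ^n M` of a `k[[ħ]]`-module `M`. -/
def HCompletion (k : Type*) [Field k] (M : Type*) [AddCommGroup M] [Module k⟦X⟧ M] : Type _ :=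
  AdicCompletion (hIdeal k) M

section Completion

variable {k : Type*} [Field k]

section Mod

variable (M : Type*) [AddCommGroup M] [Module k⟦X⟧ M]

instance : AddCommGroup (HCompletion k M) :=
  inferInstanceAs (AddCommGroup (AdicCompletion (hIdeal k) M))

instance : Module k⟦X⟧ (HCompletion k M) :=
  inferInstanceAs (Module k⟦X⟧ (AdicCompletion (hIdeal k) M))

/-- `ħ`-adic completions carry the `ħ`-adic topology. -/
instance : TopologicalSpace (HCompletion k M) :=
  (hIdeal k).adicModuleTopology (HCompletion k M)

/-- The canonical map from a module to its completion. -/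
def HCompletion.of (k : Type*) [Field k] (M : Type*) [AddCommGroup M] [Module k⟦X⟧ M] :
    M →ₗ[k⟦X⟧] HCompletion k M :=
  AdicCompletion.of (hIdeal k) M

/-- The completion is complete and separated. -/
theorem HCompletion.isAdicComplete : IsAdicComplete (hIdeal k) (HCompletion k M) :=
  AdicCompletion.isAdicComplete (I := hIdeal k) (M := M) ⟨{PowerSeries.X}, by simp⟩

variable {M}

theorem hCauchy (f : ℕ → M) (n : ℕ) :
    (∑ m ∈ Finset.range n, (PowerSeries.X : k⟦X⟧) ^ m • f m) ≡
      (∑ m ∈ Finset.range (n + 1), (PowerSeries.X : k⟦X⟧) ^ m • f m)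
        [SMOD ((hIdeal k) ^ n • ⊤ : Submodule k⟦X⟧ M)] := by
  rw [SModEq.comm, SModEq.sub_mem, Finset.sum_range_succ, add_sub_cancel_left]
  exact Submodule.smul_mem_smul (Ideal.pow_mem_pow (Ideal.mem_span_singleton_self _) n)
    Submodule.mem_top

/-- The sum of the convergent series `∑ ħ^m f(m)` in the completion. -/
def hSum (f : ℕ → M) : HCompletion k M :=
  AdicCompletion.mk (hIdeal k) M (AdicCompletion.AdicCauchySequence.mk (hIdeal k) M
    (fun n => ∑ m ∈ Finset.range n, (PowerSeries.X : k⟦X⟧) ^ m • f m) (hCauchy f))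

end Mod

section Alg

variable (A : Type*) [Ring A] [Algebra k⟦X⟧ A]

/-- The multiplication of `A / ħ^n A`. -/
def mulQ (n : ℕ) : (A ⧸ ((hIdeal k) ^ n • ⊤ : Submodule k⟦X⟧ A)) →ₗ[k⟦X⟧]
    (A ⧸ ((hIdeal k) ^ n • ⊤ : Submodule k⟦X⟧ A)) →ₗ[k⟦X⟧]
      (A ⧸ ((hIdeal k) ^ n • ⊤ : Submodule k⟦X⟧ A)) :=
  Submodule.liftQ _
    (LinearMap.flip (Submodule.liftQ _
      (LinearMap.flip ((LinearMap.mul k⟦X⟧ A).compr₂ (Submodule.mkQ _))) (by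
        rw [Submodule.smul_le]
        intro r hr x _
        rw [LinearMap.mem_ker]
        ext y
        simp only [map_smul, LinearMap.smul_apply, LinearMap.flip_apply, LinearMap.compr₂_apply,
          LinearMap.mul_apply', LinearMap.zero_apply]
        rw [← map_smul, Submodule.mkQ_apply, Submodule.Quotient.mk_eq_zero]
        exact Submodule.smul_mem_smul hr Submodule.mem_top))) (by
    rw [Submodule.smul_le]
    intro r hr x _
    rw [LinearMap.mem_ker]
    refine LinearMap.ext fun y => ?_
    obtain ⟨y, rfl⟩ := Submodule.Quotient.mk_surjective _ y
    simp only [map_smul, LinearMap.smul_apply, LinearMap.flip_apply, LinearMap.zero_apply]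
    change r • (Submodule.Quotient.mk (x * y) :
      A ⧸ ((hIdeal k) ^ n • ⊤ : Submodule k⟦X⟧ A)) = 0
    rw [← Submodule.Quotient.mk_smul, Submodule.Quotient.mk_eq_zero]
    exact Submodule.smul_mem_smul hr Submodule.mem_top)

@[simp] theorem mulQ_mk (n : ℕ) (x y : A) :
    mulQ (k := k) A n (Submodule.Quotient.mk x) (Submodule.Quotient.mk y) =
      Submodule.Quotient.mk (x * y) := rfl

theorem transitionMap_mulQ {m n : ℕ} (hmn : m ≤ n)
    (x y : A ⧸ ((hIdeal k) ^ n • ⊤ : Submodule k⟦X⟧ A)) :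
    AdicCompletion.transitionMap (hIdeal k) A hmn (mulQ A n x y) =
      mulQ A m (AdicCompletion.transitionMap (hIdeal k) A hmn x)
        (AdicCompletion.transitionMap (hIdeal k) A hmn y) := by
  obtain ⟨a, rfl⟩ := Submodule.Quotient.mk_surjective _ x
  obtain ⟨b, rfl⟩ := Submodule.Quotient.mk_surjective _ y
  rfl

instance : Mul (HCompletion k A) where
  mul x y := ⟨fun n => mulQ A n (x.val n) (y.val n), fun hmn => by
    have h := transitionMap_mulQ A hmn (x.val _) (y.val _)
    have hx := x.property hmn
    have hy := y.property hmn
    exact h.trans (congrArg₂ (fun a b => mulQ A _ a b) hx hy)⟩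

instance : One (HCompletion k A) where
  one := HCompletion.of k A 1

variable {A}

theorem HCompletion.ext {x y : HCompletion k A} (h : ∀ n, x.val n = y.val n) : x = y :=
  AdicCompletion.ext h

theorem HCompletion.val_mul (x y : HCompletion k A) (n : ℕ) :
    (x * y).val n = mulQ A n (x.val n) (y.val n) := rfl

theorem HCompletion.val_add (x y : HCompletion k A) (n : ℕ) :
    (x + y).val n = x.val n + y.val n := rfl

theorem HCompletion.val_one (n : ℕ) :
    (1 : HCompletion k A).val n = Submodule.Quotient.mk 1 := rfl

theorem HCompletion.val_zero (n : ℕ) : (0 : HCompletion k A).val n = 0 := rfl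

theorem HCompletion.val_smul (r : k⟦X⟧) (x : HCompletion k A) (n : ℕ) :
    (r • x).val n = r • x.val n := rfl

variable (A)

/-- The completion of an algebra is an algebra. -/
instance : Ring (HCompletion k A) where
  __ := (inferInstance : AddCommGroup (HCompletion k A))
  __ := (inferInstance : Mul (HCompletion k A))
  __ := (inferInstance : One (HCompletion k A))
  left_distrib x y z := HCompletion.ext fun n => by
    simp only [HCompletion.val_mul, HCompletion.val_add, map_add]
  right_distrib x y z := HCompletion.ext fun n => by
    simp only [HCompletion.val_mul, HCompletion.val_add, map_add, LinearMap.add_apply]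
  zero_mul x := HCompletion.ext fun n => by
    simp only [HCompletion.val_mul, HCompletion.val_zero, map_zero, LinearMap.zero_apply]
  mul_zero x := HCompletion.ext fun n => by
    simp only [HCompletion.val_mul, HCompletion.val_zero, map_zero]
  mul_assoc x y z := HCompletion.ext fun n => by
    obtain ⟨a, ha⟩ := Submodule.Quotient.mk_surjective _ (x.val n)
    obtain ⟨b, hb⟩ := Submodule.Quotient.mk_surjective _ (y.val n)
    obtain ⟨c, hc⟩ := Submodule.Quotient.mk_surjective _ (z.val n)
    simp only [HCompletion.val_mul, ← ha, ← hb, ← hc, mulQ_mk, mul_assoc]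
  one_mul x := HCompletion.ext fun n => by
    obtain ⟨a, ha⟩ := Submodule.Quotient.mk_surjective _ (x.val n)
    simp only [HCompletion.val_mul, HCompletion.val_one, ← ha, mulQ_mk, one_mul]
  mul_one x := HCompletion.ext fun n => by
    obtain ⟨a, ha⟩ := Submodule.Quotient.mk_surjective _ (x.val n)
    simp only [HCompletion.val_mul, HCompletion.val_one, ← ha, mulQ_mk, mul_one]
  zsmul := fun n x => n • x
  zsmul_zero' := zero_zsmul
  zsmul_succ' := SubNegMonoid.zsmul_succ'
  zsmul_neg' := SubNegMonoid.zsmul_neg'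

instance : Algebra k⟦X⟧ (HCompletion k A) :=
  Algebra.ofModule
    (fun r x y => HCompletion.ext fun n => by
      simp only [HCompletion.val_mul, HCompletion.val_smul, map_smul, LinearMap.smul_apply])
    (fun r x y => HCompletion.ext fun n => by
      simp only [HCompletion.val_mul, HCompletion.val_smul, map_smul])

end Alg

end Completion

/-- The completed tensor product `M ⊗̂ N` over `k[[ħ]]`. -/
abbrev CTensor₂ (k : Type*) [Field k] (M N : Type*) [AddCommGroup M] [Module k⟦X⟧ M]
    [AddCommGroup N] [Module k⟦X⟧ N] : Type _ :=
  HCompletion k (M ⊗[k⟦X⟧] N)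

/-- The completed tensor product `L ⊗̂ M ⊗̂ N` over `k[[ħ]]`. -/
abbrev CTensor₃ (k : Type*) [Field k] (L M N : Type*) [AddCommGroup L] [Module k⟦X⟧ L]
    [AddCommGroup M] [Module k⟦X⟧ M] [AddCommGroup N] [Module k⟦X⟧ N] : Type _ :=
  HCompletion k ((L ⊗[k⟦X⟧] M) ⊗[k⟦X⟧] N)

/-- The image of the pure tensor `x ⊗ y` in `M ⊗̂ N`. -/
def ctmul₂ (k : Type*) [Field k] {M N : Type*} [AddCommGroup M] [Module k⟦X⟧ M]
    [AddCommGroup N] [Module k⟦X⟧ N] (x : M) (y : N) : CTensor₂ k M N :=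
  HCompletion.of k _ (x ⊗ₜ[k⟦X⟧] y)

/-- The image of the pure tensor `x ⊗ y ⊗ z` in `L ⊗̂ M ⊗̂ N`. -/
def ctmul₃ (k : Type*) [Field k] {L M N : Type*} [AddCommGroup L] [Module k⟦X⟧ L]
    [AddCommGroup M] [Module k⟦X⟧ M] [AddCommGroup N] [Module k⟦X⟧ N] (x : L) (y : M) (z : N) :
    CTensor₃ k L M N :=
  HCompletion.of k _ ((x ⊗ₜ[k⟦X⟧] y) ⊗ₜ[k⟦X⟧] z)

/-! ### Exponentials -/

section Exponentials

variable {k : Type*} [Field k]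

/-- `e^{ħ c}` for `c ∈ k[[ħ]]`. -/
def qexp [CharZero k] (c : k⟦X⟧) : k⟦X⟧ := (PowerSeries.exp k).subst (PowerSeries.X * c)

/-- `(q - q⁻¹) / ħ` for a power series `q` with constant term `1`. -/
def qden (q : k⟦X⟧) : k⟦X⟧ := PowerSeries.mk fun n => PowerSeries.coeff (n + 1) (q - q⁻¹)

variable {A : Type*} [Ring A] [Algebra k⟦X⟧ A]

/-- `e^{ħ x} = ∑ ħ^m x^m / m!`, an element of the completion of `A`. -/
def hexp (k : Type*) [Field k] {A : Type*} [Ring A] [Algebra k⟦X⟧ A] (x : A) :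
    HCompletion k A :=
  hSum (k := k) fun m => (PowerSeries.C ((m.factorial : k)⁻¹) : k⟦X⟧) • x ^ m

/-- `(e^{ħ x} - e^{ħ y}) / ħ = ∑ ħ^m (x^{m+1} - y^{m+1}) / (m+1)!`. -/
def hexpNum (k : Type*) [Field k] {A : Type*} [Ring A] [Algebra k⟦X⟧ A] (x y : A) :
    HCompletion k A :=
  hSum (k := k) fun m =>
    (PowerSeries.C (((m + 1).factorial : k)⁻¹) : k⟦X⟧) • (x ^ (m + 1) - y ^ (m + 1))

/-- `(e^{ħ x} - e^{ħ y}) / (q - q⁻¹)`, with numerator and denominator both divided by `ħ` first,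
which makes the denominator invertible for `q = e^{ħ d}`, `d ≠ 0`. See `hexpQuot_spec`. -/
def hexpQuot (q : k⟦X⟧) (x y : A) : HCompletion k A :=
  (qden q)⁻¹ • hexpNum k x y

theorem X_smul_hexpNum (x y : A) :
    (PowerSeries.X : k⟦X⟧) • hexpNum k x y = hexp k x - hexp k y := by
  refine HCompletion.ext fun n => ?_
  change (Submodule.Quotient.mk _ : A ⧸ ((hIdeal k) ^ n • ⊤ : Submodule k⟦X⟧ A)) =
    Submodule.Quotient.mk _
  rw [Submodule.Quotient.eq]
  change (PowerSeries.X : k⟦X⟧) • (∑ m ∈ Finset.range n, (PowerSeries.X : k⟦X⟧) ^ m •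
      ((PowerSeries.C (((m + 1).factorial : k)⁻¹) : k⟦X⟧) • (x ^ (m + 1) - y ^ (m + 1)))) -
    ((∑ m ∈ Finset.range n, (PowerSeries.X : k⟦X⟧) ^ m •
      ((PowerSeries.C ((m.factorial : k)⁻¹) : k⟦X⟧) • x ^ m)) -
     (∑ m ∈ Finset.range n, (PowerSeries.X : k⟦X⟧) ^ m •
      ((PowerSeries.C ((m.factorial : k)⁻¹) : k⟦X⟧) • y ^ m))) ∈ _
  rw [← Finset.sum_sub_distrib, Finset.smul_sum]
  have h1 : ∀ m : ℕ, (PowerSeries.X : k⟦X⟧) ^ m •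
      ((PowerSeries.C ((m.factorial : k)⁻¹) : k⟦X⟧) • x ^ m) - (PowerSeries.X : k⟦X⟧) ^ m •
      ((PowerSeries.C ((m.factorial : k)⁻¹) : k⟦X⟧) • y ^ m) = (PowerSeries.X : k⟦X⟧) ^ m •
      ((PowerSeries.C ((m.factorial : k)⁻¹) : k⟦X⟧) • (x ^ m - y ^ m)) := fun m => by
    rw [smul_sub, smul_sub]
  simp only [h1, smul_smul (PowerSeries.X : k⟦X⟧) (PowerSeries.X ^ _), ← pow_succ']
  have h2 := Finset.sum_range_succ' (fun m => (PowerSeries.X : k⟦X⟧) ^ m •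
      ((PowerSeries.C ((m.factorial : k)⁻¹) : k⟦X⟧) • (x ^ m - y ^ m))) n
  simp only [pow_zero, sub_self, smul_zero, add_zero] at h2
  rw [← h2, Finset.sum_range_succ, add_sub_cancel_left]
  exact Submodule.smul_mem_smul (Ideal.pow_mem_pow (Ideal.mem_span_singleton_self _) n)
    Submodule.mem_top


theorem X_mul_qden {q : k⟦X⟧} (hq : PowerSeries.constantCoeff q = 1) :
    PowerSeries.X * qden q = q - q⁻¹ := by
  ext n
  cases n with
  | zero => simp [hq]
  | succ n => simp [qden, PowerSeries.coeff_succ_X_mul]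

theorem hexpQuot_spec [CharZero k] {q : k⟦X⟧} (hq : PowerSeries.constantCoeff q = 1)
    (hq' : PowerSeries.coeff 1 q ≠ 0) (x y : A) :
    (q - q⁻¹) • hexpQuot q x y = hexp k x - hexp k y := by
  have h0 : PowerSeries.constantCoeff (qden q) ≠ 0 := by
    have h1 : q * q⁻¹ = 1 := PowerSeries.mul_inv_cancel _ (by simp [hq])
    have h2 := congrArg (PowerSeries.coeff 1) h1
    rw [PowerSeries.coeff_mul, Finset.Nat.antidiagonal_succ] at h2
    simp [hq] at h2
    have h3 : PowerSeries.constantCoeff (qden q) =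
        PowerSeries.coeff 1 q - PowerSeries.coeff 1 q⁻¹ := by
      rw [← PowerSeries.coeff_zero_eq_constantCoeff_apply]
      simp [qden]
    rw [h3]
    intro h
    have h4 : PowerSeries.coeff 1 q + PowerSeries.coeff 1 q = 0 := by linear_combination h2 + h
    exact hq' (by simpa [← two_mul] using h4)
  rw [← X_mul_qden hq, hexpQuot, smul_smul, mul_assoc, PowerSeries.mul_inv_cancel _ h0, mul_one,
    X_smul_hexpNum]

theorem constantCoeff_qexp [CharZero k] (c : k⟦X⟧) : PowerSeries.constantCoeff (qexp c) = 1 := by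
  have hs : PowerSeries.HasSubst (PowerSeries.X * c) :=
    PowerSeries.HasSubst.of_constantCoeff_zero' (by simp)
  rw [qexp, ← PowerSeries.coeff_zero_eq_constantCoeff_apply, PowerSeries.coeff_subst' hs,
    finsum_eq_single _ 0]
  · simp
  · intro n hn
    simp [hn]

theorem coeff_one_qexp [CharZero k] (c : k⟦X⟧) :
    PowerSeries.coeff 1 (qexp c) = PowerSeries.constantCoeff c := by
  have hs : PowerSeries.HasSubst (PowerSeries.X * c) :=
    PowerSeries.HasSubst.of_constantCoeff_zero' (by simp)
  rw [qexp, PowerSeries.coeff_subst' hs, finsum_eq_single _ 1]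
  · simp [PowerSeries.coeff_exp]
  · intro n hn
    match n, hn with
    | 0, _ => simp [PowerSeries.coeff_one]
    | n + 2, _ =>
      rw [mul_pow, PowerSeries.coeff_X_pow_mul', if_neg (by omega), smul_zero]

end Exponentials

/-! ### Quantum integers, factorials, binomials -/

section QNumbers

variable {k : Type*} [Field k]

/-- `[n]_q = q^{n-1} + q^{n-3} + ⋯ + q^{-(n-1)}`. -/
def qInt (q : k⟦X⟧) (n : ℕ) : k⟦X⟧ := ∑ s ∈ Finset.range n, q ^ s * q⁻¹ ^ (n - 1 - s)

/-- `[n]_q! = [1]_q ⋯ [n]_q`. -/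
def qFact (q : k⟦X⟧) (n : ℕ) : k⟦X⟧ := ∏ s ∈ Finset.range n, qInt q (s + 1)

/-- The `q`-binomial coefficient `[n]_q! / ([m]_q! [n-m]_q!)`, for `m ≤ n`. -/
def qBinom (q : k⟦X⟧) (n m : ℕ) : k⟦X⟧ := qFact q n * (qFact q m * qFact q (n - m))⁻¹

end QNumbers

/-! ### Cartan data, multiparameters, realizations -/

/-- `A` is a generalized Cartan matrix, symmetrized by the positive integers `d i`. -/
structure IsSymmetrizableGCM {I : Type*} (A : Matrix I I ℤ) (d : I → ℕ) : Prop where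
  diag : ∀ i, A i i = 2
  nonpos : ∀ i j, i ≠ j → A i j ≤ 0
  zero_iff : ∀ i j, A i j = 0 ↔ A j i = 0
  pos : ∀ i, 0 < d i
  symm : ∀ i j, (d i : ℤ) * A i j = (d j : ℤ) * A j i

/-- `P` is a multiparameter matrix of Cartan type: `P + Pᵀ = 2 D A`. -/
def IsCartanType {k : Type*} [Field k] {I : Type*} (A : Matrix I I ℤ) (d : I → ℕ)
    (P : Matrix I I k⟦X⟧) : Prop :=
  ∀ i j, P i j + P j i = 2 * (d i : k⟦X⟧) * ((A i j : ℤ) : k⟦X⟧)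

/-- A realization of the matrix `P` on the free module `h`: coroots `T i ^ ±`, roots `α j`. -/
structure Realization {k : Type*} [Field k] {I : Type*} (P : Matrix I I k⟦X⟧)
    (h : Type*) [AddCommGroup h] [Module k⟦X⟧ h] where
  Tp : I → h
  Tm : I → h
  α : I → Module.Dual k⟦X⟧ h
  root_Tp : ∀ i j, α j (Tp i) = P i j
  root_Tm : ∀ i j, α j (Tm i) = P j i
  /-- The classes of `S_i = (T_i^+ + T_i^-)/2` in `h/ħh` are independent over `k = k[[ħ]]/(ħ)`. -/
  indep : LinearIndependent (k⟦X⟧ ⧸ hIdeal k) fun i =>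
    (Submodule.Quotient.mk ((PowerSeries.C ((2 : k)⁻¹) : k⟦X⟧) • (Tp i + Tm i)) :
      h ⧸ (hIdeal k • ⊤ : Submodule k⟦X⟧ h))

/-! ### Quantum Serre elements -/

section Serre

variable {k : Type*} [Field k] [CharZero k] {I : Type*}
  (A : Matrix I I ℤ) (d : I → ℕ) (P : Matrix I I k⟦X⟧)

/-- The coefficient `(-1)^m [1-a_ij choose m]_{q_i} q_ij^{m/2} q_ji^{-m/2}`, where
`q_i = e^{ħ d_i}` and `q_ij^{1/2} = e^{ħ p_ij / 2}`. -/
def serreCoeff (i j : I) (m : ℕ) : k⟦X⟧ :=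
  (-1) ^ m * qBinom (qexp (d i : k⟦X⟧)) (1 - A i j).toNat m *
    qexp (PowerSeries.C ((2 : k)⁻¹) * P i j) ^ m *
    ((qexp (PowerSeries.C ((2 : k)⁻¹) * P j i))⁻¹) ^ m

variable {B : Type*} [Ring B] [Algebra k⟦X⟧ B]

/-- `∑_m (-1)^m [N choose m] q_ij^{m/2} q_ji^{-m/2} x_i^{N-m} x_j x_i^m`, with `N = 1 - a_ij`. -/
def serrePos (x : I → B) (i j : I) : B :=
  ∑ m ∈ Finset.range ((1 - A i j).toNat + 1),
    serreCoeff A d P i j m • (x i ^ ((1 - A i j).toNat - m) * x j * x i ^ m)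

/-- `∑_m (-1)^m [N choose m] q_ij^{m/2} q_ji^{-m/2} x_i^m x_j x_i^{N-m}`, with `N = 1 - a_ij`. -/
def serreNeg (x : I → B) (i j : I) : B :=
  ∑ m ∈ Finset.range ((1 - A i j).toNat + 1),
    serreCoeff A d P i j m • (x i ^ m * x j * x i ^ ((1 - A i j).toNat - m))

/-! ### The algebras presented by the quantum Serre relations alone -/

inductive PosRel : FreeAlgebra k⟦X⟧ I → FreeAlgebra k⟦X⟧ I → Prop
  | serre (i j : I) : i ≠ j → PosRel (serrePos A d P (FreeAlgebra.ι k⟦X⟧) i j) 0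

inductive NegRel : FreeAlgebra k⟦X⟧ I → FreeAlgebra k⟦X⟧ I → Prop
  | serre (i j : I) : i ≠ j → NegRel (serreNeg A d P (FreeAlgebra.ι k⟦X⟧) i j) 0

/-- `Û⁺`: the complete algebra with generators `E_i` and the quantum Serre relations. -/
abbrev UhatPos : Type _ := HCompletion k (RingQuot (PosRel A d P))

/-- `Û⁻`: the complete algebra with generators `F_i` and the quantum Serre relations. -/
abbrev UhatNeg : Type _ := HCompletion k (RingQuot (NegRel A d P))

/-- The generator `E_i` of `Û⁺`. -/
def UhatPos.gen (i : I) : UhatPos A d P :=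
  HCompletion.of k _ (RingQuot.mkAlgHom k⟦X⟧ (PosRel A d P) (FreeAlgebra.ι k⟦X⟧ i))

/-- The generator `F_i` of `Û⁻`. -/
def UhatNeg.gen (i : I) : UhatNeg A d P :=
  HCompletion.of k _ (RingQuot.mkAlgHom k⟦X⟧ (NegRel A d P) (FreeAlgebra.ι k⟦X⟧ i))

end Serre

/-- `Û⁰`: the `ħ`-adic completion of the symmetric algebra of `h`. -/
abbrev UhatZero (k : Type*) [Field k] (h : Type*) [AddCommGroup h] [Module k⟦X⟧ h] : Type _ :=
  HCompletion k (SymmetricAlgebra k⟦X⟧ h)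

/-- The canonical map `h → Û⁰`. -/
def UhatZero.gen (k : Type*) [Field k] {h : Type*} [AddCommGroup h] [Module k⟦X⟧ h] (t : h) :
    UhatZero k h :=
  HCompletion.of k _ (SymmetricAlgebra.ι k⟦X⟧ h t)

/-! ### The formal multiparameter quantized universal enveloping algebra -/

/-- Symbols for the generators: all elements of `h`, and `E_i`, `F_i` for `i ∈ I`. -/
inductive Gen (I h : Type*)
  | T : h → Gen I h
  | E : I → Gen I h
  | F : I → Gen I h

section U

variable {k : Type*} [Field k] [CharZero k] {I : Type*}
  {h : Type*} [AddCommGroup h] [Module k⟦X⟧ h]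

/-- The completed free algebra on the generators. -/
abbrev FreeC (k : Type*) [Field k] (I h : Type*) : Type _ :=
  HCompletion k (FreeAlgebra k⟦X⟧ (Gen I h))

/-- The generators in the completed free algebra. -/
def fgen (k : Type*) [Field k] {I h : Type*} (g : Gen I h) : FreeC k I h :=
  HCompletion.of k _ (FreeAlgebra.ι k⟦X⟧ g)

variable (A : Matrix I I ℤ) (d : I → ℕ) {P : Matrix I I k⟦X⟧} (ρ : Realization P h)

/-- The defining relations. The first two say that the symbols `T t` generate a copy of the
module `h`. -/
inductive URel : FreeC k I h → FreeC k I h → Prop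
  | add (t t' : h) : URel (fgen k (.T (t + t'))) (fgen k (.T t) + fgen k (.T t'))
  | smul (c : k⟦X⟧) (t : h) : URel (fgen k (.T (c • t))) (c • fgen k (.T t))
  | comm_T (t t' : h) : URel (fgen k (.T t) * fgen k (.T t')) (fgen k (.T t') * fgen k (.T t))
  | comm_TE (t : h) (j : I) :
      URel (fgen k (.T t) * fgen k (.E j) - fgen k (.E j) * fgen k (.T t))
        (ρ.α j t • fgen k (.E j))
  | comm_TF (t : h) (j : I) :
      URel (fgen k (.T t) * fgen k (.F j) - fgen k (.F j) * fgen k (.T t))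
        (-(ρ.α j t • fgen k (.F j)))
  | comm_EF_ne (i j : I) : i ≠ j →
      URel (fgen k (.E i) * fgen k (.F j) - fgen k (.F j) * fgen k (.E i)) 0
  | comm_EF (i : I) :
      URel (fgen k (.E i) * fgen k (.F i) - fgen k (.F i) * fgen k (.E i))
        (hexpQuot (qexp (d i : k⟦X⟧)) (FreeAlgebra.ι k⟦X⟧ (Gen.T (ρ.Tp i)))
          (-FreeAlgebra.ι k⟦X⟧ (Gen.T (ρ.Tm i))))
  | serreE (i j : I) : i ≠ j → URel (serrePos A d P (fun i => fgen k (.E i)) i j) 0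
  | serreF (i j : I) : i ≠ j → URel (serreNeg A d P (fun i => fgen k (.F i)) i j) 0

/-- The formal multiparameter QUEA: the complete algebra generated by `h`, `E_i`, `F_i` with the
relations `URel`. -/
abbrev U : Type _ := HCompletion k (RingQuot (URel A d ρ))

/-- The generators of `U`. -/
def U.gen (g : Gen I h) : U A d ρ :=
  HCompletion.of k _ (RingQuot.mkAlgHom k⟦X⟧ (URel A d ρ) (fgen k g))

/-- The smallest `ħ`-adically closed unital subalgebra containing `s`. -/
def closedAdjoin (s : Set (U A d ρ)) : Subalgebra k⟦X⟧ (U A d ρ) :=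
  sInf {S : Subalgebra k⟦X⟧ (U A d ρ) | s ⊆ S ∧ IsClosed (S : Set (U A d ρ))}

/-- The Cartan subalgebra `U(h)`. -/
def cartan : Subalgebra k⟦X⟧ (U A d ρ) :=
  closedAdjoin A d ρ (Set.range fun t => U.gen A d ρ (.T t))

/-- The positive nilpotent subalgebra `U(n₊)`. -/
def nilPos : Subalgebra k⟦X⟧ (U A d ρ) :=
  closedAdjoin A d ρ (Set.range fun i => U.gen A d ρ (.E i))

/-- The negative nilpotent subalgebra `U(n₋)`. -/
def nilNeg : Subalgebra k⟦X⟧ (U A d ρ) :=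
  closedAdjoin A d ρ (Set.range fun i => U.gen A d ρ (.F i))

/-- The positive Borel subalgebra `U(b₊)`. -/
def borelPos : Subalgebra k⟦X⟧ (U A d ρ) :=
  closedAdjoin A d ρ
    ((Set.range fun t => U.gen A d ρ (.T t)) ∪ Set.range fun i => U.gen A d ρ (.E i))

/-- The negative Borel subalgebra `U(b₋)`. -/
def borelNeg : Subalgebra k⟦X⟧ (U A d ρ) :=
  closedAdjoin A d ρ
    ((Set.range fun t => U.gen A d ρ (.T t)) ∪ Set.range fun i => U.gen A d ρ (.F i))

end U

end MpQUEA

end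

/-! Let X⁻ and X⁺ be the uncompleted algebras presented by the Serre relations alone (`NegAlg`,
`PosAlg`), and S the symmetric algebra of h. Everything follows from two properties of the
multiplication map μ : X⁻ ⊗ S ⊗ X⁺ → U: its image is ħ-adically dense, and μ(z) ∈ ħⁿU forces z to be
divisible by ħⁿ (`ReflectsHPow`). A map that reflects divisibility into a complete module extends to
a homeomorphic isomorphism from the completion of its source onto the closure of its image
(`ReflectsHPow.exists_linearEquiv`). Divisibility is tested for one n at a time, so no basis and no
flatness of X⁻ or X⁺ enters.

Density need only be checked modulo ħ (`hClosure_eq_top`), where the product X⁻SX⁺ absorbs left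
multiplication by every generator (`adjoin_le_range_mul₃_sup`).

Reflection comes from a module of Verma type. Fix n and replace S by S/ħⁿ, so that the exponential
quotients become polynomials. On words in the F_i with coefficients in S/ħⁿ ⊗ X⁺ there are operators
satisfying all relations except the Serre ones (`indRep`); the Serre elements in the F_i are then
divided out (`TriRep.relSub`). This is compatible with the E_i, and the Serre elements in the E_i
act by zero, because Serre elements commute with the opposite generators (`TriRep.E_mul_serre`,
`TriRep.serre_mul_F`). The quotient is a U-module killed by ħⁿ, with a vector v₀ such that a t b v₀
projects to a ⊗ t ⊗ b in X⁻ ⊗ S/ħⁿ ⊗ X⁺ (`exists_triRep`). If μ(z) ∈ ħⁿU then μ(z) kills v₀, so z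
vanishes modulo ħⁿ (`mem_hPow_of_mul₃_mem`).

The commutation of Serre elements amounts to identities in S/ħⁿ (`SerreIdentities`). Shifting T by a
scalar multiplies e^{ħT} by a scalar, so each follows from two scalar identities
(`sum_smul_tquot_mem`). These are the vanishing of an alternating q-binomial sum and the ratio of
consecutive q-binomials.

Augmentations of X⁻, X⁺ and S split off factors of μ, so partial products and single factors also
reflect divisibility; this yields the Borel factorizations and the presentations. The other order of
factors is obtained by exchanging E and F (`TriRep.unswap`). -/

noncomputable section

namespace MpQUEA

/-! ### Divisibility by powers of `ħ` -/

section HPow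

variable {k : Type*} [Field k]

/-- The submodule `ħ^n M`. -/
abbrev hPow (k : Type*) [Field k] (M : Type*) [AddCommGroup M] [Module k⟦X⟧ M] (n : ℕ) :
    Submodule k⟦X⟧ M :=
  (hIdeal k) ^ n • (⊤ : Submodule k⟦X⟧ M)

variable {M N : Type*} [AddCommGroup M] [Module k⟦X⟧ M] [AddCommGroup N] [Module k⟦X⟧ N]

theorem mem_hPow {n : ℕ} {x : M} :
    x ∈ hPow k M n ↔ ∃ y, (PowerSeries.X : k⟦X⟧) ^ n • y = x := by
  rw [hPow, Ideal.span_singleton_pow, Submodule.ideal_span_singleton_smul,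
    Submodule.mem_smul_pointwise_iff_exists]
  simp

theorem X_pow_smul_mem_hPow (n : ℕ) (x : M) : (PowerSeries.X : k⟦X⟧) ^ n • x ∈ hPow k M n :=
  mem_hPow.2 ⟨x, rfl⟩

theorem map_mem_hPow (f : M →ₗ[k⟦X⟧] N) {n : ℕ} {x : M} (hx : x ∈ hPow k M n) :
    f x ∈ hPow k N n := by
  obtain ⟨y, rfl⟩ := mem_hPow.1 hx
  rw [map_smul]
  exact X_pow_smul_mem_hPow n _

theorem hPow_antitone {m n : ℕ} (h : m ≤ n) : hPow k M n ≤ hPow k M m :=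
  Submodule.smul_mono_left (Ideal.pow_le_pow_right h)

theorem hPow_zero : hPow k M 0 = ⊤ := by simp [hPow]

theorem eq_zero_of_forall_mem_hPow [IsHausdorff (hIdeal k) M] {x : M}
    (h : ∀ n, x ∈ hPow k M n) : x = 0 :=
  IsHausdorff.haus ‹_› x fun n => SModEq.zero.2 (h n)

theorem mul_mem_hPow {B : Type*} [Ring B] [Algebra k⟦X⟧ B] {n : ℕ} (a : B) {x : B}
    (hx : x ∈ hPow k B n) : a * x ∈ hPow k B n :=
  map_mem_hPow (LinearMap.mulLeft k⟦X⟧ a) hx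

theorem mem_hPow_mul {B : Type*} [Ring B] [Algebra k⟦X⟧ B] {n : ℕ} (a : B) {x : B}
    (hx : x ∈ hPow k B n) : x * a ∈ hPow k B n :=
  map_mem_hPow (LinearMap.mulRight k⟦X⟧ a) hx

theorem isOpen_adic_iff (s : Set M) :
    @IsOpen M ((hIdeal k).adicModuleTopology M) s ↔
      ∀ x ∈ s, ∃ n, ∀ y, y - x ∈ hPow k M n → y ∈ s := by
  let := (hIdeal k).adicTopology
  let B := ((hIdeal k).ringFilterBasis.moduleFilterBasis
    ((hIdeal k).adic_module_basis M)).toAddGroupFilterBasis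
  let := B.topology
  rw [isOpen_iff_mem_nhds]
  refine forall₂_congr fun x _ => ?_
  rw [(B.nhds_hasBasis x).mem_iff]
  constructor
  · rintro ⟨V, ⟨n, rfl⟩, h⟩
    exact ⟨n, fun y hy => h ⟨y - x, hy, by simp⟩⟩
  · rintro ⟨n, h⟩
    refine ⟨_, ⟨n, rfl⟩, ?_⟩
    rintro _ ⟨y, hy, rfl⟩
    exact h _ (by simpa using hy)

/-- The points that can be approximated `ħ`-adically by elements of `W`. -/
def hClosure (W : Submodule k⟦X⟧ M) : Submodule k⟦X⟧ M := ⨅ n, W ⊔ hPow k M n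

theorem mem_hClosure {W : Submodule k⟦X⟧ M} {x : M} :
    x ∈ hClosure W ↔ ∀ n, ∃ w ∈ W, x - w ∈ hPow k M n := by
  simp only [hClosure, Submodule.mem_iInf]
  refine forall_congr' fun n => ?_
  rw [Submodule.mem_sup]
  constructor
  · rintro ⟨w, hw, y, hy, rfl⟩
    exact ⟨w, hw, by simpa using hy⟩
  · rintro ⟨w, hw, h⟩
    exact ⟨w, hw, _, h, by abel⟩

theorem le_hClosure (W : Submodule k⟦X⟧ M) : W ≤ hClosure W :=
  le_iInf fun _ => le_sup_left

/-- Successive approximation: write x = w + ħz; if z is known up to ħⁿ, then x is known up to ħⁿ⁺¹.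
-/
theorem hClosure_eq_top {W : Submodule k⟦X⟧ M} (h : W ⊔ hPow k M 1 = ⊤) : hClosure W = ⊤ := by
  refine iInf_eq_top.2 fun n => ?_
  induction n with
  | zero => rw [hPow_zero, sup_top_eq]
  | succ n ih =>
    rw [eq_top_iff]
    rintro x -
    obtain ⟨w, hw, y, hy, rfl⟩ := Submodule.mem_sup.1 (h ▸ Submodule.mem_top : x ∈ W ⊔ hPow k M 1)
    obtain ⟨z, rfl⟩ := mem_hPow.1 hy
    obtain ⟨w', hw', y', hy', rfl⟩ :=
      Submodule.mem_sup.1 (ih ▸ Submodule.mem_top : z ∈ W ⊔ hPow k M n)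
    obtain ⟨z', rfl⟩ := mem_hPow.1 hy'
    rw [smul_add, ← add_assoc, smul_smul, ← pow_add, add_comm 1 n]
    exact Submodule.add_mem_sup (W.add_mem hw (W.smul_mem _ hw')) (X_pow_smul_mem_hPow _ _)

end HPow

/-! ### Completions -/

section Completion

variable {k : Type*} [Field k]
  {M N : Type*} [AddCommGroup M] [Module k⟦X⟧ M] [AddCommGroup N] [Module k⟦X⟧ N]

/-- This rests on (ħ) being finitely generated; it lets the ħ-adic filtration of a completion be
read off from components. -/
theorem HCompletion.mem_hPow_iff {n : ℕ} {x : HCompletion k M} :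
    x ∈ hPow k (HCompletion k M) n ↔ x.val n = 0 := by
  have h := AdicCompletion.pow_smul_top_eq_ker_eval (I := hIdeal k) (M := M) (n := n)
    ⟨{PowerSeries.X}, by simp⟩
  exact SetLike.ext_iff.1 h x

theorem HCompletion.of_mem_hPow {n : ℕ} {x : M} :
    HCompletion.of k M x ∈ hPow k (HCompletion k M) n ↔ x ∈ hPow k M n := by
  rw [HCompletion.mem_hPow_iff]
  exact Submodule.Quotient.mk_eq_zero _

theorem HCompletion.exists_sub_of_mem (x : HCompletion k M) (n : ℕ) :
    ∃ m : M, x - HCompletion.of k M m ∈ hPow k (HCompletion k M) n := by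
  obtain ⟨m, hm⟩ := Submodule.Quotient.mk_surjective _ (x.val n)
  refine ⟨m, HCompletion.mem_hPow_iff.2 ?_⟩
  change x.val n - Submodule.Quotient.mk m = 0
  rw [hm, sub_self]

instance : IsAdicComplete (hIdeal k) (HCompletion k M) := HCompletion.isAdicComplete M

theorem HCompletion.isOpen_iff (s : Set (HCompletion k M)) :
    IsOpen s ↔ ∀ x ∈ s, ∃ n, ∀ y, y - x ∈ hPow k (HCompletion k M) n → y ∈ s :=
  isOpen_adic_iff s

theorem HCompletion.isClosed_iff (s : Set (HCompletion k M)) :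
    IsClosed s ↔ ∀ x, (∀ n, ∃ y ∈ s, x - y ∈ hPow k (HCompletion k M) n) → x ∈ s := by
  rw [← isOpen_compl_iff, HCompletion.isOpen_iff]
  constructor
  · intro h x hx
    by_contra hxs
    obtain ⟨n, hn⟩ := h x hxs
    obtain ⟨y, hy, hxy⟩ := hx n
    exact hn y (by simpa using Submodule.neg_mem _ hxy) hy
  · intro h x hx
    by_contra! hne
    refine hx (h x fun n => ?_)
    obtain ⟨y, hy, hys⟩ := hne n
    exact ⟨y, by simpa using hys, by simpa using Submodule.neg_mem _ hy⟩

/-- The extension to the completion of a linear map with complete target. -/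
def HCompletion.extend [IsAdicComplete (hIdeal k) N] (f : M →ₗ[k⟦X⟧] N) :
    HCompletion k M →ₗ[k⟦X⟧] N :=
  (AdicCompletion.ofLinearEquiv (hIdeal k) N).symm.toLinearMap ∘ₗ
    (AdicCompletion.map (hIdeal k) f).restrictScalars k⟦X⟧

theorem HCompletion.extend_of [IsAdicComplete (hIdeal k) N] (f : M →ₗ[k⟦X⟧] N) (x : M) :
    HCompletion.extend f (HCompletion.of k M x) = f x := by
  change (AdicCompletion.ofLinearEquiv (hIdeal k) N).symm
    (AdicCompletion.map (hIdeal k) f (AdicCompletion.of _ _ x)) = _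
  rw [AdicCompletion.map_of, AdicCompletion.ofLinearEquiv_symm_of]

/-- `f : M → N` reflects divisibility by powers of `ħ`. -/
def ReflectsHPow (f : M →ₗ[k⟦X⟧] N) : Prop :=
  ∀ (n : ℕ) (x : M), f x ∈ hPow k N n → x ∈ hPow k M n

namespace ReflectsHPow

variable [IsAdicComplete (hIdeal k) N] {f : M →ₗ[k⟦X⟧] N} (hf : ReflectsHPow f)

include hf

theorem extend : ReflectsHPow (HCompletion.extend f) := by
  intro n x hx
  obtain ⟨m, hm⟩ := x.exists_sub_of_mem n
  have h1 : f m ∈ hPow k N n := by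
    have := Submodule.sub_mem _ hx (map_mem_hPow (HCompletion.extend f) hm)
    rwa [map_sub, HCompletion.extend_of, sub_sub_cancel] at this
  have h2 := HCompletion.of_mem_hPow.2 (hf n m h1)
  simpa using Submodule.add_mem _ hm h2

/-- An element of the kernel maps into every ħⁿN, hence lies in every ħⁿ of the completion, which is
separated. -/
theorem extend_injective : Function.Injective (HCompletion.extend f) := by
  rw [injective_iff_map_eq_zero]
  intro x hx
  refine eq_zero_of_forall_mem_hPow (k := k) fun n => hf.extend n x ?_
  rw [hx]
  exact Submodule.zero_mem _

/-- Approximate preimages of a point of the closure form a Cauchy sequence because `f` reflects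
divisibility; their limit is an exact preimage. -/
theorem range_extend : LinearMap.range (HCompletion.extend f) = hClosure (LinearMap.range f) := by
  ext u
  rw [mem_hClosure]
  constructor
  · rintro ⟨x, rfl⟩ n
    obtain ⟨m, hm⟩ := x.exists_sub_of_mem n
    refine ⟨f m, ⟨m, rfl⟩, ?_⟩
    have := map_mem_hPow (HCompletion.extend f) hm
    rwa [map_sub, HCompletion.extend_of] at this
  · intro h
    have h' : ∀ n, ∃ m, u - f m ∈ hPow k N n := fun n => by
      obtain ⟨_, ⟨m, rfl⟩, hm⟩ := h n
      exact ⟨m, hm⟩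
    choose m hm using h'
    have hc : ∀ n, m n ≡ m (n + 1) [SMOD ((hIdeal k) ^ n • ⊤ : Submodule k⟦X⟧ M)] := fun n => by
      rw [SModEq.sub_mem]
      refine hf n _ ?_
      rw [map_sub, ← sub_sub_sub_cancel_left _ _ u]
      exact Submodule.sub_mem _ (hPow_antitone (Nat.le_succ n) (hm (n + 1))) (hm n)
    let x : HCompletion k M := AdicCompletion.mk (hIdeal k) M
      (AdicCompletion.AdicCauchySequence.mk (hIdeal k) M m hc)
    refine ⟨x, ?_⟩
    rw [← sub_eq_zero]
    refine eq_zero_of_forall_mem_hPow (k := k) fun n => ?_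
    have hx : x - HCompletion.of k M (m n) ∈ hPow k (HCompletion k M) n := by
      rw [HCompletion.mem_hPow_iff]
      change (Submodule.Quotient.mk (m n) : M ⧸ ((hIdeal k) ^ n • ⊤ : Submodule k⟦X⟧ M)) -
        Submodule.Quotient.mk (m n) = 0
      exact sub_self _
    have := map_mem_hPow (HCompletion.extend f) hx
    rw [map_sub, HCompletion.extend_of] at this
    simpa using Submodule.sub_mem _ this (hm n)

end ReflectsHPow

/-- The extension of an algebra homomorphism to the completion. -/
def HCompletion.extendAlg {A B : Type*} [Ring A] [Algebra k⟦X⟧ A] [Ring B] [Algebra k⟦X⟧ B]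
    [IsAdicComplete (hIdeal k) B] (f : A →ₐ[k⟦X⟧] B) : HCompletion k A →ₐ[k⟦X⟧] B :=
  AlgHom.ofLinearMap (HCompletion.extend f.toLinearMap)
    (by
      change HCompletion.extend f.toLinearMap (HCompletion.of k A 1) = 1
      rw [HCompletion.extend_of]
      exact map_one f)
    (by
      intro x y
      rw [← sub_eq_zero]
      -- Multiplicativity is compared modulo every ħⁿ, with `x` and `y` approximated by elements of
      -- `A`.
      refine eq_zero_of_forall_mem_hPow (k := k) fun n => ?_
      obtain ⟨a, ha⟩ := x.exists_sub_of_mem n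
      obtain ⟨b, hb⟩ := y.exists_sub_of_mem n
      have hab : HCompletion.of k A (a * b) = HCompletion.of k A a * HCompletion.of k A b := rfl
      have h1 : x * y - HCompletion.of k A (a * b) ∈ hPow k (HCompletion k A) n := by
        have : x * y - HCompletion.of k A (a * b) =
            x * (y - HCompletion.of k A b) + (x - HCompletion.of k A a) * HCompletion.of k A b := by
          rw [hab]; noncomm_ring
        rw [this]
        exact Submodule.add_mem _ (mul_mem_hPow _ hb) (mem_hPow_mul _ ha)
      set g := HCompletion.extend f.toLinearMap with hg
      have ha' := map_mem_hPow g ha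
      have hb' := map_mem_hPow g hb
      have h1' := map_mem_hPow g h1
      rw [map_sub, hg, HCompletion.extend_of, ← hg] at ha' hb' h1'
      have : g (x * y) - g x * g y = (g (x * y) - f.toLinearMap (a * b)) -
          (g x * (g y - f.toLinearMap b) + (g x - f.toLinearMap a) * f.toLinearMap b) := by
        rw [AlgHom.toLinearMap_apply, map_mul f, AlgHom.toLinearMap_apply, AlgHom.toLinearMap_apply]
        noncomm_ring
      rw [this]
      exact Submodule.sub_mem _ h1' (Submodule.add_mem _ (mul_mem_hPow _ hb') (mem_hPow_mul _ ha')))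

theorem HCompletion.extendAlg_of {A B : Type*} [Ring A] [Algebra k⟦X⟧ A] [Ring B]
    [Algebra k⟦X⟧ B] [IsAdicComplete (hIdeal k) B] (f : A →ₐ[k⟦X⟧] B) (a : A) :
    HCompletion.extendAlg f (HCompletion.of k A a) = f a :=
  HCompletion.extend_of f.toLinearMap a

/-- Modules killed by a power of `ħ` are complete. -/
theorem isAdicComplete_of_X_pow_smul {n : ℕ} (h : ∀ x : N, (PowerSeries.X : k⟦X⟧) ^ n • x = 0) :
    IsAdicComplete (hIdeal k) N := by
  have h0 : hPow k N n = ⊥ := by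
    rw [eq_bot_iff]
    intro x hx
    obtain ⟨y, rfl⟩ := mem_hPow.1 hx
    simp [h]
  refine { haus' := fun x hx => ?_, prec' := fun f hf => ⟨f n, fun m => ?_⟩ }
  · have := SModEq.zero.1 (hx n)
    change x ∈ hPow k N n at this
    rwa [h0] at this
  · rcases le_total m n with hmn | hmn
    · exact hf hmn
    · have h1 := SModEq.sub_mem.1 (hf hmn)
      change f n - f m ∈ hPow k N n at h1
      rw [h0, Submodule.mem_bot, sub_eq_zero] at h1
      rw [h1]
      exact SModEq.rfl

/-- The completion of the source of an `ħ`-adic embedding into a completion is homeomorphic to the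
closure of the image. -/
theorem isHomeomorph_of_reflectsHPow {f : M →ₗ[k⟦X⟧] HCompletion k N} (hf : ReflectsHPow f)
    {S : Set (HCompletion k N)} (e : HCompletion k M → S) (he : Function.Bijective e)
    (hef : ∀ x, (e x : HCompletion k N) = HCompletion.extend f x) : IsHomeomorph e := by
  refine ⟨continuous_induced_rng.2 ⟨fun s hs => ?_⟩, fun s hs => ?_, he⟩
  · rw [HCompletion.isOpen_iff] at hs ⊢
    intro x hx
    obtain ⟨n, hn⟩ := hs _ hx
    refine ⟨n, fun y hy => hn _ ?_⟩
    simp only [Function.comp_apply, hef, ← map_sub]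
    exact map_mem_hPow _ hy
  · rw [HCompletion.isOpen_iff] at hs
    choose! n hn using hs
    -- A union of balls around the images of the points of `s`, of radii for which the balls in the
    -- source stay in `s`. By reflection, a point of `S` in such a ball comes from `s`.
    refine ⟨{u | ∃ x ∈ s, u - HCompletion.extend f x ∈ hPow k _ (n x)}, ?_, ?_⟩
    · rw [HCompletion.isOpen_iff]
      rintro u ⟨x, hx, hu⟩
      refine ⟨n x, fun y hy => ⟨x, hx, ?_⟩⟩
      simpa using Submodule.add_mem _ hy hu
    · ext u
      constructor
      · rintro ⟨x, hx, hu⟩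
        obtain ⟨y, rfl⟩ := he.2 u
        rw [hef, ← map_sub] at hu
        exact ⟨y, hn x hx y (hf.extend _ _ hu), rfl⟩
      · rintro ⟨x, hx, rfl⟩
        exact ⟨x, hx, by rw [hef, sub_self]; exact Submodule.zero_mem _⟩

/-- An `ħ`-adic embedding of `M` extends to an isomorphism of the completion of `M` with the closure
of the image. -/
theorem ReflectsHPow.exists_linearEquiv {f : M →ₗ[k⟦X⟧] HCompletion k N} (hf : ReflectsHPow f)
    (S : Submodule k⟦X⟧ (HCompletion k N)) (hS : hClosure (LinearMap.range f) = S) :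
    ∃ e : HCompletion k M ≃ₗ[k⟦X⟧] S, IsHomeomorph e ∧
      ∀ x, (e (HCompletion.of k M x) : HCompletion k N) = f x := by
  have hr : LinearMap.range (HCompletion.extend f) = S := hf.range_extend.trans hS
  let e : HCompletion k M ≃ₗ[k⟦X⟧] S :=
    (LinearEquiv.ofInjective (HCompletion.extend f) hf.extend_injective).trans
      (LinearEquiv.ofEq _ _ hr)
  exact ⟨e, isHomeomorph_of_reflectsHPow hf e e.bijective fun _ => rfl,
    fun x => HCompletion.extend_of f x⟩

end Completion

/-! ### Algebras with a triangular structure -/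

section Triangular

variable {R S I : Type*} [CommRing R] [CommRing S] [Algebra R S]

/-- Images in `B` of a commutative algebra `S` and of raising and lowering operators `E i`, `F i`
satisfying the relations of a quantized enveloping algebra other than the Serre relations. -/
structure TriRep (σ : I → S ≃ₐ[R] S) (H : I → S) (B : Type*) [Ring B] [Algebra R B] where
  τ : S →ₐ[R] B
  E : I → B
  F : I → B
  E_τ : ∀ i t, E i * τ t = τ (σ i t) * E i
  τ_F : ∀ i t, τ t * F i = F i * τ (σ i t)
  EF_comm : ∀ i j, i ≠ j → E i * F j = F j * E i
  EF : ∀ i, E i * F i = F i * E i + τ (H i)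

namespace TriRep

variable {σ : I → S ≃ₐ[R] S} {H : I → S} {B : Type*} [Ring B] [Algebra R B]

/-- Exchange of the raising and lowering operators. -/
def unswap (ρ : TriRep (fun i => (σ i).symm) (fun i => -H i) B) : TriRep σ H B where
  τ := ρ.τ
  E := ρ.F
  F := ρ.E
  E_τ i t := by rw [ρ.τ_F, AlgEquiv.symm_apply_apply]
  τ_F i t := by rw [ρ.E_τ, AlgEquiv.symm_apply_apply]
  EF_comm i j h := (ρ.EF_comm j i h.symm).symm
  EF i := by rw [ρ.EF, map_neg, neg_add_cancel_right]

/-- Exchange of the raising and lowering operators in the opposite algebra. -/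
def op (ρ : TriRep σ H B) : TriRep σ H Bᵐᵒᵖ where
  τ := AlgHom.toOpposite ρ.τ fun x y => by
    rw [Commute, SemiconjBy, ← map_mul, mul_comm, map_mul]
  E i := MulOpposite.op (ρ.F i)
  F i := MulOpposite.op (ρ.E i)
  E_τ i t := MulOpposite.unop_injective (ρ.τ_F i t)
  τ_F i t := MulOpposite.unop_injective (ρ.E_τ i t)
  EF_comm i j h := MulOpposite.unop_injective (ρ.EF_comm j i h.symm).symm.symm
  EF i := MulOpposite.unop_injective (ρ.EF i)

end TriRep

/-! ### Induced modules -/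

section Induced

variable (σ : I → S ≃ₐ[R] S) (H : I → S) {M : Type*} [AddCommGroup M] [Module R M]
  (τM : S →ₐ[R] Module.End R M) (EM : I → Module.End R M)

/-- The composite of the automorphisms `σ i` along a word. -/
def twist : List I → S →ₐ[R] S
  | [] => AlgHom.id R S
  | j :: w => (twist w).comp (σ j : S →ₐ[R] S)

/-- Left multiplication by `F i` on the induced module. -/
def indF (R : Type*) [CommRing R] (M : Type*) [AddCommGroup M] [Module R M] (i : I) : Module.End R (List I →₀ M) :=
  Finsupp.lmapDomain M R (List.cons i)

@[simp]
theorem indF_single (i : I) (w : List I) (m : M) :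
    indF R M i (Finsupp.single w m) = Finsupp.single (i :: w) m :=
  Finsupp.mapDomain_single

/-- The action of `S` on the induced module, as a plain function. -/
def indTFun (t : S) : Module.End R (List I →₀ M) :=
  Finsupp.lsum R fun w => Finsupp.lsingle w ∘ₗ τM (twist σ w t)

@[simp]
theorem indTFun_single (t : S) (w : List I) (m : M) :
    indTFun σ τM t (Finsupp.single w m) = Finsupp.single w (τM (twist σ w t) m) := by
  simp [indTFun]

/-- The action of `S` on the induced module. -/
def indT : S →ₐ[R] Module.End R (List I →₀ M) where
  toFun := indTFun σ τM
  map_one' := by ext w m : 2; simp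
  map_mul' s t := by ext w m : 2; simp
  map_zero' := by ext w m : 2; simp
  map_add' s t := by ext w m : 2; simp
  commutes' r := by ext w m : 2; simp [Module.algebraMap_end_apply]

@[simp]
theorem indT_single (t : S) (w : List I) (m : M) :
    indT σ τM t (Finsupp.single w m) = Finsupp.single w (τM (twist σ w t) m) :=
  indTFun_single σ τM t w m

open Classical in
/-- The action of `E i` on the words of the induced module. -/
def indEWord (i : I) : List I → M →ₗ[R] (List I →₀ M)
  | [] => Finsupp.lsingle [] ∘ₗ EM i
  -- Forced by E_i F_j = F_j E_i + δ_ij H_i.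
  | j :: w => indF R M j ∘ₗ indEWord i w + if i = j then indT σ τM (H i) ∘ₗ Finsupp.lsingle w else 0

/-- The action of `E i` on the induced module. -/
def indE (i : I) : Module.End R (List I →₀ M) := Finsupp.lsum R (indEWord σ H τM EM i)

@[simp]
theorem indE_single_nil (i : I) (m : M) :
    indE σ H τM EM i (Finsupp.single [] m) = Finsupp.single [] (EM i m) := by
  simp [indE, indEWord]

theorem indE_single_cons_ne {i j : I} (h : i ≠ j) (w : List I) (m : M) :
    indE σ H τM EM i (Finsupp.single (j :: w) m) =
      indF R M j (indE σ H τM EM i (Finsupp.single w m)) := by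
  simp [indE, indEWord, h]

theorem indE_single_cons_self (i : I) (w : List I) (m : M) :
    indE σ H τM EM i (Finsupp.single (i :: w) m) =
      indF R M i (indE σ H τM EM i (Finsupp.single w m)) +
        indT σ τM (H i) (Finsupp.single w m) := by
  simp [indE, indEWord]

/-- The module over the algebra with all relations except the Serre relations, induced from a
module over its upper triangular part. -/
def indRep (hσ : ∀ i j t, σ i (σ j t) = σ j (σ i t))
    (hM : ∀ i t, EM i * τM t = τM (σ i t) * EM i) :
    TriRep σ H (Module.End R (List I →₀ M)) :=
  have hEF : ∀ i, indE σ H τM EM i * indF R M i =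
      indF R M i * indE σ H τM EM i + indT σ τM (H i) := fun i => by
    refine Finsupp.lhom_ext fun w m => ?_
    simp [indE_single_cons_self]
  have hcomm : ∀ i j, i ≠ j → indE σ H τM EM i * indF R M j = indF R M j * indE σ H τM EM i :=
    fun i j hij => by
      refine Finsupp.lhom_ext fun w m => ?_
      simp [indE_single_cons_ne _ _ _ _ hij]
  have hTF : ∀ i t, indT σ τM t * indF R M i = indF R M i * indT σ τM (σ i t) := fun i t => by
    refine Finsupp.lhom_ext fun w m => ?_
    simp [twist]
  { τ := indT σ τM
    E := indE σ H τM EM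
    F := indF R M
    τ_F := hTF
    EF := hEF
    EF_comm := hcomm
    E_τ := fun i t => by
      refine Finsupp.lhom_ext fun w => ?_
      induction w generalizing t with
      | nil =>
        intro m
        have := LinearMap.congr_fun (hM i t) m
        simp only [Module.End.mul_apply] at this
        simp [twist, this]
      | cons j w ih =>
        intro m
        have hw : (Finsupp.single (j :: w) m : List I →₀ M) =
          indF R M j (Finsupp.single w m) := by simp
        -- F_j is moved to the left on both sides, where the induction hypothesis applies to the
        -- shorter word. For i = j the extra Cartan terms agree because S is commutative; for i ≠ j
        -- the automorphisms commute.
        have key : ∀ t : S, (indE σ H τM EM i * indT σ τM t * indF R M j) (Finsupp.single w m) =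
            (indT σ τM (σ i t) * indE σ H τM EM i * indF R M j) (Finsupp.single w m) := by
          intro t
          by_cases hij : i = j
          · subst hij
            rw [mul_assoc, hTF, ← mul_assoc, hEF, mul_assoc (indT σ τM (σ i t)), hEF, mul_add,
              ← mul_assoc _ (indF R M i), hTF, add_mul, LinearMap.add_apply, LinearMap.add_apply,
              ← map_mul, ← map_mul, mul_comm (H i), mul_assoc, mul_assoc, Module.End.mul_apply,
              ih, Module.End.mul_apply _ (_ * indE σ H τM EM i)]
          · rw [mul_assoc, hTF, ← mul_assoc, hcomm _ _ hij, mul_assoc (indT σ τM (σ i t)),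
              hcomm _ _ hij, ← mul_assoc _ (indF R M j), hTF, mul_assoc, mul_assoc,
              Module.End.mul_apply, ih, Module.End.mul_apply _ (_ * indE σ H τM EM i), hσ]
        rw [hw]
        exact key t }

end Induced

end Triangular

/-! ### Quotients by relations among the lowering operators -/

section Quotients

variable {R S I : Type*} [CommRing R] [CommRing S] [Algebra R S]

theorem map_lift_apply_of_intertwine {V V' : Type*} [AddCommGroup V] [Module R V]
    [AddCommGroup V'] [Module R V'] (g : V →ₗ[R] V') {A : I → Module.End R V}
    {A' : I → Module.End R V'} (h : ∀ i v, g (A i v) = A' i (g v)) (x : FreeAlgebra R I) (v : V) :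
    g (FreeAlgebra.lift R A x v) = FreeAlgebra.lift R A' x (g v) := by
  induction x using FreeAlgebra.induction generalizing v with
  | grade0 r => simp [Module.algebraMap_end_apply]
  | grade1 i => simp [h]
  | mul a b ha hb => simp [ha, hb]
  | add a b ha hb => simp [ha, hb]

namespace TriRep

variable {σ : I → S ≃ₐ[R] S} {H : I → S} {V : Type*} [AddCommGroup V] [Module R V]

/-- The quotient of a module by a stable submodule. -/
def quotient (ρ : TriRep σ H (Module.End R V)) (W : Submodule R V)
    (hE : ∀ i, W ≤ W.comap (ρ.E i)) (hF : ∀ i, W ≤ W.comap (ρ.F i))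
    (hτ : ∀ t, W ≤ W.comap (ρ.τ t)) : TriRep σ H (Module.End R (V ⧸ W)) where
  τ :=
    { toFun := fun t => W.mapQ W (ρ.τ t) (hτ t)
      map_one' := by ext v; simp
      map_mul' := fun s t => by ext v; simp
      map_zero' := by ext v; simp
      map_add' := fun s t => by ext v; simp
      commutes' := fun r => by ext v; simp [Module.algebraMap_end_apply] }
  E i := W.mapQ W (ρ.E i) (hE i)
  F i := W.mapQ W (ρ.F i) (hF i)
  E_τ i t := by
    ext v
    exact congrArg W.mkQ (LinearMap.congr_fun (ρ.E_τ i t) v)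
  τ_F i t := by
    ext v
    exact congrArg W.mkQ (LinearMap.congr_fun (ρ.τ_F i t) v)
  EF_comm i j h := by
    ext v
    exact congrArg W.mkQ (LinearMap.congr_fun (ρ.EF_comm i j h) v)
  EF i := by
    ext v
    exact congrArg W.mkQ (LinearMap.congr_fun (ρ.EF i) v)

/-- The submodule generated, under the lowering operators, by the images of the elements `r a`
in the lowering operators. -/
def relSub {ι : Type*} (ρ : TriRep σ H (Module.End R V)) (r : ι → FreeAlgebra R I) :
    Submodule R V :=
  Submodule.span R {v | ∃ (w : List I) (a : ι) (u : V),
    v = (w.map ρ.F).prod (FreeAlgebra.lift R ρ.F (r a) u)}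

section relSub

variable {ι : Type*} (ρ : TriRep σ H (Module.End R V)) (r : ι → FreeAlgebra R I)

theorem mem_relSub (w : List I) (a : ι) (u : V) :
    (w.map ρ.F).prod (FreeAlgebra.lift R ρ.F (r a) u) ∈ ρ.relSub r :=
  Submodule.subset_span ⟨w, a, u, rfl⟩

theorem relSub_le_comap_F (i : I) : ρ.relSub r ≤ (ρ.relSub r).comap (ρ.F i) := by
  rw [relSub, Submodule.span_le]
  rintro _ ⟨w, a, u, rfl⟩
  have := ρ.mem_relSub r (i :: w) a u
  rwa [List.map_cons, List.prod_cons] at this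

/-- The Cartan part crosses each letter of the word, and by hypothesis the relation itself, with
only its argument changing. -/
theorem relSub_le_comap_τ
    (hr : ∀ a t, ∃ t', ρ.τ t * FreeAlgebra.lift R ρ.F (r a) =
      FreeAlgebra.lift R ρ.F (r a) * ρ.τ t') (t : S) :
    ρ.relSub r ≤ (ρ.relSub r).comap (ρ.τ t) := by
  rw [relSub, Submodule.span_le]
  rintro _ ⟨w, a, u, rfl⟩
  induction w generalizing t with
  | nil =>
    obtain ⟨t', ht'⟩ := hr a t
    have := LinearMap.congr_fun ht' u
    rw [Module.End.mul_apply, Module.End.mul_apply] at this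
    simp only [List.map_nil, List.prod_nil, Module.End.one_apply, Submodule.comap_coe,
      Set.mem_preimage, this]
    exact ρ.mem_relSub r [] a (ρ.τ t' u)
  | cons j w ih =>
    simp only [List.map_cons, List.prod_cons, Submodule.comap_coe, Set.mem_preimage,
      Module.End.mul_apply]
    rw [← Module.End.mul_apply (ρ.τ t), ρ.τ_F]
    exact ρ.relSub_le_comap_F r j (ih (σ j t))

/-- E_i travels along the word. Each time it meets F_i it leaves a Cartan term, absorbed by
`relSub_le_comap_τ`, and at the end it commutes with the relation. -/
theorem relSub_le_comap_E
    (hr : ∀ a t, ∃ t', ρ.τ t * FreeAlgebra.lift R ρ.F (r a) =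
      FreeAlgebra.lift R ρ.F (r a) * ρ.τ t')
    (hE : ∀ a i, ρ.E i * FreeAlgebra.lift R ρ.F (r a) = FreeAlgebra.lift R ρ.F (r a) * ρ.E i)
    (i : I) : ρ.relSub r ≤ (ρ.relSub r).comap (ρ.E i) := by
  rw [relSub, Submodule.span_le]
  rintro _ ⟨w, a, u, rfl⟩
  induction w with
  | nil =>
    have := LinearMap.congr_fun (hE a i) u
    rw [Module.End.mul_apply, Module.End.mul_apply] at this
    simp only [List.map_nil, List.prod_nil, Module.End.one_apply, Submodule.comap_coe,
      Set.mem_preimage, this]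
    exact ρ.mem_relSub r [] a (ρ.E i u)
  | cons j w ih =>
    simp only [List.map_cons, List.prod_cons, Submodule.comap_coe, Set.mem_preimage,
      Module.End.mul_apply]
    rw [← Module.End.mul_apply (ρ.E i)]
    by_cases hij : i = j
    · subst hij
      rw [ρ.EF, LinearMap.add_apply]
      exact Submodule.add_mem _ (ρ.relSub_le_comap_F r i ih)
        (ρ.relSub_le_comap_τ r hr (H i) (ρ.mem_relSub r w a u))
    · rw [ρ.EF_comm i j hij]
      exact ρ.relSub_le_comap_F r j ih

end relSub

end TriRep

end Quotients

/-! ### The module of Verma type -/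

section Triangularity

universe uR uS uI uP uM

variable {R : Type uR} {S : Type uS} {I : Type uI} [CommRing R] [CommRing S] [Algebra R S]
  (σ : I → S ≃ₐ[R] S) (H : I → S) (hσ : ∀ i j t, σ i (σ j t) = σ j (σ i t))
  {Xp : Type uP} [Ring Xp] [Algebra R Xp] {Xm : Type uM} [Ring Xm] [Algebra R Xm]
  (e : I → Xp) (f : I → Xm)

/-- The raising operators on `S ⊗ X⁺`. -/
def borelE (i : I) : Module.End R (S ⊗[R] Xp) :=
  TensorProduct.map (σ i : S →ₐ[R] S).toLinearMap (LinearMap.mulLeft R (e i))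

/-- The action of `S` on `S ⊗ X⁺`. -/
def borelT (R S Xp : Type*) [CommRing R] [CommRing S] [Algebra R S] [Ring Xp] [Algebra R Xp] :
    S →ₐ[R] Module.End R (S ⊗[R] Xp) :=
  Algebra.lsmul R R (S ⊗[R] Xp)

theorem borelT_tmul (t s : S) (y : Xp) : borelT R S Xp t (s ⊗ₜ y) = (t * s) ⊗ₜ y := rfl

theorem borelE_mul_borelT (i : I) (t : S) :
    borelE σ e i * borelT R S Xp t = borelT R S Xp (σ i t) * borelE σ e i := by
  ext s y
  simp [borelE, borelT_tmul]

/-- The projection of the induced module onto `X⁻ ⊗ M`. -/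
def indProj (M : Type*) [AddCommGroup M] [Module R M] : (List I →₀ M) →ₗ[R] Xm ⊗[R] M :=
  Finsupp.lsum R fun w => TensorProduct.mk R Xm M (w.map f).prod

theorem indProj_indF (M : Type*) [AddCommGroup M] [Module R M] (i : I) (v : List I →₀ M) :
    indProj f M (indF R M i v) = (LinearMap.mulLeft R (f i)).rTensor M (indProj f M v) := by
  induction v using Finsupp.induction_linear with
  | zero => simp
  | add v w hv hw => simp only [map_add, hv, hw]
  | single w m => simp [indProj]

theorem lift_rTensor_mulLeft (M : Type*) [AddCommGroup M] [Module R M] (x : FreeAlgebra R I) :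
    FreeAlgebra.lift R (fun i => (LinearMap.mulLeft R (f i)).rTensor M) x =
      (LinearMap.mulLeft R (FreeAlgebra.lift R f x)).rTensor M := by
  induction x using FreeAlgebra.induction with
  | grade0 r =>
    ext x m
    simp [Module.algebraMap_end_apply, Algebra.smul_def, TensorProduct.smul_tmul']
  | grade1 i => simp
  | mul a b ha hb => rw [map_mul, map_mul, ha, hb]; ext; simp
  | add a b ha hb => rw [map_add, map_add, ha, hb]; ext; simp [add_mul, TensorProduct.add_tmul]

include hσ in
/-- If the relations `rp` and `rm` of `X⁺` and `X⁻` commute with the lowering and raising operators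
respectively, then `X⁻ ⊗ S ⊗ X⁺` is a quotient of a module over the algebra with all relations. -/
theorem exists_triRep {ι κ : Type*} (rm : ι → FreeAlgebra R I) (rp : κ → FreeAlgebra R I)
    (hrm : ∀ a, FreeAlgebra.lift R f (rm a) = 0)
    (hrp : ∀ b, FreeAlgebra.lift R (borelE σ e) (rp b) = 0)
    (hτ : ∀ (ρ : TriRep σ H (Module.End R (List I →₀ S ⊗[R] Xp))) (a : ι) (t : S),
      ∃ t', ρ.τ t * FreeAlgebra.lift R ρ.F (rm a) = FreeAlgebra.lift R ρ.F (rm a) * ρ.τ t')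
    (hE : ∀ (ρ : TriRep σ H (Module.End R (List I →₀ S ⊗[R] Xp))) (a : ι) (i : I),
      ρ.E i * FreeAlgebra.lift R ρ.F (rm a) = FreeAlgebra.lift R ρ.F (rm a) * ρ.E i)
    (hF : ∀ (ρ : TriRep σ H (Module.End R (List I →₀ S ⊗[R] Xp))) (b : κ) (i : I),
      FreeAlgebra.lift R ρ.E (rp b) * ρ.F i = ρ.F i * FreeAlgebra.lift R ρ.E (rp b)) :
    ∃ (V : Type (max uS uI uP)) (_ : AddCommGroup V) (_ : Module R V)
      (ρ : TriRep σ H (Module.End R V)) (v₀ : V) (p : V →ₗ[R] Xm ⊗[R] (S ⊗[R] Xp)),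
      (∀ a, FreeAlgebra.lift R ρ.F (rm a) = 0) ∧ (∀ b, FreeAlgebra.lift R ρ.E (rp b) = 0) ∧
      ∀ x t z, p (FreeAlgebra.lift R ρ.F x (ρ.τ t (FreeAlgebra.lift R ρ.E z v₀))) =
        FreeAlgebra.lift R f x ⊗ₜ (t ⊗ₜ FreeAlgebra.lift R e z) := by
  let M := S ⊗[R] Xp
  let ρ₀ : TriRep σ H (Module.End R (List I →₀ M)) :=
    indRep σ H (borelT R S Xp) (borelE σ e) hσ (borelE_mul_borelT σ e)
  let W := ρ₀.relSub rm
  let ρ := ρ₀.quotient W (ρ₀.relSub_le_comap_E rm (hτ ρ₀) (hE ρ₀)) (ρ₀.relSub_le_comap_F rm)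
    (ρ₀.relSub_le_comap_τ rm (hτ ρ₀))
  have hnil : ∀ (z : FreeAlgebra R I) (m : M), FreeAlgebra.lift R ρ₀.E z (Finsupp.single [] m) =
      Finsupp.single [] (FreeAlgebra.lift R (borelE σ e) z m) := fun z m =>
    (map_lift_apply_of_intertwine (Finsupp.lsingle (R := R) (M := M) ([] : List I))
      (A' := ρ₀.E) (fun i m => (indE_single_nil σ H (borelT R S Xp) (borelE σ e) i m).symm)
      z m).symm
  have hp : ∀ (x : FreeAlgebra R I) (v : List I →₀ M), indProj f M (FreeAlgebra.lift R ρ₀.F x v) =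
      (LinearMap.mulLeft R (FreeAlgebra.lift R f x)).rTensor M (indProj f M v) := fun x v => by
    rw [← lift_rTensor_mulLeft]
    exact map_lift_apply_of_intertwine (indProj f M) (A := ρ₀.F) (indProj_indF f M) x v
  have hpw : ∀ (w : List I) (v : List I →₀ M), indProj f M v = 0 →
      indProj f M ((w.map ρ₀.F).prod v) = 0 := fun w v hv => by
    induction w with
    | nil => simpa using hv
    | cons j w ih =>
      rw [List.map_cons, List.prod_cons, Module.End.mul_apply]
      refine (indProj_indF f M j _).trans ?_
      rw [ih hv, map_zero]
  -- The projection turns lowering operators into left multiplications in X⁻, where the relations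
  -- hold; hence it descends to the quotient.
  have hW : W ≤ LinearMap.ker (indProj f M) := by
    refine Submodule.span_le.2 ?_
    rintro _ ⟨w, a, u, rfl⟩
    refine hpw _ _ ?_
    rw [hp, hrm]
    simp
  have hmkF : ∀ (x : FreeAlgebra R I) (v : List I →₀ M),
      FreeAlgebra.lift R ρ.F x (W.mkQ v) = W.mkQ (FreeAlgebra.lift R ρ₀.F x v) := fun x v =>
    (map_lift_apply_of_intertwine W.mkQ (A := ρ₀.F) (A' := ρ.F) (fun _ _ => rfl) x v).symm
  have hmkE : ∀ (x : FreeAlgebra R I) (v : List I →₀ M),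
      FreeAlgebra.lift R ρ.E x (W.mkQ v) = W.mkQ (FreeAlgebra.lift R ρ₀.E x v) := fun x v =>
    (map_lift_apply_of_intertwine W.mkQ (A := ρ₀.E) (A' := ρ.E) (fun _ _ => rfl) x v).symm
  refine ⟨(List I →₀ M) ⧸ W, inferInstance, inferInstance, ρ,
    W.mkQ (Finsupp.single [] (1 ⊗ₜ 1)), W.liftQ (indProj f M) hW, fun a => ?_, fun b => ?_,
    fun x t z => ?_⟩
  · refine W.linearMap_qext (LinearMap.ext fun v => ?_)
    rw [LinearMap.comp_apply, hmkF, LinearMap.zero_comp, LinearMap.zero_apply, Submodule.mkQ_apply,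
      Submodule.Quotient.mk_eq_zero]
    exact ρ₀.mem_relSub rm [] a v
  -- On the empty word the relation vanishes because it does on S ⊗ X⁺. Since it commutes with every
  -- F_j, it vanishes on all words, already before passing to the quotient.
  · have h0 : FreeAlgebra.lift R ρ₀.E (rp b) = 0 := by
      refine Finsupp.lhom_ext fun w => ?_
      induction w with
      | nil =>
        intro m
        rw [hnil, hrp]
        simp
      | cons j w ih =>
        intro m
        have hw : (Finsupp.single (j :: w) m : List I →₀ M) = ρ₀.F j (Finsupp.single w m) :=
          (indF_single j w m).symm
        rw [hw, ← Module.End.mul_apply, hF, Module.End.mul_apply, ih]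
        simp
    refine W.linearMap_qext (LinearMap.ext fun v => ?_)
    rw [LinearMap.comp_apply, hmkE, h0]
    simp
  · have hz : FreeAlgebra.lift R (borelE σ e) z (1 ⊗ₜ 1) = 1 ⊗ₜ FreeAlgebra.lift R e z := by
      have h1 := map_lift_apply_of_intertwine (TensorProduct.mk R S Xp 1)
        (A := fun i => LinearMap.mulLeft R (e i)) (A' := borelE σ e)
        (fun i y => by simp [borelE]) z 1
      have h2 : ∀ z : FreeAlgebra R I, FreeAlgebra.lift R (fun i => LinearMap.mulLeft R (e i)) z =
          LinearMap.mulLeft R (FreeAlgebra.lift R e z) := fun z => by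
        have : FreeAlgebra.lift R (fun i => LinearMap.mulLeft R (e i)) =
            (Algebra.lmul R Xp).comp (FreeAlgebra.lift R e) := by
          ext i y
          simp
        rw [this]
        rfl
      rw [h2] at h1
      simpa using h1.symm
    have hτ' : ρ₀.τ t (Finsupp.single [] (1 ⊗ₜ FreeAlgebra.lift R e z)) =
        Finsupp.single [] (t ⊗ₜ[R] FreeAlgebra.lift R e z) := by
      refine (indT_single σ (borelT R S Xp) t [] _).trans ?_
      rw [twist, AlgHom.id_apply, borelT_tmul, mul_one]
    rw [hmkE, hnil, hz]
    change W.liftQ (indProj f M) hW (FreeAlgebra.lift R ρ.F x (W.mkQ (ρ₀.τ t _))) = _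
    rw [hmkF, hτ', Submodule.mkQ_apply, Submodule.liftQ_apply, hp]
    simp [indProj]

end Triangularity

/-! ### Serre elements commute with the opposite generators -/

section SerreCommutation

variable {R S I : Type*} [CommRing R] [CommRing S] [Algebra R S]

/-- The identities in the Cartan part that make the Serre elements with coefficients `c` commute
with the opposite generators. -/
structure SerreIdentities (σ : I → S ≃ₐ[R] S) (H : I → S) (N : ℕ) (c : ℕ → R) (i j : I) :
    Prop where
  sum_eq_zero : ∑ m ∈ Finset.range (N + 1), c m • (σ i)^[N - m] (H j) = 0
  add_eq_zero : ∀ m < N, c (m + 1) • (σ i)^[N - 1 - m] (σ j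
      (∑ b ∈ Finset.range (m + 1), (σ i)^[b] (H i))) +
    c m • ∑ b ∈ Finset.range (N - m), (σ i)^[b] (H i) = 0

namespace TriRep

variable {σ : I → S ≃ₐ[R] S} {H : I → S} {B : Type*} [Ring B] [Algebra R B] (ρ : TriRep σ H B)

theorem τ_F_pow (i : I) (m : ℕ) (t : S) :
    ρ.τ t * ρ.F i ^ m = ρ.F i ^ m * ρ.τ ((σ i)^[m] t) := by
  induction m generalizing t with
  | zero => simp
  | succ m ih =>
    rw [pow_succ', ← mul_assoc, ρ.τ_F, mul_assoc, ih, Function.iterate_succ_apply, mul_assoc]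

theorem E_F_pow_ne {i l : I} (h : l ≠ i) (m : ℕ) : ρ.E l * ρ.F i ^ m = ρ.F i ^ m * ρ.E l :=
  (Commute.pow_right (ρ.EF_comm l i h) m :)

/-- Each crossing of an F_i leaves a copy of H_i; moving it right through the b remaining factors
applies σ_i b times. For m = 0 the sum is empty, so the truncated exponent m - 1 is harmless. -/
theorem E_F_pow_self (i : I) (m : ℕ) : ρ.E i * ρ.F i ^ m =
    ρ.F i ^ m * ρ.E i + ρ.F i ^ (m - 1) * ρ.τ (∑ b ∈ Finset.range m, (σ i)^[b] (H i)) := by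
  induction m with
  | zero => simp
  | succ m ih =>
    rw [pow_succ, ← mul_assoc, ih, Finset.sum_range_succ', add_mul, mul_assoc, ρ.EF, mul_add,
      mul_assoc (ρ.F i ^ (m - 1)), ρ.τ_F, ← mul_assoc (ρ.F i ^ (m - 1)), map_sum]
    simp only [← Function.iterate_succ_apply' (σ i)]
    rcases m with - | m
    · simp
    · rw [Nat.add_sub_cancel, ← pow_succ, Nat.add_sub_cancel, map_add, mul_add]
      simp only [Function.iterate_zero, id_eq]
      noncomm_ring

/-- All monomials have the same weight, so they twist the Cartan part alike. The exponents are left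
general so as to cover both orders of the Serre element. -/
theorem τ_mul_serre (i j : I) (N : ℕ) (c : ℕ → R) (a b : ℕ → ℕ)
    (hab : ∀ m ∈ Finset.range (N + 1), a m + b m = N) (hσ : ∀ i j t, σ i (σ j t) = σ j (σ i t))
    (t : S) :
    ρ.τ t * (∑ m ∈ Finset.range (N + 1), c m • (ρ.F i ^ a m * ρ.F j * ρ.F i ^ b m)) =
      (∑ m ∈ Finset.range (N + 1), c m • (ρ.F i ^ a m * ρ.F j * ρ.F i ^ b m)) *
        ρ.τ ((σ i)^[N] (σ j t)) := by
  rw [Finset.mul_sum, Finset.sum_mul]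
  refine Finset.sum_congr rfl fun m hm => ?_
  have h1 : σ j ((σ i)^[a m] t) = (σ i)^[a m] (σ j t) :=
    Function.Commute.iterate_right (f := σ j) (g := σ i) (fun t => hσ j i t) (a m) t
  rw [mul_smul_comm, smul_mul_assoc, ← mul_assoc, ← mul_assoc, ρ.τ_F_pow, mul_assoc (_ ^ _) (ρ.τ _),
    ρ.τ_F, ← mul_assoc, mul_assoc _ (ρ.τ _), ρ.τ_F_pow, h1, ← mul_assoc,
    ← Function.iterate_add_apply, add_comm, hab m hm]

/-- For l = i the surplus terms are collected on the monomials F_i^m F_j F_i^(N-1-m), for l = j on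
F_i^N, and otherwise there are none. The two fields of `SerreIdentities` say that the collected
coefficients vanish. -/
theorem E_mul_serre (i j : I) (hij : i ≠ j) (N : ℕ) (c : ℕ → R)
    (hc : SerreIdentities σ H N c i j) (l : I) :
    ρ.E l * (∑ m ∈ Finset.range (N + 1), c m • (ρ.F i ^ m * ρ.F j * ρ.F i ^ (N - m))) =
      (∑ m ∈ Finset.range (N + 1), c m • (ρ.F i ^ m * ρ.F j * ρ.F i ^ (N - m))) * ρ.E l := by
  rw [Finset.mul_sum, Finset.sum_mul]
  simp only [mul_smul_comm, smul_mul_assoc]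
  by_cases hli : l = i
  · subst hli
    have key : ∀ m ∈ Finset.range (N + 1),
        c m • (ρ.E l * (ρ.F l ^ m * ρ.F j * ρ.F l ^ (N - m))) =
        c m • (ρ.F l ^ m * ρ.F j * ρ.F l ^ (N - m) * ρ.E l) +
        (ρ.F l ^ m * ρ.F j * ρ.F l ^ (N - m - 1) *
          ρ.τ (c m • ∑ b ∈ Finset.range (N - m), (σ l)^[b] (H l)) +
        ρ.F l ^ (m - 1) * ρ.F j * ρ.F l ^ (N - m) *
          ρ.τ (c m • (σ l)^[N - m] (σ j (∑ b ∈ Finset.range m, (σ l)^[b] (H l))))) := by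
      intro m _
      rw [← mul_assoc, ← mul_assoc, ρ.E_F_pow_self, add_mul, add_mul, mul_assoc _ (ρ.E l),
        ρ.EF_comm l j hij, mul_assoc _ (ρ.τ _), ρ.τ_F, ← mul_assoc, mul_assoc _ (ρ.E l),
        ρ.E_F_pow_self, ← mul_assoc, mul_assoc _ (ρ.τ _), ρ.τ_F_pow, mul_add, smul_add, smul_add,
        map_smul, map_smul, mul_smul_comm, mul_smul_comm, add_assoc, mul_assoc, mul_assoc]
      simp only [mul_assoc]
    -- The term m = N of the first family and the term m = 0 of the second are zero; term m + 1 of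
    -- the second then carries the same monomial as term m of the first.
    rw [Finset.sum_congr rfl key, Finset.sum_add_distrib, add_eq_left, Finset.sum_add_distrib,
      Finset.sum_range_succ, Finset.sum_range_succ' (fun m => ρ.F l ^ (m - 1) * _ * _ * _)]
    simp only [Nat.sub_self, Finset.range_zero, Finset.sum_empty, smul_zero, map_zero, mul_zero,
      add_zero, iterate_map_zero, Nat.add_sub_cancel]
    rw [← Finset.sum_add_distrib]
    refine Finset.sum_eq_zero fun m hm => ?_
    rw [Nat.sub_add_eq N m 1, Nat.sub_right_comm N m 1, ← mul_add, ← map_add, add_comm,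
      hc.add_eq_zero m (Finset.mem_range.1 hm), map_zero, mul_zero]
  · by_cases hlj : l = j
    · subst hlj
      have key : ∀ m ∈ Finset.range (N + 1),
          c m • (ρ.E l * (ρ.F i ^ m * ρ.F l * ρ.F i ^ (N - m))) =
          c m • (ρ.F i ^ m * ρ.F l * ρ.F i ^ (N - m) * ρ.E l) +
            ρ.F i ^ N * ρ.τ (c m • (σ i)^[N - m] (H l)) := by
        intro m hm
        have hN : m + (N - m) = N := by have := Finset.mem_range.1 hm; omega
        rw [← mul_assoc, ← mul_assoc, ρ.E_F_pow_ne hli, mul_assoc _ (ρ.E l), ρ.EF, mul_add,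
          add_mul, mul_assoc _ (ρ.τ _), ρ.τ_F_pow, ← mul_assoc (ρ.F i ^ m) (ρ.F i ^ _), ← pow_add,
          hN, ← mul_assoc (ρ.F i ^ m), mul_assoc _ (ρ.E l), ρ.E_F_pow_ne hli, smul_add, map_smul,
          mul_smul_comm, mul_assoc _ _ (ρ.E l)]
      rw [Finset.sum_congr rfl key, Finset.sum_add_distrib, add_eq_left, ← Finset.mul_sum,
        ← map_sum, hc.sum_eq_zero, map_zero, mul_zero]
    · refine Finset.sum_congr rfl fun m _ => ?_
      rw [← mul_assoc, ← mul_assoc, ρ.E_F_pow_ne hli, mul_assoc _ (ρ.E l), ρ.EF_comm l j hlj,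
        ← mul_assoc, mul_assoc _ (ρ.E l), ρ.E_F_pow_ne hli, ← mul_assoc]

/-- This is `E_mul_serre` in the opposite algebra, where E and F trade places and products are
reversed; hence the reversed exponents. -/
theorem serre_mul_F (i j : I) (hij : i ≠ j) (N : ℕ) (c : ℕ → R)
    (hc : SerreIdentities σ H N c i j) (l : I) :
    (∑ m ∈ Finset.range (N + 1), c m • (ρ.E i ^ (N - m) * ρ.E j * ρ.E i ^ m)) * ρ.F l =
      ρ.F l * (∑ m ∈ Finset.range (N + 1), c m • (ρ.E i ^ (N - m) * ρ.E j * ρ.E i ^ m)) := by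
  have h := congrArg MulOpposite.unop (ρ.op.E_mul_serre i j hij N c hc l)
  simpa [op, mul_assoc] using h

end TriRep

/-- On the factor S every monomial acts by the same automorphism σ_i^N σ_j, which comes out of the
sum and leaves the relation in `X`. -/
theorem borelE_serre_eq_zero {σ : I → S ≃ₐ[R] S} (hσ : ∀ i j t, σ i (σ j t) = σ j (σ i t))
    {X : Type*} [Ring X] [Algebra R X] (e : I → X) (i j : I) (N : ℕ) (c : ℕ → R) (a b : ℕ → ℕ)
    (hab : ∀ m ∈ Finset.range (N + 1), a m + b m = N)
    (h : ∑ m ∈ Finset.range (N + 1), c m • (e i ^ a m * e j * e i ^ b m) = 0) :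
    ∑ m ∈ Finset.range (N + 1),
      c m • (borelE σ e i ^ a m * borelE σ e j * borelE σ e i ^ b m) = 0 := by
  have hpow : ∀ (n : ℕ) (s : S) (x : X),
      (borelE σ e i ^ n) (s ⊗ₜ[R] x) = (σ i)^[n] s ⊗ₜ (e i ^ n * x) := fun n s x => by
    induction n with
    | zero => simp
    | succ n ih =>
      rw [pow_succ', Module.End.mul_apply, ih, Function.iterate_succ_apply', pow_succ', mul_assoc]
      rfl
  refine TensorProduct.ext' fun s x => ?_
  have key : ∀ m ∈ Finset.range (N + 1),
      (c m • (borelE σ e i ^ a m * borelE σ e j * borelE σ e i ^ b m)) (s ⊗ₜ[R] x) =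
        (σ i)^[N] (σ j s) ⊗ₜ (c m • (e i ^ a m * e j * e i ^ b m) * x) := fun m hm => by
    have h1 : σ j ((σ i)^[b m] s) = (σ i)^[b m] (σ j s) :=
      Function.Commute.iterate_right (f := σ j) (g := σ i) (fun t => hσ j i t) (b m) s
    rw [LinearMap.smul_apply, Module.End.mul_apply, Module.End.mul_apply, hpow]
    change c m • (borelE σ e i ^ a m) (σ j ((σ i)^[b m] s) ⊗ₜ[R] (e j * (e i ^ b m * x))) = _
    rw [hpow, h1, ← Function.iterate_add_apply, hab m hm, ← TensorProduct.tmul_smul,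
      smul_mul_assoc, mul_assoc, mul_assoc]
  rw [LinearMap.sum_apply, Finset.sum_congr rfl key, ← TensorProduct.tmul_sum, ← Finset.sum_mul, h]
  simp

end SerreCommutation

/-! ### Truncated exponentials -/

section TruncExp

variable {k : Type*} [Field k]

/-- The truncated exponential `∑_{m < n} ħ^m x^m / m!`. -/
def texp (k : Type*) [Field k] {A : Type*} [Ring A] [Algebra k⟦X⟧ A] (n : ℕ) (x : A) : A :=
  ∑ m ∈ Finset.range n, (PowerSeries.X : k⟦X⟧) ^ m •
    ((PowerSeries.C ((m.factorial : k)⁻¹) : k⟦X⟧) • x ^ m)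

/-- The truncation of `(e^{ħ x} - e^{ħ y}) / (q - q⁻¹)`. -/
def tquot {A : Type*} [Ring A] [Algebra k⟦X⟧ A] (q : k⟦X⟧) (n : ℕ) (x y : A) : A :=
  (qden q)⁻¹ • ∑ m ∈ Finset.range n, (PowerSeries.X : k⟦X⟧) ^ m •
    ((PowerSeries.C (((m + 1).factorial : k)⁻¹) : k⟦X⟧) • (x ^ (m + 1) - y ^ (m + 1)))

theorem map_tquot {A B : Type*} [Ring A] [Algebra k⟦X⟧ A] [Ring B] [Algebra k⟦X⟧ B]
    (f : A →ₐ[k⟦X⟧] B) (q : k⟦X⟧) (n : ℕ) (x y : A) :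
    f (tquot q n x y) = tquot q n (f x) (f y) := by
  simp [tquot, map_sum]

/-- The factor ħ shifts the series by one, and the missing constant terms cancel in the difference;
hence the truncation order n + 1. -/
theorem X_smul_tquot {A : Type*} [Ring A] [Algebra k⟦X⟧ A] (q : k⟦X⟧) (n : ℕ) (x y : A) :
    (PowerSeries.X : k⟦X⟧) • tquot q n x y =
      (qden q)⁻¹ • (texp k (n + 1) x - texp k (n + 1) y) := by
  rw [tquot, smul_comm, texp, texp, ← Finset.sum_sub_distrib, Finset.sum_range_succ',
    Finset.smul_sum]
  simp [smul_smul, pow_succ', smul_sub, mul_assoc]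

theorem hexpQuot_sub_tquot_mem {A : Type*} [Ring A] [Algebra k⟦X⟧ A] (q : k⟦X⟧) (n : ℕ)
    (x y : A) :
    hexpQuot q x y - HCompletion.of k A (tquot q n x y) ∈ hPow k (HCompletion k A) n := by
  rw [hexpQuot, tquot, map_smul, ← smul_sub]
  refine Submodule.smul_mem _ _ (HCompletion.mem_hPow_iff.2 ?_)
  change (Submodule.Quotient.mk _ : A ⧸ ((hIdeal k) ^ n • ⊤ : Submodule k⟦X⟧ A)) -
    Submodule.Quotient.mk _ = 0
  exact sub_self _

/-- An algebra homomorphism to an algebra killed by `ħ^n` sends the exponential quotient to its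
truncation. -/
theorem extendAlg_hexpQuot {A B : Type*} [Ring A] [Algebra k⟦X⟧ A] [Ring B] [Algebra k⟦X⟧ B]
    [IsAdicComplete (hIdeal k) B] (f : A →ₐ[k⟦X⟧] B) {n : ℕ} (hn : hPow k B n = ⊥) (q : k⟦X⟧)
    (x y : A) : HCompletion.extendAlg f (hexpQuot q x y) = tquot q n (f x) (f y) := by
  have h := map_mem_hPow (HCompletion.extendAlg f).toLinearMap (hexpQuot_sub_tquot_mem q n x y)
  rw [hn, Submodule.mem_bot, AlgHom.toLinearMap_apply, map_sub, HCompletion.extendAlg_of,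
    sub_eq_zero, map_tquot] at h
  exact h

theorem map_texp {A B : Type*} [Ring A] [Algebra k⟦X⟧ A] [Ring B] [Algebra k⟦X⟧ B]
    (f : A →ₐ[k⟦X⟧] B) (n : ℕ) (x : A) : f (texp k n x) = texp k n (f x) := by
  simp [texp, map_sum]

theorem eq_zero_of_forall_mem_hPow_self {f : k⟦X⟧} (h : ∀ n, f ∈ hPow k k⟦X⟧ n) : f = 0 := by
  ext n
  obtain ⟨g, hg⟩ := mem_hPow.1 (h (n + 1))
  rw [← hg, smul_eq_mul, PowerSeries.coeff_X_pow_mul', if_neg (by omega), map_zero]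

variable [CharZero k]

/-- The tail of the exponential series is divisible by Xⁿ, and substituting ħc for X turns this into
divisibility by ħⁿ. -/
theorem qexp_sub_texp_mem (n : ℕ) (c : k⟦X⟧) : qexp c - texp k n c ∈ hPow k k⟦X⟧ n := by
  have hs : PowerSeries.HasSubst (PowerSeries.X * c : k⟦X⟧) :=
    PowerSeries.HasSubst.of_constantCoeff_zero' (by simp)
  have h1 : (PowerSeries.X : k⟦X⟧) ^ n ∣ PowerSeries.exp k -
      ∑ m ∈ Finset.range n, ((m.factorial : k)⁻¹) • (PowerSeries.X : k⟦X⟧) ^ m := by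
    rw [PowerSeries.X_pow_dvd_iff]
    intro m hm
    simp [PowerSeries.coeff_exp, PowerSeries.coeff_X_pow, hm]
  obtain ⟨g, hg⟩ := h1
  have h2 := congrArg (PowerSeries.substAlgHom hs) hg
  rw [map_sub, map_sum, map_mul, map_pow, PowerSeries.substAlgHom_X, mul_pow] at h2
  simp only [map_smul, map_pow, PowerSeries.substAlgHom_X] at h2
  rw [mem_hPow]
  refine ⟨c ^ n * PowerSeries.substAlgHom hs g, ?_⟩
  rw [smul_eq_mul, ← mul_assoc, ← h2, PowerSeries.coe_substAlgHom, qexp, texp]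
  congr 1
  refine Finset.sum_congr rfl fun m _ => ?_
  rw [PowerSeries.smul_eq_C_mul, smul_eq_mul, smul_eq_mul, mul_pow]
  ring

/-- Modulo ħⁿ the element ħx is nilpotent and the truncation is its true exponential, so the
addition formula for commuting nilpotents applies. -/
theorem texp_add_sub_mem {A : Type*} [CommRing A] [Algebra k⟦X⟧ A] (n : ℕ) (x y : A) :
    texp k n (x + y) - texp k n x * texp k n y ∈ hPow k A n := by
  let J : Ideal A := Ideal.span {algebraMap k⟦X⟧ A (PowerSeries.X ^ n)}
  let Q := A ⧸ J
  let : Module ℚ Q := Module.compHom Q (algebraMap ℚ k⟦X⟧)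
  have hX : (algebraMap k⟦X⟧ Q PowerSeries.X) ^ n = 0 := by
    rw [← map_pow, IsScalarTower.algebraMap_apply k⟦X⟧ A Q]
    exact Ideal.Quotient.eq_zero_iff_mem.2 (Ideal.mem_span_singleton_self _)
  have hnil : ∀ x : Q, (algebraMap k⟦X⟧ Q PowerSeries.X * x) ^ n = 0 := fun x => by
    rw [mul_pow, hX, zero_mul]
  have hexp : ∀ x : A, Ideal.Quotient.mk J (texp k n x) =
      IsNilpotent.exp (algebraMap k⟦X⟧ Q PowerSeries.X * Ideal.Quotient.mk J x) := fun x => by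
    rw [IsNilpotent.exp_eq_sum (hnil _)]
    change Ideal.Quotient.mkₐ k⟦X⟧ J (texp k n x) = _
    rw [texp, map_sum]
    refine Finset.sum_congr rfl fun m _ => ?_
    change _ = algebraMap ℚ k⟦X⟧ ((m.factorial : ℚ)⁻¹) •
      (algebraMap k⟦X⟧ Q PowerSeries.X * Ideal.Quotient.mk J x) ^ m
    have : algebraMap ℚ k⟦X⟧ ((m.factorial : ℚ)⁻¹) = PowerSeries.C ((m.factorial : k)⁻¹) := by
      rw [IsScalarTower.algebraMap_apply ℚ k k⟦X⟧]
      simp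
    rw [this, map_smul, map_smul, mul_pow, smul_comm, ← map_pow, ← map_pow, ← Algebra.smul_def]
    rfl
  have h : Ideal.Quotient.mk J (texp k n (x + y) - texp k n x * texp k n y) = 0 := by
    rw [map_sub, map_mul, hexp, hexp, hexp, map_add, mul_add, IsNilpotent.exp_add_of_commute (Commute.all _ _) ⟨n, hnil _⟩ ⟨n, hnil _⟩, sub_self]
  obtain ⟨a, ha⟩ := Ideal.mem_span_singleton.1 (Ideal.Quotient.eq_zero_iff_mem.1 h)
  rw [ha, ← Algebra.smul_def]
  exact X_pow_smul_mem_hPow _ _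

/-- Shifts of the Cartan variables become scalar factors e^{ħc}; this reduces the Serre identities
to scalar ones. -/
theorem texp_add_algebraMap_sub_mem {A : Type*} [CommRing A] [Algebra k⟦X⟧ A] (n : ℕ) (x : A)
    (c : k⟦X⟧) :
    texp k n (x + algebraMap k⟦X⟧ A c) - qexp c • texp k n x ∈ hPow k A n := by
  have h1 := texp_add_sub_mem (k := k) n x (algebraMap k⟦X⟧ A c)
  have h2 := mul_mem_hPow (k := k) (texp k n x)
    (map_mem_hPow (Algebra.linearMap k⟦X⟧ A) (qexp_sub_texp_mem n c))
  have h3 : algebraMap k⟦X⟧ A (texp k n c) = texp k n (algebraMap k⟦X⟧ A c) :=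
    map_texp (Algebra.ofId k⟦X⟧ A) n c
  rw [Algebra.linearMap_apply, map_sub, h3] at h2
  rw [Algebra.smul_def]
  convert Submodule.sub_mem _ h1 h2 using 1
  ring

theorem qexp_add (a b : k⟦X⟧) : qexp (a + b) = qexp a * qexp b := by
  rw [← sub_eq_zero]
  refine eq_zero_of_forall_mem_hPow_self fun n => ?_
  have h1 := texp_add_algebraMap_sub_mem n a b
  have h2 := qexp_sub_texp_mem n (a + b)
  have h3 := mul_mem_hPow (qexp b) (qexp_sub_texp_mem n a)
  rw [Algebra.algebraMap_self_apply, smul_eq_mul] at h1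
  convert Submodule.sub_mem _ (Submodule.add_mem _ h1 h2) h3 using 1
  ring

theorem qexp_zero : qexp (0 : k⟦X⟧) = 1 := by
  have h := qexp_add (0 : k⟦X⟧) 0
  have h0 : qexp (0 : k⟦X⟧) ≠ 0 := fun h0 => by simpa [h0] using constantCoeff_qexp (0 : k⟦X⟧)
  rw [add_zero] at h
  exact (mul_eq_left₀ h0).1 h.symm

theorem qexp_mul_qexp_neg (a : k⟦X⟧) : qexp a * qexp (-a) = 1 := by
  rw [← qexp_add, add_neg_cancel, qexp_zero]

theorem qexp_natCast_mul (n : ℕ) (a : k⟦X⟧) : qexp ((n : k⟦X⟧) * a) = qexp a ^ n := by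
  induction n with
  | zero => simp [qexp_zero]
  | succ n ih => rw [Nat.cast_succ, add_one_mul, qexp_add, ih, pow_succ]

theorem qexp_mul_inv (a : k⟦X⟧) : qexp a * (qexp a)⁻¹ = 1 :=
  PowerSeries.mul_inv_cancel _ (by simp [constantCoeff_qexp])

theorem inv_qexp (a : k⟦X⟧) : (qexp a)⁻¹ = qexp (-a) := by
  have h0 : qexp a ≠ 0 := left_ne_zero_of_mul_eq_one (qexp_mul_inv a)
  exact mul_left_cancel₀ h0 ((qexp_mul_inv a).trans (qexp_mul_qexp_neg a).symm)

/-- A linear relation between exponentials yields a relation between shifted exponential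
quotients. -/
theorem sum_smul_tquot_mem {A : Type*} [CommRing A] [Algebra k⟦X⟧ A] [Module.IsTorsionFree k⟦X⟧ A]
    {ι : Type*} (s : Finset ι) (l a b : ι → k⟦X⟧) (ha : ∑ i ∈ s, l i * qexp (a i) = 0)
    (hb : ∑ i ∈ s, l i * qexp (b i) = 0) (q : k⟦X⟧) (n : ℕ) (x y : A) :
    ∑ i ∈ s, l i • tquot q n (x + algebraMap k⟦X⟧ A (a i)) (y + algebraMap k⟦X⟧ A (b i)) ∈
      hPow k A n := by
  have key : ∀ (x : A) (a : ι → k⟦X⟧), ∑ i ∈ s, l i * qexp (a i) = 0 →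
      ∑ i ∈ s, l i • texp k (n + 1) (x + algebraMap k⟦X⟧ A (a i)) ∈ hPow k A (n + 1) := by
    intro x a ha
    have h1 : ∑ i ∈ s, l i • (texp k (n + 1) (x + algebraMap k⟦X⟧ A (a i)) -
        qexp (a i) • texp k (n + 1) x) ∈ hPow k A (n + 1) :=
      Submodule.sum_mem _ fun i _ => Submodule.smul_mem _ _ (texp_add_algebraMap_sub_mem _ _ _)
    simpa only [smul_sub, Finset.sum_sub_distrib, smul_smul, ← Finset.sum_smul, ha, zero_smul,
      sub_zero] using h1
  -- Times ħ, the sum is a combination of exponentials truncated at order n + 1, hence divisible by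
  -- ħⁿ⁺¹; torsion-freeness then cancels one ħ.
  have h : (PowerSeries.X : k⟦X⟧) • ∑ i ∈ s, l i •
      tquot q n (x + algebraMap k⟦X⟧ A (a i)) (y + algebraMap k⟦X⟧ A (b i)) ∈
        hPow k A (n + 1) := by
    have h2 := Submodule.smul_mem _ (qden q)⁻¹ (Submodule.sub_mem _ (key x a ha) (key y b hb))
    rw [← Finset.sum_sub_distrib, Finset.smul_sum] at h2
    rw [Finset.smul_sum]
    convert h2 using 2 with i
    rw [smul_comm, X_smul_tquot, smul_comm, smul_sub]
  obtain ⟨z, hz⟩ := mem_hPow.1 h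
  rw [pow_succ', mul_smul] at hz
  rw [← smul_right_injective A (PowerSeries.X_ne_zero (R := k)) hz]
  exact X_pow_smul_mem_hPow _ _

end TruncExp

/-! ### `q`-binomial identities -/

section QIdentities

theorem qInt_add {k : Type*} [Field k] (q : k⟦X⟧) (a b : ℕ) :
    qInt q (a + b) = q ^ a * qInt q b + q⁻¹ ^ b * qInt q a := by
  rw [qInt, qInt, qInt, Finset.sum_range_add, add_comm, Finset.mul_sum, Finset.mul_sum]
  congr 1
  · refine Finset.sum_congr rfl fun s hs => ?_
    have := Finset.mem_range.1 hs
    rw [pow_add, mul_assoc, show a + b - 1 - (a + s) = b - 1 - s by omega]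
  · refine Finset.sum_congr rfl fun s hs => ?_
    have := Finset.mem_range.1 hs
    rw [show a + b - 1 - s = b + (a - 1 - s) by omega, pow_add]
    ring

variable {k : Type*} [Field k] {q : k⟦X⟧} (hq : PowerSeries.constantCoeff q = 1)

include hq

theorem mul_inv_of_constantCoeff : q * q⁻¹ = 1 :=
  PowerSeries.mul_inv_cancel _ (by simp [hq])

theorem constantCoeff_inv_of_eq_one : PowerSeries.constantCoeff q⁻¹ = 1 := by
  simp [hq]

theorem qInt_inv (n : ℕ) : qInt q⁻¹ n = qInt q n := by
  have hqq : q⁻¹⁻¹ = q := by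
    have h1 := mul_inv_of_constantCoeff hq
    have h2 := mul_inv_of_constantCoeff (constantCoeff_inv_of_eq_one hq)
    calc q⁻¹⁻¹ = q * q⁻¹ * q⁻¹⁻¹ := by rw [h1, one_mul]
      _ = q := by rw [mul_assoc, h2, mul_one]
  rw [qInt, qInt, hqq, ← Finset.sum_range_reflect]
  refine Finset.sum_congr rfl fun s hs => ?_
  have := Finset.mem_range.1 hs
  rw [mul_comm, show n - 1 - (n - 1 - s) = s by omega]

theorem qBinom_inv (n m : ℕ) : qBinom q⁻¹ n m = qBinom q n m := by
  simp only [qBinom, qFact, qInt_inv hq]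

theorem sum_inv_sq_pow (r : ℕ) :
    ∑ b ∈ Finset.range (r + 1), (q⁻¹ ^ 2) ^ b = q⁻¹ ^ r * qInt q (r + 1) := by
  rw [qInt, Finset.mul_sum, ← Finset.sum_range_reflect]
  refine Finset.sum_congr rfl fun s hs => ?_
  have hs' : s ≤ r := Nat.lt_succ_iff.1 (Finset.mem_range.1 hs)
  obtain ⟨t, rfl⟩ := Nat.exists_eq_add_of_le hs'
  have h1 : q ^ s * q⁻¹ ^ s = 1 := by rw [← mul_pow, mul_inv_of_constantCoeff hq, one_pow]
  rw [show s + t + 1 - 1 - s = t by omega, pow_add, ← pow_mul]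
  linear_combination (- q⁻¹ ^ t * q⁻¹ ^ t) * h1

theorem constantCoeff_qFact (n : ℕ) : PowerSeries.constantCoeff (qFact q n) = n.factorial := by
  rw [qFact, map_prod, ← Finset.prod_range_add_one_eq_factorial, Nat.cast_prod]
  refine Finset.prod_congr rfl fun s _ => ?_
  simp [qInt, map_sum, hq]

variable [CharZero k]

theorem qBinom_mul_qFact (n m : ℕ) : qBinom q n m * (qFact q m * qFact q (n - m)) = qFact q n := by
  rw [qBinom, mul_assoc, mul_comm (_)⁻¹, PowerSeries.mul_inv_cancel, mul_one]
  rw [map_mul, constantCoeff_qFact hq, constantCoeff_qFact hq]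
  exact mul_ne_zero (Nat.cast_ne_zero.2 (Nat.factorial_ne_zero _))
    (Nat.cast_ne_zero.2 (Nat.factorial_ne_zero _))

theorem qFact_ne_zero (n : ℕ) : qFact q n ≠ 0 := fun h => by
  have := constantCoeff_qFact hq n
  rw [h, map_zero] at this
  exact Nat.factorial_ne_zero n (by exact_mod_cast this.symm)

theorem qBinom_zero_right (n : ℕ) : qBinom q n 0 = 1 := by
  refine mul_right_cancel₀ (qFact_ne_zero hq n) ?_
  have := qBinom_mul_qFact hq n 0
  rw [Nat.sub_zero, show qFact q 0 = 1 by simp [qFact], one_mul] at this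
  rw [this, one_mul]

theorem qBinom_self (n : ℕ) : qBinom q n n = 1 := by
  refine mul_right_cancel₀ (qFact_ne_zero hq n) ?_
  have := qBinom_mul_qFact hq n n
  rw [Nat.sub_self, show qFact q 0 = 1 by simp [qFact], mul_one] at this
  rw [this, one_mul]

theorem qBinom_succ_mul_qInt {n m : ℕ} (h : m < n) :
    qBinom q n (m + 1) * qInt q (m + 1) = qBinom q n m * qInt q (n - m) := by
  refine mul_right_cancel₀ (mul_ne_zero (qFact_ne_zero hq m) (qFact_ne_zero hq (n - (m + 1)))) ?_
  have h1 := qBinom_mul_qFact hq n (m + 1)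
  have h2 := qBinom_mul_qFact hq n m
  have h3 : qFact q (n - m) = qFact q (n - (m + 1)) * qInt q (n - m) := by
    rw [show n - m = n - (m + 1) + 1 by omega, qFact, Finset.prod_range_succ, qFact]
  have h4 : qFact q (m + 1) = qFact q m * qInt q (m + 1) := by
    rw [qFact, Finset.prod_range_succ, qFact]
  rw [h4] at h1
  rw [h3] at h2
  linear_combination h1 - h2

/-- Pascal's rule: clear the factorials and split [n+1] along n + 1 = (m + 1) + (n - m) with
`qInt_add`. -/
theorem qBinom_succ_succ {n m : ℕ} (h : m < n) :
    qBinom q (n + 1) (m + 1) = q ^ (m + 1) * qBinom q n (m + 1) + q⁻¹ ^ (n - m) * qBinom q n m := by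
  refine mul_right_cancel₀
    (mul_ne_zero (qFact_ne_zero hq (m + 1)) (qFact_ne_zero hq (n - m))) ?_
  have h0 := qBinom_mul_qFact hq (n + 1) (m + 1)
  have h1 := qBinom_mul_qFact hq n (m + 1)
  have h2 := qBinom_mul_qFact hq n m
  have h3 : qFact q (n - m) = qFact q (n - (m + 1)) * qInt q (n - m) := by
    rw [show n - m = n - (m + 1) + 1 by omega, qFact, Finset.prod_range_succ, qFact]
  have h4 : qFact q (m + 1) = qFact q m * qInt q (m + 1) := by
    rw [qFact, Finset.prod_range_succ, qFact]
  have h5 : qFact q (n + 1) = qFact q n * qInt q (n + 1) := by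
    rw [qFact, Finset.prod_range_succ, qFact]
  have h6 := qInt_add q (m + 1) (n - m)
  rw [show m + 1 + (n - m) = n + 1 by omega] at h6
  rw [show n + 1 - (m + 1) = n - m by omega, h5, h6] at h0
  have h7 : qBinom q n (m + 1) * (qFact q (m + 1) * qFact q (n - m)) =
      qFact q n * qInt q (n - m) := by rw [← h1, h3]; ring
  have h8 : qBinom q n m * (qFact q (m + 1) * qFact q (n - m)) =
      qFact q n * qInt q (m + 1) := by rw [← h2, h4]; ring
  linear_combination h0 - q ^ (m + 1) * h7 - q⁻¹ ^ (n - m) * h8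

/-- The vanishing of the alternating sum of `q`-binomial coefficients. -/
theorem sum_qBinom_eq_zero (n : ℕ) :
    ∑ m ∈ Finset.range (n + 1 + 1), (-1) ^ m * qBinom q (n + 1) m * (q ^ n) ^ m = 0 := by
  -- By Pascal's rule the partial sums have a closed form; the one for M = n cancels the top term.
  have key : ∀ M ≤ n, ∑ m ∈ Finset.range (M + 1), (-1) ^ m * qBinom q (n + 1) m * (q ^ n) ^ m =
      (-1) ^ M * (q ^ (n + 1)) ^ M * qBinom q n M := by
    intro M hM
    induction M with
    | zero => simp [qBinom_zero_right hq]
    | succ M ih =>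
      rw [Finset.sum_range_succ, ih (by omega), qBinom_succ_succ hq (by omega)]
      obtain ⟨r, rfl⟩ := Nat.exists_eq_add_of_le (show M ≤ n by omega)
      have h1 : q ^ r * q⁻¹ ^ r = 1 := by rw [← mul_pow, mul_inv_of_constantCoeff hq, one_pow]
      rw [show M + r - M = r by omega]
      have h2 : (q ^ (M + r)) ^ (M + 1) * q⁻¹ ^ r = (q ^ (M + r + 1)) ^ M := by
        rw [show (q ^ (M + r)) ^ (M + 1) = (q ^ (M + r + 1)) ^ M * q ^ r by ring, mul_assoc, h1,
          mul_one]
      linear_combination (-1) ^ (M + 1) * qBinom q (M + r) M * h2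
  rw [Finset.sum_range_succ, key n le_rfl, qBinom_self hq, qBinom_self hq]
  ring

theorem sum_qBinom_inv_eq_zero (n : ℕ) :
    ∑ m ∈ Finset.range (n + 1 + 1), (-1) ^ m * qBinom q (n + 1) m * (q⁻¹ ^ n) ^ m = 0 := by
  have := sum_qBinom_eq_zero (constantCoeff_inv_of_eq_one hq) n
  simpa only [qBinom_inv hq] using this

/-- The relation between consecutive coefficients of the quantum Serre element. -/
theorem serre_consecutive {n m : ℕ} (h : m < n + 1) {z v : k⟦X⟧} (hz : z * v = q ^ n) :
    (-1) ^ (m + 1) * qBinom q (n + 1) (m + 1) * z ^ (m + 1) *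
        ∑ b ∈ Finset.range (m + 1), (q⁻¹ ^ 2) ^ b * v * (q⁻¹ ^ 2) ^ (n - m) +
      (-1) ^ m * qBinom q (n + 1) m * z ^ m *
        ∑ b ∈ Finset.range (n + 1 - m), (q⁻¹ ^ 2) ^ b = 0 := by
  obtain ⟨r, rfl⟩ := Nat.exists_eq_add_of_le (Nat.lt_succ_iff.1 h)
  have h1 : q ^ (m + r) * q⁻¹ ^ (m + r) = 1 := by
    rw [← mul_pow, mul_inv_of_constantCoeff hq, one_pow]
  have h2 := qBinom_succ_mul_qInt hq h
  -- Both sums are geometric, equal to q^(-m)[m+1] and q^(-r)[r+1] up to a constant factor. The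
  -- ratio of consecutive binomials and z v = q^n then leave the factor 1 - q^n q^(-n).
  rw [← Finset.sum_mul, ← Finset.sum_mul, show m + r + 1 - m = r + 1 by omega,
    show m + r - m = r by omega, sum_inv_sq_pow hq, sum_inv_sq_pow hq]
  rw [show m + r + 1 - m = r + 1 by omega] at h2
  have h3 : q⁻¹ ^ m * (q⁻¹ ^ 2) ^ r = q⁻¹ ^ (m + r) * q⁻¹ ^ r := by ring
  calc _ = (-1) ^ m * z ^ m * (-(qBinom q (m + r + 1) (m + 1) * qInt q (m + 1)) * (z * v) *
        (q⁻¹ ^ m * (q⁻¹ ^ 2) ^ r) + qBinom q (m + r + 1) m * qInt q (r + 1) * q⁻¹ ^ r) := by ring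
    _ = (-1) ^ m * z ^ m * (qBinom q (m + r + 1) m * qInt q (r + 1) * q⁻¹ ^ r *
        (1 - q ^ (m + r) * q⁻¹ ^ (m + r))) := by rw [h2, hz, h3]; ring
    _ = 0 := by rw [h1]; ring

end QIdentities

/-! ### Shifts of the Cartan part -/

section Shift

variable {k : Type*} [Field k] {h : Type*} [AddCommGroup h] [Module k⟦X⟧ h]

/-- The endomorphism `T ↦ T - a(T)` of the symmetric algebra. -/
def shiftHom (a : Module.Dual k⟦X⟧ h) :
    SymmetricAlgebra k⟦X⟧ h →ₐ[k⟦X⟧] SymmetricAlgebra k⟦X⟧ h :=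
  SymmetricAlgebra.lift (SymmetricAlgebra.ι k⟦X⟧ h - Algebra.linearMap k⟦X⟧ _ ∘ₗ a)

theorem shiftHom_ι (a : Module.Dual k⟦X⟧ h) (t : h) :
    shiftHom a (SymmetricAlgebra.ι k⟦X⟧ h t) =
      SymmetricAlgebra.ι k⟦X⟧ h t - algebraMap k⟦X⟧ _ (a t) :=
  SymmetricAlgebra.lift_ι_apply _ _

theorem shiftHom_comp (a b : Module.Dual k⟦X⟧ h) :
    (shiftHom a).comp (shiftHom b) = shiftHom (a + b) := by
  ext t
  simp [shiftHom_ι, sub_sub]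

theorem shiftHom_zero : shiftHom (0 : Module.Dual k⟦X⟧ h) = AlgHom.id _ _ := by
  ext t
  simp [shiftHom_ι]

/-- The automorphism `T ↦ T - a(T)` of the symmetric algebra. -/
def shift (a : Module.Dual k⟦X⟧ h) : SymmetricAlgebra k⟦X⟧ h ≃ₐ[k⟦X⟧] SymmetricAlgebra k⟦X⟧ h :=
  AlgEquiv.ofAlgHom (shiftHom a) (shiftHom (-a))
    (by rw [shiftHom_comp, add_neg_cancel, shiftHom_zero])
    (by rw [shiftHom_comp, neg_add_cancel, shiftHom_zero])

theorem shift_ι (a : Module.Dual k⟦X⟧ h) (t : h) :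
    shift a (SymmetricAlgebra.ι k⟦X⟧ h t) =
      SymmetricAlgebra.ι k⟦X⟧ h t - algebraMap k⟦X⟧ _ (a t) :=
  shiftHom_ι a t

theorem shift_shift_comm (a b : Module.Dual k⟦X⟧ h) (x : SymmetricAlgebra k⟦X⟧ h) :
    shift a (shift b x) = shift b (shift a x) := by
  change ((shiftHom a).comp (shiftHom b)) x = ((shiftHom b).comp (shiftHom a)) x
  rw [shiftHom_comp, shiftHom_comp, add_comm]

/-- The scalars are carried along so that shifts can be iterated; they move in opposite directions
because the second argument contains -T'. -/
theorem shift_tquot (a : Module.Dual k⟦X⟧ h) (q : k⟦X⟧) (n : ℕ) (t t' : h) (c c' : k⟦X⟧) :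
    shift a (tquot q n (SymmetricAlgebra.ι k⟦X⟧ h t + algebraMap k⟦X⟧ _ c)
      (-SymmetricAlgebra.ι k⟦X⟧ h t' + algebraMap k⟦X⟧ _ c')) =
    tquot q n (SymmetricAlgebra.ι k⟦X⟧ h t + algebraMap k⟦X⟧ _ (c - a t))
      (-SymmetricAlgebra.ι k⟦X⟧ h t' + algebraMap k⟦X⟧ _ (c' + a t')) := by
  refine (map_tquot (shiftHom a) q n _ _).trans ?_
  simp only [map_add, map_neg, shiftHom_ι, AlgHom.commutes, map_sub]
  congr 1 <;> ring

theorem iterate_shift_sum {ι : Type*} (a : Module.Dual k⟦X⟧ h) (r : ℕ) (s : Finset ι)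
    (f : ι → SymmetricAlgebra k⟦X⟧ h) :
    (shift a)^[r] (∑ i ∈ s, f i) = ∑ i ∈ s, (shift a)^[r] (f i) := by
  induction r with
  | zero => rfl
  | succ r ih => simp only [Function.iterate_succ_apply', ih, map_sum]

theorem iterate_shift_tquot (a : Module.Dual k⟦X⟧ h) (q : k⟦X⟧) (n : ℕ) (t t' : h) (c c' : k⟦X⟧)
    (r : ℕ) :
    (shift a)^[r] (tquot q n (SymmetricAlgebra.ι k⟦X⟧ h t + algebraMap k⟦X⟧ _ c)
      (-SymmetricAlgebra.ι k⟦X⟧ h t' + algebraMap k⟦X⟧ _ c')) =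
    tquot q n (SymmetricAlgebra.ι k⟦X⟧ h t + algebraMap k⟦X⟧ _ (c - r * a t))
      (-SymmetricAlgebra.ι k⟦X⟧ h t' + algebraMap k⟦X⟧ _ (c' + r * a t')) := by
  induction r with
  | zero => simp
  | succ r ih =>
    rw [Function.iterate_succ_apply', ih, shift_tquot, Nat.cast_succ, add_one_mul, add_one_mul,
      sub_sub, add_assoc]

/-- The ideal generated by `ħ^n` in the symmetric algebra. -/
abbrev hIdealSym (k h : Type*) [Field k] [AddCommGroup h] [Module k⟦X⟧ h] (n : ℕ) :
    Ideal (SymmetricAlgebra k⟦X⟧ h) :=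
  Ideal.span {algebraMap k⟦X⟧ _ (PowerSeries.X ^ n)}

/-- The reduction modulo `ħ^n` of the symmetric algebra. -/
abbrev SymQuot (k h : Type*) [Field k] [AddCommGroup h] [Module k⟦X⟧ h] (n : ℕ) : Type _ :=
  SymmetricAlgebra k⟦X⟧ h ⧸ hIdealSym k h n

/-- The reduction map modulo `ħ^n`. -/
abbrev SymQuot.mk (k h : Type*) [Field k] [AddCommGroup h] [Module k⟦X⟧ h] (n : ℕ) :
    SymmetricAlgebra k⟦X⟧ h →ₐ[k⟦X⟧] SymQuot k h n :=
  Ideal.Quotient.mkₐ k⟦X⟧ (hIdealSym k h n)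

theorem SymQuot.mk_eq_zero_iff {n : ℕ} {x : SymmetricAlgebra k⟦X⟧ h} :
    SymQuot.mk k h n x = 0 ↔ x ∈ hPow k (SymmetricAlgebra k⟦X⟧ h) n := by
  rw [Ideal.Quotient.mkₐ_eq_mk, Ideal.Quotient.eq_zero_iff_mem, Ideal.mem_span_singleton, mem_hPow]
  simp only [Algebra.smul_def, dvd_iff_exists_eq_mul_right, eq_comm]

/-- The automorphism of the reduced symmetric algebra induced by a shift. -/
def shiftQuot (n : ℕ) (a : Module.Dual k⟦X⟧ h) : SymQuot k h n ≃ₐ[k⟦X⟧] SymQuot k h n :=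
  Ideal.quotientEquivAlg _ _ (shift a) (by
    rw [Ideal.map_span, Set.image_singleton]
    exact congrArg (fun x => Ideal.span {x}) ((shift a).commutes _).symm)

theorem shiftQuot_mk (n : ℕ) (a : Module.Dual k⟦X⟧ h) (x : SymmetricAlgebra k⟦X⟧ h) :
    shiftQuot n a (SymQuot.mk k h n x) = SymQuot.mk k h n (shift a x) := rfl

theorem iterate_shiftQuot_mk (n : ℕ) (a : Module.Dual k⟦X⟧ h) (r : ℕ)
    (x : SymmetricAlgebra k⟦X⟧ h) :
    (shiftQuot n a)^[r] (SymQuot.mk k h n x) = SymQuot.mk k h n ((shift a)^[r] x) := by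
  induction r with
  | zero => rfl
  | succ r ih => rw [Function.iterate_succ_apply', Function.iterate_succ_apply', ih, shiftQuot_mk]

theorem shiftQuot_comm (n : ℕ) (a b : Module.Dual k⟦X⟧ h) (x : SymQuot k h n) :
    shiftQuot n a (shiftQuot n b x) = shiftQuot n b (shiftQuot n a x) := by
  obtain ⟨x, rfl⟩ := Ideal.Quotient.mkₐ_surjective k⟦X⟧ _ x
  rw [shiftQuot_mk, shiftQuot_mk, shiftQuot_mk, shiftQuot_mk, shift_shift_comm]

end Shift

/-! ### The Serre identities -/

section Identities

variable {k : Type*} [Field k] [CharZero k] {I : Type*}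
  {A : Matrix I I ℤ} {d : I → ℕ} (hA : IsSymmetrizableGCM A d)
  {P : Matrix I I k⟦X⟧} (hP : IsCartanType A d P)

theorem qexp_eq_sq (a : k⟦X⟧) : qexp a = qexp (PowerSeries.C ((2 : k)⁻¹) * a) ^ 2 := by
  rw [← qexp_natCast_mul, ← mul_assoc]
  congr 1
  have : ((2 : ℕ) : k⟦X⟧) * PowerSeries.C ((2 : k)⁻¹) = 1 := by
    rw [← map_natCast (PowerSeries.C (R := k)), ← map_mul]
    simp
  rw [this, one_mul]

include hP

/-- Only the symmetric part of P enters: half of p_ij + p_ji is d_i a_ij. -/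
theorem qexp_half_mul_qexp_half {i j : I} {n : ℕ} (hn : A i j = -n) :
    qexp (PowerSeries.C ((2 : k)⁻¹) * P i j) * qexp (PowerSeries.C ((2 : k)⁻¹) * P j i) =
      (qexp (d i : k⟦X⟧))⁻¹ ^ n := by
  rw [← qexp_add, ← mul_add, hP i j, hn, inv_qexp, ← qexp_natCast_mul]
  congr 1
  have : PowerSeries.C ((2 : k)⁻¹) * (2 : k⟦X⟧) = 1 := by
    rw [← map_ofNat (PowerSeries.C (R := k)) 2, ← map_mul]
    simp
  push_cast
  linear_combination (-(n : k⟦X⟧) * d i) * this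

include hA

theorem qexp_diag (i : I) : qexp (P i i) = qexp (d i : k⟦X⟧) ^ 2 := by
  rw [← qexp_natCast_mul]
  congr 1
  have h1 := hP i i
  rw [hA.diag] at h1
  have h2 : (2 : k⟦X⟧) ≠ 0 := fun h => by
    have := congrArg PowerSeries.constantCoeff h
    rw [map_ofNat, map_zero] at this
    exact two_ne_zero this
  refine mul_left_cancel₀ h2 ?_
  push_cast at h1 ⊢
  linear_combination h1

variable {h : Type*} [AddCommGroup h] [Module k⟦X⟧ h] [Module.Free k⟦X⟧ h] (ρ : Realization P h)

/-- The truncated commutator `[E_i, F_i]` modulo `ħ^n`. -/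
def cartanElt {k : Type*} [Field k] [CharZero k] {I : Type*} (d : I → ℕ) {P : Matrix I I k⟦X⟧}
    {h : Type*} [AddCommGroup h] [Module k⟦X⟧ h] (ρ : Realization P h) (n : ℕ) (i : I) :
    SymmetricAlgebra k⟦X⟧ h :=
  tquot (qexp (d i : k⟦X⟧)) n (SymmetricAlgebra.ι k⟦X⟧ h (ρ.Tp i))
    (-SymmetricAlgebra.ι k⟦X⟧ h (ρ.Tm i))

/-- By `sum_smul_tquot_mem` each identity splits into scalar identities for e^{ħT⁺} and for
e^{-ħT⁻}. With u = e^{ħp_ij/2}, v = e^{ħp_ji/2} and r = -a_ij, the twist u/v of the Serre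
coefficients combines with the shift factors u⁻² and v² to q_i^r and q_i^(-r). So the multiparameter
survives only in common factors, and one-parameter q-binomial identities remain. -/
theorem serreIdentities (n : ℕ) {i j : I} (hij : i ≠ j) :
    SerreIdentities (fun i => shiftQuot n (ρ.α i)) (fun i => SymQuot.mk k h n (cartanElt d ρ n i))
      (1 - A i j).toNat (serreCoeff A d P i j) i j := by
  obtain ⟨r, hr⟩ : ∃ r : ℕ, A i j = -r :=
    ⟨(-A i j).toNat, by have := hA.nonpos i j hij; omega⟩
  have hN : (1 - A i j).toNat = r + 1 := by omega
  have hq := constantCoeff_qexp (d i : k⟦X⟧)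
  have hqq := mul_inv_of_constantCoeff hq
  have hu := qexp_mul_inv (PowerSeries.C ((2 : k)⁻¹) * P i j)
  have hv := qexp_mul_inv (PowerSeries.C ((2 : k)⁻¹) * P j i)
  have huv := qexp_half_mul_qexp_half hP hr
  have hcoeff : ∀ m, serreCoeff A d P i j m = (-1) ^ m * qBinom (qexp (d i : k⟦X⟧)) (r + 1) m *
      (qexp (PowerSeries.C ((2 : k)⁻¹) * P i j) *
        (qexp (PowerSeries.C ((2 : k)⁻¹) * P j i))⁻¹) ^ m := fun m => by
    rw [serreCoeff, hN, mul_pow, mul_assoc]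
  have ha2 := qexp_eq_sq (P i j)
  have hb2 := qexp_eq_sq (P j i)
  have hd := qexp_diag hA hP i
  have hneg : ∀ a : k⟦X⟧, qexp (-a) = (qexp a)⁻¹ := fun a => (inv_qexp a).symm
  have hinv2 : ∀ {x y : k⟦X⟧}, x * x⁻¹ = 1 → y = x ^ 2 → y * y⁻¹ = 1 → y⁻¹ = x⁻¹ ^ 2 :=
    fun {x y} h1 h2 h3 => by
      have h4 : y * x⁻¹ ^ 2 = 1 := by rw [h2, ← mul_pow, h1, one_pow]
      exact mul_left_cancel₀ (left_ne_zero_of_mul_eq_one h3) (h3.trans h4.symm)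
  have ha2' := hinv2 hu ha2 (qexp_mul_inv _)
  have hb2' := hinv2 hv hb2 (qexp_mul_inv _)
  have hd' := hinv2 hqq hd (qexp_mul_inv _)
  rw [hN]
  set q := qexp (d i : k⟦X⟧) with hqdef
  set u := qexp (PowerSeries.C ((2 : k)⁻¹) * P i j)
  set v := qexp (PowerSeries.C ((2 : k)⁻¹) * P j i)
  have huv' : u⁻¹ * v⁻¹ = q ^ r := by
    have h1 : q ^ r * q⁻¹ ^ r = 1 := by rw [← mul_pow, hqq, one_pow]
    calc u⁻¹ * v⁻¹ = (q ^ r * q⁻¹ ^ r) * (u⁻¹ * v⁻¹) := by rw [h1, one_mul]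
      _ = q ^ r * (u * u⁻¹) * (v * v⁻¹) := by rw [← huv]; ring
      _ = q ^ r := by rw [hu, hv, mul_one, mul_one]
  have hT : ∀ i, cartanElt d ρ n i = tquot (qexp (d i : k⟦X⟧)) n
      (SymmetricAlgebra.ι k⟦X⟧ h (ρ.Tp i) + algebraMap k⟦X⟧ _ 0)
      (-SymmetricAlgebra.ι k⟦X⟧ h (ρ.Tm i) + algebraMap k⟦X⟧ _ 0) := fun i => by
    rw [map_zero, add_zero, add_zero, cartanElt]
  have hzq : u * v⁻¹ * u⁻¹ ^ 2 = q ^ r := by linear_combination huv' + (v⁻¹ * u⁻¹) * hu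
  have hzq' : u * v⁻¹ * v ^ 2 = q⁻¹ ^ r := by linear_combination huv + (u * v) * hv
  constructor
  · simp only [iterate_shiftQuot_mk, ← map_smul, ← map_sum]
    rw [SymQuot.mk_eq_zero_iff]
    simp only [hT, iterate_shift_tquot, ρ.root_Tp, ρ.root_Tm]
    refine sum_smul_tquot_mem _ _ _ _ ?_ ?_ _ n _ _
    -- The (N-m)-fold shift contributes v^(-2(N-m)); extracting v^(-2N) leaves the alternating sum
    -- at q⁻¹. The exponentials of T⁻ similarly give the sum at q, after extracting u^(2N).
    · have key : ∀ m ∈ Finset.range (r + 1 + 1), serreCoeff A d P i j m *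
          qexp (0 - ((r + 1 - m : ℕ) : k⟦X⟧) * P j i) = (v⁻¹ ^ 2) ^ (r + 1) *
            ((-1) ^ m * qBinom q (r + 1) m * (q⁻¹ ^ r) ^ m) := fun m hm => by
        obtain ⟨s, hs⟩ := Nat.exists_eq_add_of_le (Nat.lt_succ_iff.1 (Finset.mem_range.1 hm))
        have h1 : (v⁻¹ ^ 2) ^ m * (v ^ 2) ^ m = 1 := by
          rw [← mul_pow, ← mul_pow, mul_comm, hv, one_pow, one_pow]
        rw [zero_sub, ← mul_neg, qexp_natCast_mul, hneg, hb2', hcoeff, hs, Nat.add_sub_cancel_left,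
          ← hzq', mul_pow _ (v ^ 2), pow_add]
        linear_combination (-(-1) ^ m * qBinom q (m + s) m * (u * v⁻¹) ^ m * (v⁻¹ ^ 2) ^ s) * h1
      rw [Finset.sum_congr rfl key, ← Finset.mul_sum, sum_qBinom_inv_eq_zero hq, mul_zero]
    · have key : ∀ m ∈ Finset.range (r + 1 + 1), serreCoeff A d P i j m *
          qexp (0 + ((r + 1 - m : ℕ) : k⟦X⟧) * P i j) = (u ^ 2) ^ (r + 1) *
            ((-1) ^ m * qBinom q (r + 1) m * (q ^ r) ^ m) := fun m hm => by
        obtain ⟨s, hs⟩ := Nat.exists_eq_add_of_le (Nat.lt_succ_iff.1 (Finset.mem_range.1 hm))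
        have h1 : (u ^ 2) ^ m * (u⁻¹ ^ 2) ^ m = 1 := by
          rw [← mul_pow, ← mul_pow, hu, one_pow, one_pow]
        rw [zero_add, qexp_natCast_mul, ha2, hcoeff, hs, Nat.add_sub_cancel_left,
          ← hzq, mul_pow _ (u⁻¹ ^ 2), pow_add]
        linear_combination (-(-1) ^ m * qBinom q (m + s) m * (u * v⁻¹) ^ m * (u ^ 2) ^ s) * h1
      rw [Finset.sum_congr rfl key, ← Finset.mul_sum, sum_qBinom_eq_zero hq, mul_zero]
  · intro m hm
    simp only [iterate_shiftQuot_mk, shiftQuot_mk, ← map_smul, ← map_sum, ← map_add]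
    rw [SymQuot.mk_eq_zero_iff]
    simp only [hT, iterate_shift_tquot, iterate_shift_sum, map_sum, shift_tquot, ρ.root_Tp,
      ρ.root_Tm, Finset.smul_sum]
    -- The two sums are indexed by one disjoint union, so that they form a single linear relation
    -- among exponentials.
    have hsum := sum_smul_tquot_mem (A := SymmetricAlgebra k⟦X⟧ h)
      ((Finset.range (m + 1)).disjSum (Finset.range (r + 1 - m)))
      (Sum.elim (fun _ => serreCoeff A d P i j (m + 1)) (fun _ => serreCoeff A d P i j m))
      (Sum.elim (fun b => 0 - (b : k⟦X⟧) * P i i - P i j - ((r + 1 - 1 - m : ℕ) : k⟦X⟧) * P i i)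
        (fun b => 0 - (b : k⟦X⟧) * P i i))
      (Sum.elim (fun b => 0 + (b : k⟦X⟧) * P i i + P j i + ((r + 1 - 1 - m : ℕ) : k⟦X⟧) * P i i)
        (fun b => 0 + (b : k⟦X⟧) * P i i)) ?_ ?_ q n (SymmetricAlgebra.ι k⟦X⟧ h (ρ.Tp i))
        (-SymmetricAlgebra.ι k⟦X⟧ h (ρ.Tm i))
    · simpa only [Finset.sum_disjSum, Sum.elim_inl, Sum.elim_inr] using hsum
    · simp only [Finset.sum_disjSum, Sum.elim_inl, Sum.elim_inr, ← Finset.mul_sum]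
      have h1 : ∀ b : ℕ, qexp (0 - (b : k⟦X⟧) * P i i) = (q⁻¹ ^ 2) ^ b := fun b => by
        rw [zero_sub, ← mul_neg, qexp_natCast_mul, hneg, hd']
      have h2 : ∀ b : ℕ, qexp (0 - (b : k⟦X⟧) * P i i - P i j -
          ((r + 1 - 1 - m : ℕ) : k⟦X⟧) * P i i) = (q⁻¹ ^ 2) ^ b * u⁻¹ ^ 2 * (q⁻¹ ^ 2) ^ (r - m) :=
        fun b => by
          rw [sub_eq_add_neg _ (P i j), sub_eq_add_neg, qexp_add, qexp_add, h1, hneg, ha2',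
            ← zero_sub (_ * _), h1, Nat.add_sub_cancel]
      simp only [h1, h2, hcoeff]
      exact serre_consecutive hq hm hzq
    · simp only [Finset.sum_disjSum, Sum.elim_inl, Sum.elim_inr, ← Finset.mul_sum]
      have h1 : ∀ b : ℕ, qexp (0 + (b : k⟦X⟧) * P i i) = (q ^ 2) ^ b := fun b => by
        rw [zero_add, qexp_natCast_mul, hd]
      have h2 : ∀ b : ℕ, qexp (0 + (b : k⟦X⟧) * P i i + P j i +
          ((r + 1 - 1 - m : ℕ) : k⟦X⟧) * P i i) = (q ^ 2) ^ b * v ^ 2 * (q ^ 2) ^ (r - m) :=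
        fun b => by
          rw [qexp_add, qexp_add, h1, hb2, qexp_natCast_mul, hd, Nat.add_sub_cancel]
      simp only [h1, h2, hcoeff]
      -- The exponentials of T⁻ are the same case with q replaced by q⁻¹, under which q-binomials
      -- are invariant.
      have h3 := serre_consecutive (constantCoeff_inv_of_eq_one hq) hm hzq'
      have h4 : q⁻¹⁻¹ = q := by
        rw [hqdef, inv_qexp, inv_qexp, neg_neg]
      rwa [qBinom_inv hq, qBinom_inv hq, h4] at h3

end Identities

/-! ### Algebra homomorphisms out of symmetric algebras -/

section SymLift

variable {R M B : Type*} [CommRing R] [AddCommGroup M] [Module R M] [Ring B] [Algebra R B]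

/-- The universal property asks for a commutative target, so `f` is first restricted to the
commutative subalgebra generated by its image. -/
theorem exists_symmetricAlgebra_lift (f : M →ₗ[R] B) (hf : ∀ x y, f x * f y = f y * f x) :
    ∃ g : SymmetricAlgebra R M →ₐ[R] B, ∀ x, g (SymmetricAlgebra.ι R M x) = f x := by
  let C := Algebra.adjoin R (Set.range f)
  have : IsMulCommutative C := Algebra.isMulCommutative_adjoin R (by
    rintro _ ⟨x, rfl⟩ _ ⟨y, rfl⟩
    exact hf x y)
  let : CommRing C := { (inferInstance : Ring C) with mul_comm := this.is_comm.comm }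
  let f' : M →ₗ[R] C := f.codRestrict (Subalgebra.toSubmodule C)
    fun x => Algebra.subset_adjoin ⟨x, rfl⟩
  exact ⟨C.val.comp (SymmetricAlgebra.lift f'), fun x => by
    rw [AlgHom.comp_apply, SymmetricAlgebra.lift_ι_apply]
    rfl⟩

theorem adjoin_range_ι_symmetricAlgebra :
    Algebra.adjoin R (Set.range (SymmetricAlgebra.ι R M)) = ⊤ := by
  rw [eq_top_iff]
  rintro x -
  induction x using SymmetricAlgebra.induction with
  | algebraMap r => exact Subalgebra.algebraMap_mem _ r
  | ι m => exact Algebra.subset_adjoin ⟨m, rfl⟩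
  | mul a b ha hb => exact Subalgebra.mul_mem _ ha hb
  | add a b ha hb => exact Subalgebra.add_mem _ ha hb

end SymLift

/-! ### Left ideals and generation -/

section Generation

variable {R B : Type*} [CommRing R] [Ring B] [Algebra R B]

theorem mul_mem_of_mem_adjoin {s : Set B} {W : Submodule R B}
    (h : ∀ a ∈ s, ∀ w ∈ W, a * w ∈ W) {b w : B} (hb : b ∈ Algebra.adjoin R s) (hw : w ∈ W) :
    b * w ∈ W := by
  induction hb using Algebra.adjoin_induction generalizing w with
  | mem a ha => exact h a ha w hw
  | algebraMap r => rw [← Algebra.smul_def]; exact W.smul_mem r hw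
  | add a b _ _ ha hb => rw [add_mul]; exact W.add_mem (ha hw) (hb hw)
  | mul a b _ _ ha hb => rw [mul_assoc]; exact ha (hb hw)

theorem adjoin_le_of_mul_mem {s : Set B} {W : Submodule R B} (h1 : 1 ∈ W)
    (h : ∀ a ∈ s, ∀ w ∈ W, a * w ∈ W) : Subalgebra.toSubmodule (Algebra.adjoin R s) ≤ W :=
  fun b hb => mul_one b ▸ mul_mem_of_mem_adjoin h hb h1

/-- The product of the images of two linear maps to an algebra. -/
def mul₂ {L M : Type*} [AddCommGroup L] [Module R L] [AddCommGroup M] [Module R M]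
    (f : L →ₗ[R] B) (g : M →ₗ[R] B) : L ⊗[R] M →ₗ[R] B :=
  LinearMap.mul' R B ∘ₗ TensorProduct.map f g

@[simp]
theorem mul₂_tmul {L M : Type*} [AddCommGroup L] [Module R L] [AddCommGroup M] [Module R M]
    (f : L →ₗ[R] B) (g : M →ₗ[R] B) (x : L) (y : M) : mul₂ f g (x ⊗ₜ y) = f x * g y := by
  simp [mul₂]

theorem range_mul₂_le {L M : Type*} [AddCommGroup L] [Module R L] [AddCommGroup M] [Module R M]
    {f : L →ₗ[R] B} {g : M →ₗ[R] B} {W : Submodule R B} (h : ∀ x y, f x * g y ∈ W) :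
    LinearMap.range (mul₂ f g) ≤ W := by
  rintro _ ⟨z, rfl⟩
  induction z with
  | zero => rw [map_zero]; exact W.zero_mem
  | tmul x y => rw [mul₂_tmul]; exact h x y
  | add a b ha hb => rw [map_add]; exact W.add_mem ha hb

theorem mul_mem_of_mem_range_mul₂ {L M : Type*} [AddCommGroup L] [Module R L] [AddCommGroup M]
    [Module R M] {f : L →ₗ[R] B} {g : M →ₗ[R] B} {W : Submodule R B} {b w : B}
    (h : ∀ x y, b * (f x * g y) ∈ W) (hw : w ∈ LinearMap.range (mul₂ f g)) : b * w ∈ W :=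
  range_mul₂_le (W := W.comap (LinearMap.mulLeft R b)) h hw

theorem mul_mem_range_mul₂ {L M : Type*} [AddCommGroup L] [Module R L] [AddCommGroup M]
    [Module R M] (f : L →ₗ[R] B) (g : M →ₗ[R] B) (x : L) (y : M) :
    f x * g y ∈ LinearMap.range (mul₂ f g) :=
  ⟨x ⊗ₜ y, mul₂_tmul f g x y⟩

variable {S X Y I : Type*} [CommRing S] [Algebra R S] [Ring X] [Algebra R X] [Ring Y] [Algebra R Y]
  {x : I → X} {y : I → Y} {j₀ : S →ₐ[R] B} {jX : X →ₐ[R] B} {jY : Y →ₐ[R] B}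
  {σ : I → S ≃ₐ[R] S}

/-- The Cartan factor moves right through the x_i one at a time and is twisted at each step, so the
induction must treat all `t` at once. -/
theorem j₀_mul_jX_mem (hx : Algebra.adjoin R (Set.range x) = ⊤)
    (h : ∀ i t, j₀ t * jX (x i) = jX (x i) * j₀ (σ i t)) {W : Submodule R B}
    (hWX : ∀ i, ∀ w ∈ W, jX (x i) * w ∈ W) {b : B} (hb : ∀ t, j₀ t * b ∈ W) (a : X) (t : S) :
    j₀ t * (jX a * b) ∈ W := by
  let V : Submodule R X := ⨅ t, W.comap
    (LinearMap.mulLeft R (j₀ t) ∘ₗ LinearMap.mulRight R b ∘ₗ jX.toLinearMap)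
  have hV : ∀ a, a ∈ V ↔ ∀ t, j₀ t * (jX a * b) ∈ W := fun a => by
    simp [V, Submodule.mem_iInf]
  have : Subalgebra.toSubmodule (Algebra.adjoin R (Set.range x)) ≤ V := by
    refine adjoin_le_of_mul_mem ((hV 1).2 fun t => ?_) ?_
    · rw [map_one, one_mul]; exact hb t
    · rintro _ ⟨i, rfl⟩ w hw
      refine (hV _).2 fun t => ?_
      rw [map_mul, mul_assoc, ← mul_assoc, h, mul_assoc]
      exact hWX i _ ((hV w).1 hw _)
  rw [hx] at this
  exact (hV a).1 (this (Algebra.mem_top (R := R))) t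

theorem range_mul₂_left (hx : Algebra.adjoin R (Set.range x) = ⊤) {s : Set S}
    (hs : Algebra.adjoin R s = ⊤) (h : ∀ i t, j₀ t * jX (x i) = jX (x i) * j₀ (σ i t)) :
    LinearMap.range (mul₂ jX.toLinearMap j₀.toLinearMap) = Subalgebra.toSubmodule
      (Algebra.adjoin R (j₀ '' s ∪ Set.range fun i => jX (x i))) := by
  refine le_antisymm (range_mul₂_le fun a t => Subalgebra.mul_mem _ ?_ ?_) ?_
  · have h1 : jX a ∈ (Algebra.adjoin R (Set.range x)).map jX := ⟨a, by rw [hx]; trivial, rfl⟩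
    rw [AlgHom.map_adjoin, ← Set.range_comp] at h1
    exact Algebra.adjoin_mono Set.subset_union_right h1
  · have h1 : j₀ t ∈ (Algebra.adjoin R s).map j₀ := ⟨t, by rw [hs]; trivial, rfl⟩
    rw [AlgHom.map_adjoin] at h1
    exact Algebra.adjoin_mono Set.subset_union_left h1
  · have hWX : ∀ i, ∀ w ∈ LinearMap.range (mul₂ jX.toLinearMap j₀.toLinearMap),
        jX (x i) * w ∈ LinearMap.range (mul₂ jX.toLinearMap j₀.toLinearMap) := fun i w hw =>
      mul_mem_of_mem_range_mul₂ (fun a t => by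
        rw [AlgHom.toLinearMap_apply, ← mul_assoc, ← map_mul jX]
        exact mul_mem_range_mul₂ jX.toLinearMap j₀.toLinearMap (x i * a) t) hw
    refine adjoin_le_of_mul_mem ?_ ?_
    · simpa using mul_mem_range_mul₂ jX.toLinearMap j₀.toLinearMap 1 1
    · rintro _ (⟨t, -, rfl⟩ | ⟨i, rfl⟩) w hw
      · exact mul_mem_of_mem_range_mul₂ (fun a s =>
          j₀_mul_jX_mem hx h hWX (fun t' => by
            simpa using mul_mem_range_mul₂ jX.toLinearMap j₀.toLinearMap 1 (t' * s)) a t) hw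
      · exact hWX i w hw

/-- In this order x_i has to cross the Cartan factor from left to right, which uses the inverse of
σ_i. -/
theorem range_mul₂_right (hx : Algebra.adjoin R (Set.range x) = ⊤) {s : Set S}
    (hs : Algebra.adjoin R s = ⊤) (h : ∀ i t, j₀ t * jX (x i) = jX (x i) * j₀ (σ i t)) :
    LinearMap.range (mul₂ j₀.toLinearMap jX.toLinearMap) = Subalgebra.toSubmodule
      (Algebra.adjoin R (j₀ '' s ∪ Set.range fun i => jX (x i))) := by
  refine le_antisymm (range_mul₂_le fun t a => Subalgebra.mul_mem _ ?_ ?_) ?_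
  · have h1 : j₀ t ∈ (Algebra.adjoin R s).map j₀ := ⟨t, by rw [hs]; trivial, rfl⟩
    rw [AlgHom.map_adjoin] at h1
    exact Algebra.adjoin_mono Set.subset_union_left h1
  · have h1 : jX a ∈ (Algebra.adjoin R (Set.range x)).map jX := ⟨a, by rw [hx]; trivial, rfl⟩
    rw [AlgHom.map_adjoin, ← Set.range_comp] at h1
    exact Algebra.adjoin_mono Set.subset_union_right h1
  · refine adjoin_le_of_mul_mem ?_ ?_
    · simpa using mul_mem_range_mul₂ j₀.toLinearMap jX.toLinearMap 1 1
    · rintro _ (⟨t, -, rfl⟩ | ⟨i, rfl⟩) w hw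
      · exact mul_mem_of_mem_range_mul₂ (fun s a => by
          simpa [mul_assoc] using mul_mem_range_mul₂ j₀.toLinearMap jX.toLinearMap (t * s) a) hw
      · exact mul_mem_of_mem_range_mul₂ (fun s a => by
          rw [AlgHom.toLinearMap_apply, AlgHom.toLinearMap_apply, ← mul_assoc]
          have := h i ((σ i).symm s)
          rw [AlgEquiv.apply_symm_apply] at this
          rw [← this, mul_assoc, ← map_mul jX]
          exact mul_mem_range_mul₂ j₀.toLinearMap jX.toLinearMap _ (x i * a)) hw

/-- If the commutators `[y_i, x_j]` lie in the image of `S` modulo a two-sided ideal `J`, then the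
subalgebra generated by `X`, `S` and `Y` is `X S Y` modulo `J`. -/
theorem adjoin_le_range_mul₃_sup (hx : Algebra.adjoin R (Set.range x) = ⊤)
    (h : ∀ i t, j₀ t * jX (x i) = jX (x i) * j₀ (σ i t))
    (h' : ∀ i t, jY (y i) * j₀ t = j₀ (σ i t) * jY (y i)) {J : Submodule R B}
    (hJl : ∀ a, ∀ b ∈ J, a * b ∈ J) (hJr : ∀ a, ∀ b ∈ J, b * a ∈ J)
    (hyx : ∀ i l, ∃ s, jY (y i) * jX (x l) - jX (x l) * jY (y i) - j₀ s ∈ J) (s : Set S) :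
    Subalgebra.toSubmodule (Algebra.adjoin R
      (j₀ '' s ∪ (Set.range (fun i => jX (x i)) ∪ Set.range fun i => jY (y i)))) ≤
    LinearMap.range (mul₂ (mul₂ jX.toLinearMap j₀.toLinearMap) jY.toLinearMap) ⊔ J := by
  set W := LinearMap.range (mul₂ (mul₂ jX.toLinearMap j₀.toLinearMap) jY.toLinearMap) ⊔ J with hW
  have hmem : ∀ a s b, jX a * (j₀ s * jY b) ∈ W := fun a s b => by
    rw [← mul_assoc]
    exact Submodule.mem_sup_left ⟨(a ⊗ₜ s) ⊗ₜ b, by simp⟩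
  have hle : ∀ V : Submodule R B, (∀ a s b, jX a * (j₀ s * jY b) ∈ V) → J ≤ V → W ≤ V := by
    intro V hV hJ
    refine sup_le ?_ hJ
    rintro _ ⟨z, rfl⟩
    induction z with
    | zero => rw [map_zero]; exact V.zero_mem
    | add a b ha hb => rw [map_add]; exact V.add_mem ha hb
    | tmul z b =>
      induction z with
      | zero => rw [TensorProduct.zero_tmul, map_zero]; exact V.zero_mem
      | add a b ha hb => rw [TensorProduct.add_tmul, map_add]; exact V.add_mem ha hb
      | tmul a s => simpa [mul_assoc] using hV a s b
  have hWX : ∀ i, ∀ w ∈ W, jX (x i) * w ∈ W := fun i => by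
    refine hle (W.comap (LinearMap.mulLeft R (jX (x i)))) (fun a s b => ?_)
      fun b hb => Submodule.mem_sup_right (hJl _ _ hb)
    rw [Submodule.mem_comap, LinearMap.mulLeft_apply, ← mul_assoc, ← map_mul jX]
    exact hmem _ s b
  have hW0' : ∀ a s b t, j₀ t * (jX a * (j₀ s * jY b)) ∈ W := fun a s b t =>
    j₀_mul_jX_mem hx h hWX (fun t' => by
      have := hmem 1 (t' * s) b
      rwa [map_one, one_mul, map_mul, mul_assoc] at this) a t
  have hWY : ∀ i, ∀ w ∈ W, jY (y i) * w ∈ W := fun i => by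
    refine hle (W.comap (LinearMap.mulLeft R (jY (y i)))) (fun a s b => ?_)
      fun b hb => Submodule.mem_sup_right (hJl _ _ hb)
    -- y_i crosses the `X`-factor by induction on that factor: at each x_l the commutator
    -- contributes a Cartan term, treated in `hW0'`, and an error in `J`.
    let V : Submodule R X := W.comap
      (LinearMap.mulLeft R (jY (y i)) ∘ₗ LinearMap.mulRight R (j₀ s * jY b) ∘ₗ jX.toLinearMap)
    have hV : Subalgebra.toSubmodule (Algebra.adjoin R (Set.range x)) ≤ V := by
      refine adjoin_le_of_mul_mem ?_ ?_
      · change jY (y i) * (jX 1 * (j₀ s * jY b)) ∈ W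
        rw [map_one, one_mul, ← mul_assoc, h', mul_assoc, ← map_mul jY]
        simpa using hmem 1 (σ i s) (y i * b)
      · rintro _ ⟨l, rfl⟩ a ha
        change jY (y i) * (jX (x l * a) * (j₀ s * jY b)) ∈ W
        replace ha : jY (y i) * (jX a * (j₀ s * jY b)) ∈ W := ha
        obtain ⟨t, ht⟩ := hyx i l
        have h1 : jY (y i) * (jX (x l * a) * (j₀ s * jY b)) =
            jX (x l) * (jY (y i) * (jX a * (j₀ s * jY b))) + j₀ t * (jX a * (j₀ s * jY b)) +
            (jY (y i) * jX (x l) - jX (x l) * jY (y i) - j₀ t) * (jX a * (j₀ s * jY b)) := by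
          rw [map_mul]
          noncomm_ring
        rw [h1]
        exact W.add_mem (W.add_mem (hWX l _ ha) (hW0' a s b t))
          (Submodule.mem_sup_right (hJr _ _ ht))
    rw [hx] at hV
    exact hV (Algebra.mem_top (R := R))
  refine adjoin_le_of_mul_mem ?_ ?_
  · simpa using hmem 1 1 1
  · rintro _ (⟨t, -, rfl⟩ | ⟨i, rfl⟩ | ⟨i, rfl⟩) w hw
    · exact hle (W.comap (LinearMap.mulLeft R (j₀ t))) (fun a s b => hW0' a s b t)
        (fun b hb => Submodule.mem_sup_right (hJl _ _ hb)) hw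
    · exact hWX i w hw
    · exact hWY i w hw

end Generation

/-! ### Tensor products and divisibility by `ħ` -/

section TensorHPow

variable {k : Type*} [Field k] {L M N : Type*} [AddCommGroup L] [Module k⟦X⟧ L]
  [AddCommGroup M] [Module k⟦X⟧ M] [AddCommGroup N] [Module k⟦X⟧ N]

/-- Right exactness of the tensor product, applied to multiplication by ħⁿ followed by `g`. -/
theorem mem_hPow_of_lTensor_eq_zero {n : ℕ} (g : M →ₗ[k⟦X⟧] N) (hg : Function.Surjective g)
    (hk : ∀ x, g x = 0 ↔ x ∈ hPow k M n) {z : L ⊗[k⟦X⟧] M} (hz : g.lTensor L z = 0) :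
    z ∈ hPow k (L ⊗[k⟦X⟧] M) n := by
  have hex : Function.Exact ((PowerSeries.X : k⟦X⟧) ^ n • (LinearMap.id : M →ₗ[k⟦X⟧] M)) g :=
    fun x => (hk x).trans (mem_hPow.trans Iff.rfl)
  obtain ⟨y, hy⟩ := (lTensor_exact L hex hg z).1 hz
  rw [LinearMap.lTensor_smul, LinearMap.lTensor_id] at hy
  exact mem_hPow.2 ⟨y, hy⟩

theorem mem_hPow_of_rTensor_eq_zero {n : ℕ} (g : M →ₗ[k⟦X⟧] N) (hg : Function.Surjective g)
    (hk : ∀ x, g x = 0 ↔ x ∈ hPow k M n) {z : M ⊗[k⟦X⟧] L} (hz : g.rTensor L z = 0) :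
    z ∈ hPow k (M ⊗[k⟦X⟧] L) n := by
  have hex : Function.Exact ((PowerSeries.X : k⟦X⟧) ^ n • (LinearMap.id : M →ₗ[k⟦X⟧] M)) g :=
    fun x => (hk x).trans (mem_hPow.trans Iff.rfl)
  obtain ⟨y, hy⟩ := (rTensor_exact L hex hg z).1 hz
  rw [LinearMap.rTensor_smul, LinearMap.rTensor_id] at hy
  exact mem_hPow.2 ⟨y, hy⟩

/-- `f : M → N` has `ħ`-adically dense image. -/
def HDense (f : M →ₗ[k⟦X⟧] N) : Prop := ∀ (n : ℕ) (y : N), ∃ x, y - f x ∈ hPow k N n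

theorem HDense.map {M' N' : Type*} [AddCommGroup M'] [Module k⟦X⟧ M'] [AddCommGroup N']
    [Module k⟦X⟧ N'] {f : M →ₗ[k⟦X⟧] N} {g : M' →ₗ[k⟦X⟧] N'} (hf : HDense f) (hg : HDense g) :
    HDense (TensorProduct.map f g) := by
  intro n z
  induction z with
  | zero => exact ⟨0, by simp⟩
  | add a b ha hb =>
    obtain ⟨x, hx⟩ := ha
    obtain ⟨y, hy⟩ := hb
    exact ⟨x + y, by rw [map_add, add_sub_add_comm]; exact Submodule.add_mem _ hx hy⟩
  | tmul a b =>
    obtain ⟨x, hx⟩ := hf n a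
    obtain ⟨y, hy⟩ := hg n b
    refine ⟨x ⊗ₜ y, ?_⟩
    have h1 := map_mem_hPow ((TensorProduct.mk k⟦X⟧ N N').flip b) hx
    have h2 := map_mem_hPow (TensorProduct.mk k⟦X⟧ N N' (f x)) hy
    have h3 : a ⊗ₜ[k⟦X⟧] b - TensorProduct.map f g (x ⊗ₜ y) =
        (a - f x) ⊗ₜ b + f x ⊗ₜ (b - g y) := by
      rw [TensorProduct.map_tmul, TensorProduct.sub_tmul, TensorProduct.tmul_sub]
      abel
    rw [h3]
    exact Submodule.add_mem _ h1 h2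

/-- Modulo ħⁿ every element of `M` comes from `L`, so testing on `L` suffices. -/
theorem ReflectsHPow.of_comp {f : M →ₗ[k⟦X⟧] N} {g : L →ₗ[k⟦X⟧] M} (hg : HDense g)
    (h : ReflectsHPow (f ∘ₗ g)) : ReflectsHPow f := by
  intro n z hz
  obtain ⟨x, hx⟩ := hg n z
  have h1 : f (g x) ∈ hPow k N n := by
    simpa using Submodule.sub_mem _ hz (map_mem_hPow f hx)
  simpa using Submodule.add_mem _ hx (map_mem_hPow g (h n x h1))

theorem ReflectsHPow.comp_of_retract {f : M →ₗ[k⟦X⟧] N} (hf : ReflectsHPow f) (g : L →ₗ[k⟦X⟧] M)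
    (r : M →ₗ[k⟦X⟧] L) (h : ∀ x, r (g x) = x) : ReflectsHPow (f ∘ₗ g) := fun n x hx =>
  h x ▸ map_mem_hPow r (hf n _ hx)

end TensorHPow

/-- The canonical map from an algebra to its completion. -/
def HCompletion.ofAlg (k : Type*) [Field k] (A : Type*) [Ring A] [Algebra k⟦X⟧ A] :
    A →ₐ[k⟦X⟧] HCompletion k A :=
  AlgHom.ofLinearMap (HCompletion.of k A) rfl fun _ _ => rfl

theorem adjoin_range_of_lift_surjective {R : Type*} [CommRing R] {B : Type*} [Ring B] [Algebra R B]
    {I : Type*} {x : I → B} (h : Function.Surjective (FreeAlgebra.lift R x)) :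
    Algebra.adjoin R (Set.range x) = ⊤ := by
  rw [Algebra.adjoin_range_eq_range_freeAlgebra_lift]
  exact (AlgHom.range_eq_top _).2 h

/-! ### The algebras presented by Serre relations and their universal property -/

section Naturality

variable {k : Type*} [Field k] [CharZero k] {I : Type*}
  (A : Matrix I I ℤ) (d : I → ℕ) (P : Matrix I I k⟦X⟧)
  {B C : Type*} [Ring B] [Algebra k⟦X⟧ B] [Ring C] [Algebra k⟦X⟧ C]

theorem map_serrePos (f : B →ₐ[k⟦X⟧] C) (x : I → B) (i j : I) :
    f (serrePos A d P x i j) = serrePos A d P (fun i => f (x i)) i j := by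
  simp [serrePos, map_sum]

theorem map_serreNeg (f : B →ₐ[k⟦X⟧] C) (x : I → B) (i j : I) :
    f (serreNeg A d P x i j) = serreNeg A d P (fun i => f (x i)) i j := by
  simp [serreNeg, map_sum]

theorem lift_serrePos (x : I → B) (i j : I) :
    FreeAlgebra.lift k⟦X⟧ x (serrePos A d P (FreeAlgebra.ι k⟦X⟧) i j) = serrePos A d P x i j := by
  simp [map_serrePos]

theorem lift_serreNeg (x : I → B) (i j : I) :
    FreeAlgebra.lift k⟦X⟧ x (serreNeg A d P (FreeAlgebra.ι k⟦X⟧) i j) = serreNeg A d P x i j := by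
  simp [map_serreNeg]

/-- The uncompleted algebra presented by the quantum Serre relations for the `E_i`. -/
abbrev PosAlg : Type _ := RingQuot (PosRel A d P)

/-- The uncompleted algebra presented by the quantum Serre relations for the `F_i`. -/
abbrev NegAlg : Type _ := RingQuot (NegRel A d P)

/-- The generators of `PosAlg`. -/
def PosAlg.gen (i : I) : PosAlg A d P :=
  RingQuot.mkAlgHom k⟦X⟧ (PosRel A d P) (FreeAlgebra.ι k⟦X⟧ i)

/-- The generators of `NegAlg`. -/
def NegAlg.gen (i : I) : NegAlg A d P :=
  RingQuot.mkAlgHom k⟦X⟧ (NegRel A d P) (FreeAlgebra.ι k⟦X⟧ i)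

theorem PosAlg.lift_gen :
    FreeAlgebra.lift k⟦X⟧ (PosAlg.gen A d P) = RingQuot.mkAlgHom k⟦X⟧ (PosRel A d P) := by
  ext i
  simp [PosAlg.gen]

theorem NegAlg.lift_gen :
    FreeAlgebra.lift k⟦X⟧ (NegAlg.gen A d P) = RingQuot.mkAlgHom k⟦X⟧ (NegRel A d P) := by
  ext i
  simp [NegAlg.gen]

theorem PosAlg.lift_gen_surjective :
    Function.Surjective (FreeAlgebra.lift k⟦X⟧ (PosAlg.gen A d P)) := by
  rw [PosAlg.lift_gen]
  exact RingQuot.mkAlgHom_surjective _ _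

theorem NegAlg.lift_gen_surjective :
    Function.Surjective (FreeAlgebra.lift k⟦X⟧ (NegAlg.gen A d P)) := by
  rw [NegAlg.lift_gen]
  exact RingQuot.mkAlgHom_surjective _ _

theorem PosAlg.serre {i j : I} (hij : i ≠ j) : serrePos A d P (PosAlg.gen A d P) i j = 0 := by
  rw [← lift_serrePos, PosAlg.lift_gen, RingQuot.mkAlgHom_rel k⟦X⟧ (PosRel.serre i j hij), map_zero]

theorem NegAlg.serre {i j : I} (hij : i ≠ j) : serreNeg A d P (NegAlg.gen A d P) i j = 0 := by
  rw [← lift_serreNeg, NegAlg.lift_gen, RingQuot.mkAlgHom_rel k⟦X⟧ (NegRel.serre i j hij), map_zero]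

/-- The homomorphism from `PosAlg` given by elements satisfying the quantum Serre relations. -/
def PosAlg.lift (x : I → B) (hx : ∀ i j, i ≠ j → serrePos A d P x i j = 0) :
    PosAlg A d P →ₐ[k⟦X⟧] B :=
  RingQuot.liftAlgHom k⟦X⟧ ⟨FreeAlgebra.lift k⟦X⟧ x, by
    rintro _ _ ⟨i, j, hij⟩
    rw [lift_serrePos, hx i j hij, map_zero]⟩

/-- The homomorphism from `NegAlg` given by elements satisfying the quantum Serre relations. -/
def NegAlg.lift (x : I → B) (hx : ∀ i j, i ≠ j → serreNeg A d P x i j = 0) :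
    NegAlg A d P →ₐ[k⟦X⟧] B :=
  RingQuot.liftAlgHom k⟦X⟧ ⟨FreeAlgebra.lift k⟦X⟧ x, by
    rintro _ _ ⟨i, j, hij⟩
    rw [lift_serreNeg, hx i j hij, map_zero]⟩

variable {A d P}

theorem PosAlg.lift_apply_gen {x : I → B} (hx : ∀ i j, i ≠ j → serrePos A d P x i j = 0) (i : I) :
    PosAlg.lift A d P x hx (PosAlg.gen A d P i) = x i := by
  rw [PosAlg.lift, PosAlg.gen, RingQuot.liftAlgHom_mkAlgHom_apply, FreeAlgebra.lift_ι_apply]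

theorem NegAlg.lift_apply_gen {x : I → B} (hx : ∀ i j, i ≠ j → serreNeg A d P x i j = 0) (i : I) :
    NegAlg.lift A d P x hx (NegAlg.gen A d P i) = x i := by
  rw [NegAlg.lift, NegAlg.gen, RingQuot.liftAlgHom_mkAlgHom_apply, FreeAlgebra.lift_ι_apply]

end Naturality

/-! ### Relations and homomorphisms of `U` -/

section U

variable {k : Type*} [Field k] [CharZero k] {I : Type*}
  {h : Type*} [AddCommGroup h] [Module k⟦X⟧ h]
  (A : Matrix I I ℤ) (d : I → ℕ) {P : Matrix I I k⟦X⟧} (ρ : Realization P h)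

/-- The canonical homomorphism from the completed free algebra to `U`. -/
def U.ofFree : FreeC k I h →ₐ[k⟦X⟧] U A d ρ :=
  (HCompletion.ofAlg k _).comp (RingQuot.mkAlgHom k⟦X⟧ (URel A d ρ))

theorem U.ofFree_fgen (g : Gen I h) : U.ofFree A d ρ (fgen k g) = U.gen A d ρ g := rfl

variable {A d ρ} in
theorem U.ofFree_rel {x y : FreeC k I h} (hxy : URel A d ρ x y) :
    U.ofFree A d ρ x = U.ofFree A d ρ y :=
  congrArg (HCompletion.ofAlg k _) (RingQuot.mkAlgHom_rel k⟦X⟧ hxy)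

/-- The generators `T` of `U`, as a linear map. -/
def U.genT : h →ₗ[k⟦X⟧] U A d ρ where
  toFun t := U.gen A d ρ (.T t)
  map_add' t t' := (U.ofFree_rel (URel.add t t')).trans (map_add (U.ofFree A d ρ) _ _)
  map_smul' c t := (U.ofFree_rel (URel.smul c t)).trans (map_smul (U.ofFree A d ρ) _ _)

theorem U.exists_ofSym : ∃ g : SymmetricAlgebra k⟦X⟧ h →ₐ[k⟦X⟧] U A d ρ,
    ∀ t, g (SymmetricAlgebra.ι k⟦X⟧ h t) = U.gen A d ρ (.T t) :=
  exists_symmetricAlgebra_lift (U.genT A d ρ) fun t t' => by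
    have h1 := U.ofFree_rel (URel.comm_T (A := A) (d := d) (ρ := ρ) t t')
    rwa [map_mul, map_mul] at h1

/-- The homomorphism from the symmetric algebra to `U`. -/
def U.ofSym : SymmetricAlgebra k⟦X⟧ h →ₐ[k⟦X⟧] U A d ρ := (U.exists_ofSym A d ρ).choose

theorem U.ofSym_ι (t : h) :
    U.ofSym A d ρ (SymmetricAlgebra.ι k⟦X⟧ h t) = U.gen A d ρ (.T t) :=
  (U.exists_ofSym A d ρ).choose_spec t

theorem U.serreE {i j : I} (hij : i ≠ j) :
    serrePos A d P (fun i => U.gen A d ρ (.E i)) i j = 0 := by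
  have h := U.ofFree_rel (URel.serreE (A := A) (d := d) (ρ := ρ) i j hij)
  rwa [map_serrePos, map_zero] at h

theorem U.serreF {i j : I} (hij : i ≠ j) :
    serreNeg A d P (fun i => U.gen A d ρ (.F i)) i j = 0 := by
  have h := U.ofFree_rel (URel.serreF (A := A) (d := d) (ρ := ρ) i j hij)
  rwa [map_serreNeg, map_zero] at h

/-- The homomorphism to `U` from the algebra generated by the `E_i`. -/
def U.ofPos : PosAlg A d P →ₐ[k⟦X⟧] U A d ρ :=
  PosAlg.lift A d P (fun i => U.gen A d ρ (.E i)) fun _ _ => U.serreE A d ρ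

/-- The homomorphism to `U` from the algebra generated by the `F_i`. -/
def U.ofNeg : NegAlg A d P →ₐ[k⟦X⟧] U A d ρ :=
  NegAlg.lift A d P (fun i => U.gen A d ρ (.F i)) fun _ _ => U.serreF A d ρ

theorem U.ofPos_gen (i : I) : U.ofPos A d ρ (PosAlg.gen A d P i) = U.gen A d ρ (.E i) :=
  PosAlg.lift_apply_gen _ i

theorem U.ofNeg_gen (i : I) : U.ofNeg A d ρ (NegAlg.gen A d P i) = U.gen A d ρ (.F i) :=
  NegAlg.lift_apply_gen _ i

theorem U.E_mul_ofSym (i : I) (t : SymmetricAlgebra k⟦X⟧ h) :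
    U.gen A d ρ (.E i) * U.ofSym A d ρ t =
      U.ofSym A d ρ (shift (ρ.α i) t) * U.gen A d ρ (.E i) := by
  induction t using SymmetricAlgebra.induction with
  | algebraMap r => simp [Algebra.commutes]
  | ι t =>
    have h1 := U.ofFree_rel (URel.comm_TE (A := A) (d := d) (ρ := ρ) t i)
    simp only [map_sub, map_mul, map_smul, U.ofFree_fgen] at h1
    rw [shift_ι, map_sub, U.ofSym_ι, AlgHom.commutes, sub_mul, ← Algebra.smul_def, ← h1]
    abel
  | mul a b ha hb => rw [map_mul, map_mul, map_mul, ← mul_assoc, ha, mul_assoc, hb, mul_assoc]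
  | add a b ha hb => rw [map_add, map_add, map_add, mul_add, add_mul, ha, hb]

theorem U.ofSym_mul_F (i : I) (t : SymmetricAlgebra k⟦X⟧ h) :
    U.ofSym A d ρ t * U.gen A d ρ (.F i) =
      U.gen A d ρ (.F i) * U.ofSym A d ρ (shift (ρ.α i) t) := by
  induction t using SymmetricAlgebra.induction with
  | algebraMap r => simp [Algebra.commutes]
  | ι t =>
    have h1 := U.ofFree_rel (URel.comm_TF (A := A) (d := d) (ρ := ρ) t i)
    simp only [map_sub, map_mul, map_neg, map_smul, U.ofFree_fgen] at h1
    rw [shift_ι, map_sub, U.ofSym_ι, AlgHom.commutes, mul_sub, ← Algebra.commutes,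
      ← Algebra.smul_def, sub_eq_add_neg, ← h1]
    abel
  | mul a b ha hb => rw [map_mul, map_mul, map_mul, mul_assoc, hb, ← mul_assoc, ha, mul_assoc]
  | add a b ha hb => rw [map_add, map_add, map_add, mul_add, add_mul, ha, hb]

theorem U.E_mul_F_of_ne {i j : I} (hij : i ≠ j) :
    U.gen A d ρ (.E i) * U.gen A d ρ (.F j) - U.gen A d ρ (.F j) * U.gen A d ρ (.E i) = 0 := by
  have h1 := U.ofFree_rel (URel.comm_EF_ne (A := A) (d := d) (ρ := ρ) i j hij)
  simpa only [map_sub, map_mul, map_zero, U.ofFree_fgen] using h1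

/-- The commutator is given by a convergent series; the symmetric algebra is not completed and
supplies only its truncations. -/
theorem U.E_mul_F_self_sub_mem (n : ℕ) (i : I) :
    U.gen A d ρ (.E i) * U.gen A d ρ (.F i) - U.gen A d ρ (.F i) * U.gen A d ρ (.E i) -
      U.ofSym A d ρ (cartanElt d ρ n i) ∈ hPow k (U A d ρ) n := by
  have h1 := U.ofFree_rel (URel.comm_EF (A := A) (d := d) (ρ := ρ) i)
  simp only [map_sub, map_mul, U.ofFree_fgen] at h1
  have h2 := map_mem_hPow (U.ofFree A d ρ).toLinearMap (hexpQuot_sub_tquot_mem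
    (qexp (d i : k⟦X⟧)) n (FreeAlgebra.ι k⟦X⟧ (Gen.T (ρ.Tp i)))
      (-FreeAlgebra.ι k⟦X⟧ (Gen.T (ρ.Tm i))))
  have h3 : U.ofFree A d ρ (HCompletion.of k _ (tquot (qexp (d i : k⟦X⟧)) n
      (FreeAlgebra.ι k⟦X⟧ (Gen.T (ρ.Tp i))) (-FreeAlgebra.ι k⟦X⟧ (Gen.T (ρ.Tm i))))) =
      U.ofSym A d ρ (cartanElt d ρ n i) := by
    rw [cartanElt, map_tquot, map_neg, U.ofSym_ι, U.ofSym_ι]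
    refine (map_tquot ((U.ofFree A d ρ).comp (HCompletion.ofAlg k _)) _ _ _ _).trans ?_
    rw [map_neg]
    rfl
  rw [AlgHom.toLinearMap_apply, map_sub, h3, ← h1] at h2
  exact h2

/-- A representation of the relations modulo `ħ^n` gives a homomorphism from `U`. -/
theorem U.exists_lift {n : ℕ} {B : Type*} [Ring B] [Algebra k⟦X⟧ B]
    (r : TriRep (fun i => shiftQuot n (ρ.α i)) (fun i => SymQuot.mk k h n (cartanElt d ρ n i)) B)
    (hE : ∀ i j, i ≠ j → serrePos A d P r.E i j = 0)
    (hF : ∀ i j, i ≠ j → serreNeg A d P r.F i j = 0) :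
    hPow k B n = ⊥ ∧ ∃ φ : U A d ρ →ₐ[k⟦X⟧] B,
      (∀ t, φ (U.gen A d ρ (.T t)) = r.τ (SymQuot.mk k h n (SymmetricAlgebra.ι k⟦X⟧ h t))) ∧
      (∀ i, φ (U.gen A d ρ (.E i)) = r.E i) ∧ ∀ i, φ (U.gen A d ρ (.F i)) = r.F i := by
  have hX : ∀ b : B, (PowerSeries.X : k⟦X⟧) ^ n • b = 0 := fun b => by
    have h1 : algebraMap k⟦X⟧ (SymQuot k h n) (PowerSeries.X ^ n) = 0 := by
      rw [← (SymQuot.mk k h n).commutes, SymQuot.mk_eq_zero_iff, Algebra.algebraMap_eq_smul_one]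
      exact X_pow_smul_mem_hPow n _
    rw [Algebra.smul_def, ← r.τ.commutes, h1, map_zero, zero_mul]
  have hbot : hPow k B n = ⊥ := by
    rw [eq_bot_iff]
    intro b hb
    obtain ⟨c, rfl⟩ := mem_hPow.1 hb
    exact hX c
  -- Being killed by ħⁿ, `B` is complete, so homomorphisms extend over both completions made in
  -- forming U.
  have : IsAdicComplete (hIdeal k) B := isAdicComplete_of_X_pow_smul hX
  let g : Gen I h → B := fun
    | .T t => r.τ (SymQuot.mk k h n (SymmetricAlgebra.ι k⟦X⟧ h t))
    | .E i => r.E i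
    | .F i => r.F i
  let f₁ : FreeC k I h →ₐ[k⟦X⟧] B := HCompletion.extendAlg (FreeAlgebra.lift k⟦X⟧ g)
  have hf₁ : ∀ x, f₁ (fgen k x) = g x := fun x => by
    rw [fgen, HCompletion.extendAlg_of, FreeAlgebra.lift_ι_apply]
  have hrel : ∀ ⦃x y⦄, URel A d ρ x y → f₁ x = f₁ y := by
    intro x y hxy
    induction hxy with
    | add t t' => simp only [map_add, hf₁, g]
    | smul c t => simp only [map_smul, hf₁, g]
    | comm_T t t' =>
      rw [map_mul, map_mul, hf₁, hf₁]
      exact (map_mul r.τ _ _).symm.trans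
        ((congrArg r.τ (mul_comm (SymQuot.mk k h n _) _)).trans (map_mul r.τ _ _))
    | comm_TE t j =>
      simp only [map_sub, map_mul, map_smul, hf₁, g]
      rw [r.E_τ, shiftQuot_mk, shift_ι, map_sub, map_sub, AlgHom.commutes, AlgHom.commutes,
        sub_mul, sub_sub_cancel, Algebra.smul_def]
    | comm_TF t j =>
      simp only [map_sub, map_mul, map_neg, map_smul, hf₁, g]
      rw [r.τ_F, shiftQuot_mk, shift_ι, map_sub, map_sub, AlgHom.commutes, AlgHom.commutes,
        mul_sub, sub_sub_cancel_left, ← Algebra.commutes, Algebra.smul_def]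
    | comm_EF_ne i j hij =>
      simp only [map_sub, map_mul, map_zero, hf₁, g]
      rw [r.EF_comm i j hij, sub_self]
    | comm_EF i =>
      have h1 := extendAlg_hexpQuot (FreeAlgebra.lift k⟦X⟧ g) hbot (qexp (d i : k⟦X⟧))
        (FreeAlgebra.ι k⟦X⟧ (Gen.T (ρ.Tp i))) (-FreeAlgebra.ι k⟦X⟧ (Gen.T (ρ.Tm i)))
      rw [map_neg, FreeAlgebra.lift_ι_apply, FreeAlgebra.lift_ι_apply] at h1
      rw [h1]
      simp only [map_sub, map_mul, hf₁, g]
      rw [r.EF, add_sub_cancel_left, cartanElt, map_tquot, map_tquot, map_neg, map_neg]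
    | serreE i j hij =>
      rw [map_serrePos, map_zero]
      simp only [hf₁]
      exact hE i j hij
    | serreF i j hij =>
      rw [map_serreNeg, map_zero]
      simp only [hf₁]
      exact hF i j hij
  let f₂ : RingQuot (URel A d ρ) →ₐ[k⟦X⟧] B := RingQuot.liftAlgHom k⟦X⟧ ⟨f₁, hrel⟩
  have hgen : ∀ x, HCompletion.extendAlg f₂ (U.gen A d ρ x) = g x := fun x => by
    rw [U.gen, HCompletion.extendAlg_of, RingQuot.liftAlgHom_mkAlgHom_apply, hf₁]
  exact ⟨hbot, HCompletion.extendAlg f₂, fun t => hgen (.T t), fun i => hgen (.E i),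
    fun i => hgen (.F i)⟩

/-- `U` is generated by its generators modulo `ħ`. -/
theorem U.adjoin_sup_eq_top :
    Subalgebra.toSubmodule (Algebra.adjoin k⟦X⟧ (Set.range (U.gen A d ρ))) ⊔
      hPow k (U A d ρ) 1 = ⊤ := by
  rw [eq_top_iff]
  rintro u -
  -- U involves two completions, so two approximations modulo ħ lead to a polynomial in the
  -- generators.
  obtain ⟨v, hv⟩ := u.exists_sub_of_mem 1
  obtain ⟨c, rfl⟩ := RingQuot.mkAlgHom_surjective k⟦X⟧ (URel A d ρ) v
  obtain ⟨p, hp⟩ := c.exists_sub_of_mem 1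
  have h1 := map_mem_hPow (U.ofFree A d ρ).toLinearMap hp
  have h2 : u - U.ofFree A d ρ (HCompletion.of k _ p) ∈ hPow k (U A d ρ) 1 := by
    have h3 := Submodule.add_mem _ hv h1
    rw [map_sub] at h3
    change u - U.ofFree A d ρ c + (U.ofFree A d ρ c - U.ofFree A d ρ _) ∈ _ at h3
    rwa [sub_add_sub_cancel] at h3
  have h4 : U.ofFree A d ρ (HCompletion.of k _ p) ∈
      Algebra.adjoin k⟦X⟧ (Set.range (U.gen A d ρ)) := by
    rw [Algebra.adjoin_range_eq_range_freeAlgebra_lift]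
    refine ⟨p, ?_⟩
    change FreeAlgebra.lift k⟦X⟧ (U.gen A d ρ) p =
      ((U.ofFree A d ρ).comp (HCompletion.ofAlg k _)) p
    congr 1
    ext g
    simp only [Function.comp_apply, FreeAlgebra.lift_ι_apply]
    rfl
  have := Submodule.add_mem_sup
    (show _ ∈ Subalgebra.toSubmodule (Algebra.adjoin k⟦X⟧ (Set.range (U.gen A d ρ))) from h4) h2
  rwa [add_sub_cancel] at this

/-- `closedAdjoin` is the closure of the generated subalgebra. -/
theorem toSubmodule_closedAdjoin (s : Set (U A d ρ)) :
    Subalgebra.toSubmodule (closedAdjoin A d ρ s) =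
      hClosure (Subalgebra.toSubmodule (Algebra.adjoin k⟦X⟧ s)) := by
  set W := Subalgebra.toSubmodule (Algebra.adjoin k⟦X⟧ s) with hW
  refine le_antisymm ?_ ?_
  · let C : Subalgebra k⟦X⟧ (U A d ρ) :=
      (hClosure W).toSubalgebra (le_hClosure W (Subalgebra.one_mem _)) fun x y hx hy => by
        rw [mem_hClosure] at hx hy ⊢
        intro n
        obtain ⟨a, ha, hxa⟩ := hx n
        obtain ⟨b, hb, hyb⟩ := hy n
        refine ⟨a * b, Subalgebra.mul_mem _ ha hb, ?_⟩
        have h1 : x * y - a * b = x * (y - b) + (x - a) * b := by noncomm_ring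
        rw [h1]
        exact Submodule.add_mem _ (mul_mem_hPow _ hyb) (mem_hPow_mul _ hxa)
    have hC : closedAdjoin A d ρ s ≤ C := by
      refine sInf_le ⟨fun x hx => le_hClosure W (Algebra.subset_adjoin hx), ?_⟩
      rw [HCompletion.isClosed_iff]
      intro x hx
      change x ∈ hClosure W
      rw [mem_hClosure]
      intro n
      obtain ⟨y, hy, hxy⟩ := hx n
      obtain ⟨w, hw, hyw⟩ := mem_hClosure.1 (show y ∈ hClosure W from hy) n
      exact ⟨w, hw, by simpa using Submodule.add_mem _ hxy hyw⟩
    exact hC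
  · intro x hx
    change x ∈ closedAdjoin A d ρ s
    rw [closedAdjoin, Algebra.mem_sInf]
    rintro C ⟨hsC, hC⟩
    rw [HCompletion.isClosed_iff] at hC
    refine hC x fun n => ?_
    obtain ⟨w, hw, hxw⟩ := mem_hClosure.1 hx n
    exact ⟨w, Algebra.adjoin_le hsC hw, hxw⟩

end U

/-! ### Reflection of divisibility by `ħ` by the multiplication maps -/

section Core

variable {k : Type*} [Field k] {I X X₀ S Y B V : Type*} [Ring X] [Algebra k⟦X⟧ X]
  [CommRing X₀] [Algebra k⟦X⟧ X₀] [CommRing S] [Algebra k⟦X⟧ S] [Ring Y] [Algebra k⟦X⟧ Y]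
  [Ring B] [Algebra k⟦X⟧ B] [AddCommGroup V] [Module k⟦X⟧ V]

theorem comp_lift_of_apply {R : Type*} [CommRing R] {A B C : Type*} [Ring A] [Algebra R A]
    [Ring B] [Algebra R B] [Ring C] [Algebra R C] {x : I → A} {E : I → C} {j : A →ₐ[R] B}
    {φ : B →ₐ[R] C} (h : ∀ i, φ (j (x i)) = E i) (a : FreeAlgebra R I) :
    φ (j (FreeAlgebra.lift R x a)) = FreeAlgebra.lift R E a := by
  have : (φ.comp j).comp (FreeAlgebra.lift R x) = FreeAlgebra.lift R E := by
    ext i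
    simp [h]
  exact DFunLike.congr_fun this a

/-- If the pure tensors `a ⊗ t ⊗ b` modulo `ħ^n` can be recovered from the action of `a t b` on a
module killed by `ħ^n`, then the multiplication map reflects divisibility by `ħ^n`. -/
theorem mem_hPow_of_mul₃_mem {n : ℕ} {mk : X₀ →ₐ[k⟦X⟧] S} (hmk : Function.Surjective mk)
    (hk : ∀ t, mk t = 0 ↔ t ∈ hPow k X₀ n) {x : I → X} {y : I → Y}
    (hx : Function.Surjective (FreeAlgebra.lift k⟦X⟧ x))
    (hy : Function.Surjective (FreeAlgebra.lift k⟦X⟧ y))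
    {jX : X →ₐ[k⟦X⟧] B} {j₀ : X₀ →ₐ[k⟦X⟧] B} {jY : Y →ₐ[k⟦X⟧] B}
    {φ : B →ₐ[k⟦X⟧] Module.End k⟦X⟧ V} (hV : hPow k (Module.End k⟦X⟧ V) n = ⊥)
    {F E : I → Module.End k⟦X⟧ V} {τ : S →ₐ[k⟦X⟧] Module.End k⟦X⟧ V}
    (hF : ∀ i, φ (jX (x i)) = F i) (hE : ∀ i, φ (jY (y i)) = E i) (hτ : ∀ t, φ (j₀ t) = τ (mk t))
    {v₀ : V} {p : V →ₗ[k⟦X⟧] X ⊗[k⟦X⟧] (S ⊗[k⟦X⟧] Y)}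
    (hp : ∀ a t b, p (FreeAlgebra.lift k⟦X⟧ F a (τ t (FreeAlgebra.lift k⟦X⟧ E b v₀))) =
      FreeAlgebra.lift k⟦X⟧ x a ⊗ₜ (t ⊗ₜ FreeAlgebra.lift k⟦X⟧ y b))
    {z : (X ⊗[k⟦X⟧] X₀) ⊗[k⟦X⟧] Y}
    (hz : mul₂ (mul₂ jX.toLinearMap j₀.toLinearMap) jY.toLinearMap z ∈ hPow k B n) :
    z ∈ hPow k ((X ⊗[k⟦X⟧] X₀) ⊗[k⟦X⟧] Y) n := by
  let g : X₀ ⊗[k⟦X⟧] Y →ₗ[k⟦X⟧] S ⊗[k⟦X⟧] Y := mk.toLinearMap.rTensor Y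
  have hg : Function.Surjective g := LinearMap.rTensor_surjective Y hmk
  have hgk : ∀ w, g w = 0 ↔ w ∈ hPow k (X₀ ⊗[k⟦X⟧] Y) n := by
    refine fun w => ⟨mem_hPow_of_rTensor_eq_zero _ hmk hk, fun hw => ?_⟩
    obtain ⟨w, rfl⟩ := mem_hPow.1 hw
    have h0 : (PowerSeries.X : k⟦X⟧) ^ n • (mk.toLinearMap : X₀ →ₗ[k⟦X⟧] S) = 0 := by
      ext t
      exact (map_smul mk _ t).symm.trans ((hk _).2 (X_pow_smul_mem_hPow n t))
    rw [map_smul, ← LinearMap.smul_apply, ← LinearMap.rTensor_smul, h0]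
    simp
  -- Acting on v₀ and applying `p` recovers the tensor with its Cartan factor reduced modulo ħⁿ.
  have key : g.lTensor X ∘ₗ (TensorProduct.assoc k⟦X⟧ X X₀ Y).toLinearMap =
      p ∘ₗ LinearMap.applyₗ v₀ ∘ₗ φ.toLinearMap ∘ₗ
        mul₂ (mul₂ jX.toLinearMap j₀.toLinearMap) jY.toLinearMap := by
    refine TensorProduct.ext_threefold fun a t b => ?_
    obtain ⟨a, rfl⟩ := hx a
    obtain ⟨b, rfl⟩ := hy b
    simp only [LinearMap.comp_apply, mul₂_tmul, AlgHom.toLinearMap_apply, LinearMap.applyₗ_apply_apply,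
      map_mul φ, Module.End.mul_apply, comp_lift_of_apply hF, comp_lift_of_apply hE, hτ, hp]
    rfl
  -- The product lies in ħⁿB, hence acts by zero; so the reduced tensor vanishes.
  have h1 : g.lTensor X (TensorProduct.assoc k⟦X⟧ X X₀ Y z) = 0 := by
    refine (LinearMap.congr_fun key z).trans ?_
    have h2 := map_mem_hPow φ.toLinearMap hz
    rw [hV, Submodule.mem_bot] at h2
    simp only [LinearMap.comp_apply, h2, map_zero]
  have h2 := map_mem_hPow (TensorProduct.assoc k⟦X⟧ X X₀ Y).symm.toLinearMap
    (mem_hPow_of_lTensor_eq_zero g hg hgk h1)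
  simpa using h2

end Core

theorem sub_add_cancel_of_mem_range {N : ℕ} : ∀ m ∈ Finset.range (N + 1), N - m + m = N :=
  fun _ hm => Nat.sub_add_cancel (Nat.lt_succ_iff.1 (Finset.mem_range.1 hm))

theorem add_sub_cancel_of_mem_range {N : ℕ} : ∀ m ∈ Finset.range (N + 1), m + (N - m) = N :=
  fun _ hm => Nat.add_sub_cancel' (Nat.lt_succ_iff.1 (Finset.mem_range.1 hm))

section SymQuot

variable {k : Type*} [Field k] {h : Type*} [AddCommGroup h] [Module k⟦X⟧ h]

theorem SymQuot.mk_surjective (n : ℕ) : Function.Surjective (SymQuot.mk k h n) :=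
  Ideal.Quotient.mkₐ_surjective _ _

theorem shiftQuot_symm_comm (n : ℕ) (a b : Module.Dual k⟦X⟧ h) (x : SymQuot k h n) :
    (shiftQuot n a).symm ((shiftQuot n b).symm x) =
      (shiftQuot n b).symm ((shiftQuot n a).symm x) := by
  rw [AlgEquiv.symm_apply_eq, AlgEquiv.symm_apply_eq, shiftQuot_comm, AlgEquiv.apply_symm_apply,
    AlgEquiv.apply_symm_apply]

end SymQuot

/-! ### The triangular products reflect divisibility by powers of ħ -/

section Reflects

set_option maxSynthPendingDepth 3

variable {k : Type*} [Field k] [CharZero k] {I : Type*}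
  {h : Type*} [AddCommGroup h] [Module k⟦X⟧ h]
  {A : Matrix I I ℤ} {d : I → ℕ} {P : Matrix I I k⟦X⟧} (ρ : Realization P h)

theorem U.comp_ofSym_eq {B : Type*} [Ring B] [Algebra k⟦X⟧ B] {n : ℕ} {φ : U A d ρ →ₐ[k⟦X⟧] B}
    {τ : SymQuot k h n →ₐ[k⟦X⟧] B}
    (hφ : ∀ t, φ (U.gen A d ρ (.T t)) = τ (SymQuot.mk k h n (SymmetricAlgebra.ι k⟦X⟧ h t)))
    (t : SymmetricAlgebra k⟦X⟧ h) : φ (U.ofSym A d ρ t) = τ (SymQuot.mk k h n t) := by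
  induction t using SymmetricAlgebra.induction with
  | algebraMap r => simp only [AlgHom.commutes]
  | ι t => rw [U.ofSym_ι, hφ]
  | mul a b ha hb => simp only [map_mul, ha, hb]
  | add a b ha hb => simp only [map_add, ha, hb]

/-- The pairs of distinct indices, labelling the quantum Serre relations. -/
abbrev OffDiag (I : Type*) : Type _ := {p : I × I // p.1 ≠ p.2}

variable [Module.Free k⟦X⟧ h] (hA : IsSymmetrizableGCM A d) (hP : IsCartanType A d P)

include hA hP

/-- The module from `exists_triRep` over Sym(h)/ħⁿ becomes a U-module through `U.exists_lift`, and
`mem_hPow_of_mul₃_mem` reads the tensor off its vector v₀. -/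
theorem U.reflectsHPow_neg_pos :
    ReflectsHPow (k := k) (N := U A d ρ) (mul₂ (mul₂ (U.ofNeg A d ρ).toLinearMap (U.ofSym A d ρ).toLinearMap)
      (U.ofPos A d ρ).toLinearMap) := by
  intro n z hz
  obtain ⟨V, _, _, r, v₀, p, hF, hE, hp⟩ := exists_triRep (fun i => shiftQuot n (ρ.α i))
    (fun i => SymQuot.mk k h n (cartanElt d ρ n i)) (fun _ _ _ => shiftQuot_comm n _ _ _)
    (PosAlg.gen A d P) (NegAlg.gen A d P)
    (fun a : OffDiag I => serreNeg A d P (FreeAlgebra.ι k⟦X⟧) a.1.1 a.1.2)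
    (fun a : OffDiag I => serrePos A d P (FreeAlgebra.ι k⟦X⟧) a.1.1 a.1.2)
    (fun a => by rw [lift_serreNeg, NegAlg.serre A d P a.2])
    (fun a => by
      rw [lift_serrePos]
      exact borelE_serre_eq_zero (fun _ _ _ => shiftQuot_comm n _ _ _) _ _ _ _ _ _ _
        sub_add_cancel_of_mem_range (PosAlg.serre A d P a.2))
    (fun r a t => by
      rw [lift_serreNeg]
      exact ⟨_, r.τ_mul_serre _ _ _ _ _ _ add_sub_cancel_of_mem_range
        (fun _ _ _ => shiftQuot_comm n _ _ _) t⟩)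
    (fun r a i => by
      rw [lift_serreNeg]
      exact r.E_mul_serre _ _ a.2 _ _ (serreIdentities hA hP ρ n a.2) i)
    (fun r a i => by
      rw [lift_serrePos]
      exact r.serre_mul_F _ _ a.2 _ _ (serreIdentities hA hP ρ n a.2) i)
  obtain ⟨hV, φ, hφT, hφE, hφF⟩ := U.exists_lift A d ρ r
    (fun i j hij => by
      have := hE ⟨(i, j), hij⟩
      rwa [lift_serrePos] at this)
    (fun i j hij => by
      have := hF ⟨(i, j), hij⟩
      rwa [lift_serreNeg] at this)
  exact mem_hPow_of_mul₃_mem (X := NegAlg A d P) (Y := PosAlg A d P) (B := U A d ρ) (V := V)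
    (X₀ := SymmetricAlgebra k⟦X⟧ h) (S := SymQuot k h n) (n := n) (mk := SymQuot.mk k h n)
    (x := NegAlg.gen A d P) (y := PosAlg.gen A d P) (jX := U.ofNeg A d ρ)
    (j₀ := U.ofSym A d ρ) (jY := U.ofPos A d ρ) (φ := φ) (p := p) (v₀ := v₀) (F := r.F) (E := r.E)
    (τ := r.τ) (SymQuot.mk_surjective n) (fun _ => SymQuot.mk_eq_zero_iff)
    (NegAlg.lift_gen_surjective A d P) (PosAlg.lift_gen_surjective A d P) hV
    (fun i => by rw [U.ofNeg_gen, hφF]) (fun i => by rw [U.ofPos_gen, hφE])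
    (U.comp_ofSym_eq ρ hφT) hp hz

/-- The E_i now act as lowering operators, which inverts σ_i and changes the sign of H_i; `unswap`
returns to the original relations and Serre identities. -/
theorem U.reflectsHPow_pos_neg :
    ReflectsHPow (k := k) (N := U A d ρ) (mul₂ (mul₂ (U.ofPos A d ρ).toLinearMap (U.ofSym A d ρ).toLinearMap)
      (U.ofNeg A d ρ).toLinearMap) := by
  intro n z hz
  obtain ⟨V, _, _, r, v₀, p, hF, hE, hp⟩ := exists_triRep (fun i => (shiftQuot n (ρ.α i)).symm)
    (fun i => -SymQuot.mk k h n (cartanElt d ρ n i)) (fun _ _ _ => shiftQuot_symm_comm n _ _ _)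
    (NegAlg.gen A d P) (PosAlg.gen A d P)
    (fun a : OffDiag I => serrePos A d P (FreeAlgebra.ι k⟦X⟧) a.1.1 a.1.2)
    (fun a : OffDiag I => serreNeg A d P (FreeAlgebra.ι k⟦X⟧) a.1.1 a.1.2)
    (fun a => by rw [lift_serrePos, PosAlg.serre A d P a.2])
    (fun a => by
      rw [lift_serreNeg]
      exact borelE_serre_eq_zero (fun _ _ _ => shiftQuot_symm_comm n _ _ _) _ _ _ _ _ _ _
        add_sub_cancel_of_mem_range (NegAlg.serre A d P a.2))
    (fun r a t => by
      rw [lift_serrePos]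
      exact ⟨_, r.τ_mul_serre _ _ _ _ _ _ sub_add_cancel_of_mem_range
        (fun _ _ _ => shiftQuot_symm_comm n _ _ _) t⟩)
    (fun r a i => by
      rw [lift_serrePos]
      exact (r.unswap.serre_mul_F _ _ a.2 _ _ (serreIdentities hA hP ρ n a.2) i).symm)
    (fun r a i => by
      rw [lift_serreNeg]
      exact (r.unswap.E_mul_serre _ _ a.2 _ _ (serreIdentities hA hP ρ n a.2) i).symm)
  obtain ⟨hV, φ, hφT, hφE, hφF⟩ := U.exists_lift A d ρ r.unswap
    (fun i j hij => by
      have := hF ⟨(i, j), hij⟩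
      rwa [lift_serrePos] at this)
    (fun i j hij => by
      have := hE ⟨(i, j), hij⟩
      rwa [lift_serreNeg] at this)
  exact mem_hPow_of_mul₃_mem (X := PosAlg A d P) (Y := NegAlg A d P) (B := U A d ρ) (V := V)
    (X₀ := SymmetricAlgebra k⟦X⟧ h) (S := SymQuot k h n) (n := n) (mk := SymQuot.mk k h n)
    (x := PosAlg.gen A d P) (y := NegAlg.gen A d P) (jX := U.ofPos A d ρ)
    (j₀ := U.ofSym A d ρ) (jY := U.ofNeg A d ρ) (φ := φ) (p := p) (v₀ := v₀) (F := r.F) (E := r.E)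
    (τ := r.τ) (SymQuot.mk_surjective n) (fun _ => SymQuot.mk_eq_zero_iff)
    (PosAlg.lift_gen_surjective A d P) (NegAlg.lift_gen_surjective A d P) hV
    (fun i => by rw [U.ofPos_gen]; exact hφE i) (fun i => by rw [U.ofNeg_gen]; exact hφF i)
    (U.comp_ofSym_eq ρ hφT) hp hz

end Reflects

/-! ### Closed subalgebras that are completions -/

section Augmented

variable {k : Type*} [Field k] {B X L : Type*} [Ring B] [Algebra k⟦X⟧ B] [Ring X] [Algebra k⟦X⟧ X]
  [AddCommGroup L] [Module k⟦X⟧ L]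

/-- The map x ↦ x ⊗ 1 is split by the augmentation, so divisibility of x ⊗ 1 gives divisibility of
x. -/
theorem ReflectsHPow.left_of_mul₂ {f : L →ₗ[k⟦X⟧] B} {j : X →ₐ[k⟦X⟧] B}
    (hf : ReflectsHPow (mul₂ f j.toLinearMap)) (ε : X →ₐ[k⟦X⟧] k⟦X⟧) : ReflectsHPow f := by
  have h1 := hf.comp_of_retract ((TensorProduct.mk k⟦X⟧ L X).flip 1)
    ((TensorProduct.rid k⟦X⟧ L).toLinearMap ∘ₗ ε.toLinearMap.lTensor L) (fun x => by simp)
  have h2 : mul₂ f j.toLinearMap ∘ₗ (TensorProduct.mk k⟦X⟧ L X).flip 1 = f := by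
    ext x
    simp
  rwa [h2] at h1

theorem ReflectsHPow.right_of_mul₂ {f : L →ₗ[k⟦X⟧] B} {j : X →ₐ[k⟦X⟧] B}
    (hf : ReflectsHPow (mul₂ j.toLinearMap f)) (ε : X →ₐ[k⟦X⟧] k⟦X⟧) : ReflectsHPow f := by
  have h1 := hf.comp_of_retract (TensorProduct.mk k⟦X⟧ X L 1)
    ((TensorProduct.lid k⟦X⟧ L).toLinearMap ∘ₗ ε.toLinearMap.rTensor L) (fun x => by simp)
  have h2 : mul₂ j.toLinearMap f ∘ₗ TensorProduct.mk k⟦X⟧ X L 1 = f := by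
    ext x
    simp
  rwa [h2] at h1

theorem ReflectsHPow.right_of_mul₃ {S Y : Type*} [Ring S] [Algebra k⟦X⟧ S] [Ring Y] [Algebra k⟦X⟧ Y]
    {jX : X →ₐ[k⟦X⟧] B} {jS : S →ₐ[k⟦X⟧] B} {jY : Y →ₐ[k⟦X⟧] B}
    (hf : ReflectsHPow (mul₂ (mul₂ jX.toLinearMap jS.toLinearMap) jY.toLinearMap))
    (ε : X →ₐ[k⟦X⟧] k⟦X⟧) : ReflectsHPow (mul₂ jS.toLinearMap jY.toLinearMap) := by
  have h1 := hf.comp_of_retract ((TensorProduct.mk k⟦X⟧ X S 1).rTensor Y)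
    (((TensorProduct.lid k⟦X⟧ S).toLinearMap ∘ₗ ε.toLinearMap.rTensor S).rTensor Y) (fun x => by
      rw [← LinearMap.comp_apply, ← LinearMap.rTensor_comp]
      convert LinearMap.id_apply x
      refine TensorProduct.ext' fun s y => ?_
      simp)
  have h2 : mul₂ (mul₂ jX.toLinearMap jS.toLinearMap) jY.toLinearMap ∘ₗ
      (TensorProduct.mk k⟦X⟧ X S 1).rTensor Y = mul₂ jS.toLinearMap jY.toLinearMap := by
    refine TensorProduct.ext' fun s y => ?_
    simp
  rwa [h2] at h1

end Augmented

section Completion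

variable {k : Type*} [Field k]

theorem HDense.hClosure_range_comp {L M N : Type*} [AddCommGroup L] [Module k⟦X⟧ L]
    [AddCommGroup M] [Module k⟦X⟧ M] [AddCommGroup N] [Module k⟦X⟧ N] {g : L →ₗ[k⟦X⟧] M}
    (hg : HDense g) (f : M →ₗ[k⟦X⟧] N) :
    hClosure (LinearMap.range (f ∘ₗ g)) = hClosure (LinearMap.range f) := by
  refine le_antisymm ?_ fun u hu => mem_hClosure.2 fun n => ?_
  · intro u hu
    rw [mem_hClosure] at hu ⊢
    intro n
    obtain ⟨_, ⟨x, rfl⟩, hx⟩ := hu n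
    exact ⟨_, ⟨g x, rfl⟩, hx⟩
  · obtain ⟨_, ⟨x, rfl⟩, hx⟩ := mem_hClosure.1 hu n
    obtain ⟨y, hy⟩ := hg n x
    refine ⟨_, ⟨y, rfl⟩, ?_⟩
    have := Submodule.add_mem _ hx (map_mem_hPow f hy)
    rwa [map_sub, sub_add_sub_cancel] at this

theorem ReflectsHPow.exists_linearEquiv_top {M N : Type*} [AddCommGroup M] [Module k⟦X⟧ M]
    [AddCommGroup N] [Module k⟦X⟧ N] {f : M →ₗ[k⟦X⟧] HCompletion k N} (hf : ReflectsHPow f)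
    (h : hClosure (LinearMap.range f) = ⊤) :
    ∃ e : HCompletion k M ≃ₗ[k⟦X⟧] HCompletion k N, IsHomeomorph e ∧
      ∀ x, e (HCompletion.of k M x) = f x := by
  have : IsAdicComplete (hIdeal k) (HCompletion k N) := HCompletion.isAdicComplete N
  obtain ⟨e, he, he'⟩ := hf.exists_linearEquiv _ h
  exact ⟨e.trans Submodule.topEquiv,
    (Homeomorph.Set.univ (HCompletion k N)).isHomeomorph.comp he, he'⟩

theorem exists_linearEquiv_of_dense₃ {L₁ L₂ L₃ M₁ M₂ M₃ N : Type*} [AddCommGroup L₁] [Module k⟦X⟧ L₁]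
    [AddCommGroup L₂] [Module k⟦X⟧ L₂] [AddCommGroup L₃] [Module k⟦X⟧ L₃]
    [AddCommGroup M₁] [Module k⟦X⟧ M₁] [AddCommGroup M₂] [Module k⟦X⟧ M₂]
    [AddCommGroup M₃] [Module k⟦X⟧ M₃] [AddCommGroup N] [Module k⟦X⟧ N]
    {g₁ : L₁ →ₗ[k⟦X⟧] M₁} {g₂ : L₂ →ₗ[k⟦X⟧] M₂} {g₃ : L₃ →ₗ[k⟦X⟧] M₃}
    (h₁ : HDense g₁) (h₂ : HDense g₂) (h₃ : HDense g₃)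
    (f : (M₁ ⊗[k⟦X⟧] M₂) ⊗[k⟦X⟧] M₃ →ₗ[k⟦X⟧] HCompletion k N)
    (hf : ReflectsHPow (f ∘ₗ TensorProduct.map (TensorProduct.map g₁ g₂) g₃))
    (h : hClosure (LinearMap.range (f ∘ₗ TensorProduct.map (TensorProduct.map g₁ g₂) g₃)) = ⊤) :
    ∃ e : CTensor₃ k M₁ M₂ M₃ ≃ₗ[k⟦X⟧] HCompletion k N, IsHomeomorph e ∧
      ∀ x, e (HCompletion.of k _ x) = f x := by
  have hg := (h₁.map h₂).map h₃
  rw [hg.hClosure_range_comp] at h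
  exact (hf.of_comp hg).exists_linearEquiv_top h

variable {B : Type*} [Ring B] [Algebra k⟦X⟧ B]
  {X Y S : Type*} [Ring X] [Algebra k⟦X⟧ X] [Ring Y] [Algebra k⟦X⟧ Y] [Ring S] [Algebra k⟦X⟧ S]

/-- The subalgebra `C` of `B` is the closure of the image of the `ħ`-adic embedding `j`. -/
structure IsCompletionOf (j : X →ₐ[k⟦X⟧] HCompletion k B)
    (C : Subalgebra k⟦X⟧ (HCompletion k B)) : Prop where
  reflects : ReflectsHPow j.toLinearMap
  closure : hClosure (LinearMap.range j.toLinearMap) = Subalgebra.toSubmodule C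

namespace IsCompletionOf

variable {j : X →ₐ[k⟦X⟧] HCompletion k B} {C : Subalgebra k⟦X⟧ (HCompletion k B)}
  (hj : IsCompletionOf j C)

include hj

theorem exists_algEquiv : ∃ φ : HCompletion k X ≃ₐ[k⟦X⟧] C, IsHomeomorph φ ∧
    ∀ x, (φ (HCompletion.of k X x) : HCompletion k B) = j x := by
  have : IsAdicComplete (hIdeal k) (HCompletion k B) := HCompletion.isAdicComplete B
  have hr : LinearMap.range (HCompletion.extend j.toLinearMap) = Subalgebra.toSubmodule C :=
    hj.reflects.range_extend.trans hj.closure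
  let f : HCompletion k X →ₐ[k⟦X⟧] C := (HCompletion.extendAlg j).codRestrict C fun x => by
    change HCompletion.extend j.toLinearMap x ∈ Subalgebra.toSubmodule C
    rw [← hr]
    exact ⟨x, rfl⟩
  have hf : Function.Bijective f := by
    refine ⟨fun x y hxy => hj.reflects.extend_injective (congrArg Subtype.val hxy), ?_⟩
    rintro ⟨c, hc⟩
    obtain ⟨x, hx⟩ : c ∈ LinearMap.range (HCompletion.extend j.toLinearMap) := hr ▸ hc
    exact ⟨x, Subtype.ext hx⟩
  exact ⟨AlgEquiv.ofBijective f hf, isHomeomorph_of_reflectsHPow hj.reflects _ hf fun _ => rfl,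
    fun x => HCompletion.extendAlg_of j x⟩

/-- Density refers to the filtration ħⁿC of `C` itself, which is the one entering completed tensor
products; it is transported from the completion of `X`. -/
theorem exists_dense : ∃ g : X →ₗ[k⟦X⟧] C, HDense g ∧ ∀ x, (g x : HCompletion k B) = j x := by
  obtain ⟨φ, -, hφ⟩ := hj.exists_algEquiv
  refine ⟨φ.toLinearMap ∘ₗ HCompletion.of k X, fun n c => ?_, hφ⟩
  obtain ⟨ξ, rfl⟩ := φ.surjective c
  obtain ⟨x, hx⟩ := ξ.exists_sub_of_mem n
  refine ⟨x, ?_⟩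
  have := map_mem_hPow φ.toLinearMap hx
  rwa [map_sub] at this

omit hj

variable {jX : X →ₐ[k⟦X⟧] HCompletion k B} {jY : Y →ₐ[k⟦X⟧] HCompletion k B}
  {jS : S →ₐ[k⟦X⟧] HCompletion k B} {CX CY CS D : Subalgebra k⟦X⟧ (HCompletion k B)}

/-- X ⊗ Y is dense in CX ⊗ CY, so reflection and the closure of the image pass to the multiplication
map of the closed subalgebras, which then extends to the completion. -/
theorem exists_ctensor₂_equiv (hX : IsCompletionOf jX CX) (hY : IsCompletionOf jY CY)
    (h : ReflectsHPow (mul₂ jX.toLinearMap jY.toLinearMap))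
    (hD : hClosure (LinearMap.range (mul₂ jX.toLinearMap jY.toLinearMap)) =
      Subalgebra.toSubmodule D) :
    ∃ e : CTensor₂ k CX CY ≃ₗ[k⟦X⟧] D, IsHomeomorph e ∧ ∀ (x : CX) (y : CY),
      (e (ctmul₂ k x y) : HCompletion k B) = (x : HCompletion k B) * (y : HCompletion k B) := by
  obtain ⟨gX, hgX, hX'⟩ := hX.exists_dense
  obtain ⟨gY, hgY, hY'⟩ := hY.exists_dense
  have hg := hgX.map hgY
  let f := mul₂ CX.val.toLinearMap CY.val.toLinearMap
  have hf : f ∘ₗ TensorProduct.map gX gY = mul₂ jX.toLinearMap jY.toLinearMap :=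
    TensorProduct.ext' fun x y => by simp [f, hX', hY']
  rw [← hf] at h hD
  rw [hg.hClosure_range_comp] at hD
  have : IsAdicComplete (hIdeal k) (HCompletion k B) := HCompletion.isAdicComplete B
  obtain ⟨e, he, he'⟩ := (h.of_comp hg).exists_linearEquiv _ hD
  exact ⟨e, he, fun x y => (he' _).trans (by simp [f])⟩

theorem exists_ctensor₃_equiv (hX : IsCompletionOf jX CX) (hS : IsCompletionOf jS CS)
    (hY : IsCompletionOf jY CY)
    (h : ReflectsHPow (mul₂ (mul₂ jX.toLinearMap jS.toLinearMap) jY.toLinearMap))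
    (hD : hClosure (LinearMap.range
      (mul₂ (mul₂ jX.toLinearMap jS.toLinearMap) jY.toLinearMap)) = ⊤) :
    ∃ e : CTensor₃ k CX CS CY ≃ₗ[k⟦X⟧] HCompletion k B, IsHomeomorph e ∧
      ∀ (x : CX) (t : CS) (y : CY), e (ctmul₃ k x t y) =
        (x : HCompletion k B) * (t : HCompletion k B) * (y : HCompletion k B) := by
  obtain ⟨gX, hgX, hX'⟩ := hX.exists_dense
  obtain ⟨gS, hgS, hS'⟩ := hS.exists_dense
  obtain ⟨gY, hgY, hY'⟩ := hY.exists_dense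
  let f := mul₂ (mul₂ CX.val.toLinearMap CS.val.toLinearMap) CY.val.toLinearMap
  have hf : f ∘ₗ TensorProduct.map (TensorProduct.map gX gS) gY =
      mul₂ (mul₂ jX.toLinearMap jS.toLinearMap) jY.toLinearMap :=
    TensorProduct.ext_threefold fun x t y => by simp [f, hX', hS', hY']
  rw [← hf] at h hD
  obtain ⟨e, he, he'⟩ := exists_linearEquiv_of_dense₃ hgX hgS hgY f h hD
  exact ⟨e, he, fun x t y => (he' _).trans (by simp [f])⟩

end IsCompletionOf

end Completion

section Augmentation

variable {k : Type*} [Field k] [CharZero k] {I : Type*} (A : Matrix I I ℤ) (d : I → ℕ)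
  (P : Matrix I I k⟦X⟧)

/-- The augmentation of `PosAlg`. -/
def PosAlg.augmentation : PosAlg A d P →ₐ[k⟦X⟧] k⟦X⟧ :=
  PosAlg.lift A d P (fun _ => 0) fun _ _ _ => by simp [serrePos]

/-- The augmentation of `NegAlg`. -/
def NegAlg.augmentation : NegAlg A d P →ₐ[k⟦X⟧] k⟦X⟧ :=
  NegAlg.lift A d P (fun _ => 0) fun _ _ _ => by simp [serreNeg]

end Augmentation

theorem range_toLinearMap_eq_adjoin {R X B : Type*} [CommRing R] [Ring X] [Algebra R X] [Ring B]
    [Algebra R B] (j : X →ₐ[R] B) {s : Set X} (hs : Algebra.adjoin R s = ⊤) :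
    LinearMap.range j.toLinearMap = Subalgebra.toSubmodule (Algebra.adjoin R (j '' s)) := by
  rw [← AlgHom.map_adjoin, hs, Algebra.map_top]
  rfl

/-! ### Density of the products, and the factors as completions -/

section Main

set_option maxSynthPendingDepth 3

variable {k : Type*} [Field k] [CharZero k] {I : Type*}
  {h : Type*} [AddCommGroup h] [Module k⟦X⟧ h]
  (A : Matrix I I ℤ) (d : I → ℕ) {P : Matrix I I k⟦X⟧} (ρ : Realization P h)

theorem U.ofSym_mul_ofNeg (i : I) (t : SymmetricAlgebra k⟦X⟧ h) :
    U.ofSym A d ρ t * U.ofNeg A d ρ (NegAlg.gen A d P i) =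
      U.ofNeg A d ρ (NegAlg.gen A d P i) * U.ofSym A d ρ (shift (ρ.α i) t) := by
  rw [U.ofNeg_gen, U.ofSym_mul_F]

theorem U.ofNeg_mul_ofSym (i : I) (t : SymmetricAlgebra k⟦X⟧ h) :
    U.ofNeg A d ρ (NegAlg.gen A d P i) * U.ofSym A d ρ t =
      U.ofSym A d ρ ((shift (ρ.α i)).symm t) * U.ofNeg A d ρ (NegAlg.gen A d P i) := by
  rw [U.ofSym_mul_ofNeg, AlgEquiv.apply_symm_apply]

theorem U.ofPos_mul_ofSym (i : I) (t : SymmetricAlgebra k⟦X⟧ h) :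
    U.ofPos A d ρ (PosAlg.gen A d P i) * U.ofSym A d ρ t =
      U.ofSym A d ρ (shift (ρ.α i) t) * U.ofPos A d ρ (PosAlg.gen A d P i) := by
  rw [U.ofPos_gen, U.E_mul_ofSym]

theorem U.ofSym_mul_ofPos (i : I) (t : SymmetricAlgebra k⟦X⟧ h) :
    U.ofSym A d ρ t * U.ofPos A d ρ (PosAlg.gen A d P i) =
      U.ofPos A d ρ (PosAlg.gen A d P i) * U.ofSym A d ρ ((shift (ρ.α i)).symm t) := by
  rw [U.ofPos_mul_ofSym, AlgEquiv.apply_symm_apply]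

/-- Precision ħ is enough, since density is checked modulo ħ. -/
theorem U.exists_commutator_sub_mem (i l : I) : ∃ s,
    U.ofPos A d ρ (PosAlg.gen A d P i) * U.ofNeg A d ρ (NegAlg.gen A d P l) -
      U.ofNeg A d ρ (NegAlg.gen A d P l) * U.ofPos A d ρ (PosAlg.gen A d P i) -
        U.ofSym A d ρ s ∈ hPow k (U A d ρ) 1 := by
  simp only [U.ofPos_gen, U.ofNeg_gen]
  rcases eq_or_ne i l with rfl | hil
  · exact ⟨_, U.E_mul_F_self_sub_mem A d ρ 1 i⟩
  · refine ⟨0, ?_⟩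
    rw [U.E_mul_F_of_ne A d ρ hil, map_zero, sub_zero]
    exact Submodule.zero_mem _

theorem U.ofSym_image_range_ι :
    U.ofSym A d ρ '' Set.range (SymmetricAlgebra.ι k⟦X⟧ h) =
      Set.range fun t => U.gen A d ρ (.T t) := by
  rw [← Set.range_comp]
  exact congrArg Set.range (funext (U.ofSym_ι A d ρ))

theorem U.range_ofNeg_gen : (Set.range fun i => U.ofNeg A d ρ (NegAlg.gen A d P i)) =
    Set.range fun i => U.gen A d ρ (.F i) :=
  congrArg Set.range (funext (U.ofNeg_gen A d ρ))

theorem U.range_ofPos_gen : (Set.range fun i => U.ofPos A d ρ (PosAlg.gen A d P i)) =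
    Set.range fun i => U.gen A d ρ (.E i) :=
  congrArg Set.range (funext (U.ofPos_gen A d ρ))

theorem U.range_gen_subset : Set.range (U.gen A d ρ) ⊆
    U.ofSym A d ρ '' Set.range (SymmetricAlgebra.ι k⟦X⟧ h) ∪
      ((Set.range fun i => U.ofNeg A d ρ (NegAlg.gen A d P i)) ∪
        Set.range fun i => U.ofPos A d ρ (PosAlg.gen A d P i)) := by
  rw [U.ofSym_image_range_ι, U.range_ofNeg_gen, U.range_ofPos_gen]
  rintro _ ⟨t | i | i, rfl⟩
  · exact Or.inl ⟨t, rfl⟩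
  · exact Or.inr (Or.inr ⟨i, rfl⟩)
  · exact Or.inr (Or.inl ⟨i, rfl⟩)

theorem U.hClosure_range_neg_pos : hClosure (LinearMap.range (mul₂ (mul₂ (U.ofNeg A d ρ).toLinearMap
    (U.ofSym A d ρ).toLinearMap) (U.ofPos A d ρ).toLinearMap)) = (⊤ : Submodule k⟦X⟧ (U A d ρ)) := by
  refine hClosure_eq_top (top_le_iff.1 ?_)
  rw [← U.adjoin_sup_eq_top A d ρ]
  refine sup_le ?_ le_sup_right
  refine le_trans ?_ (adjoin_le_range_mul₃_sup
    (adjoin_range_of_lift_surjective (NegAlg.lift_gen_surjective A d P))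
    (U.ofSym_mul_ofNeg A d ρ) (U.ofPos_mul_ofSym A d ρ) (fun a _ hb => mul_mem_hPow a hb)
    (fun a _ hb => mem_hPow_mul a hb) (U.exists_commutator_sub_mem A d ρ)
    (Set.range (SymmetricAlgebra.ι k⟦X⟧ h)))
  exact Algebra.adjoin_mono (U.range_gen_subset A d ρ)

theorem U.hClosure_range_pos_neg : hClosure (LinearMap.range (mul₂ (mul₂ (U.ofPos A d ρ).toLinearMap
    (U.ofSym A d ρ).toLinearMap) (U.ofNeg A d ρ).toLinearMap)) = (⊤ : Submodule k⟦X⟧ (U A d ρ)) := by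
  refine hClosure_eq_top (top_le_iff.1 ?_)
  rw [← U.adjoin_sup_eq_top A d ρ]
  refine sup_le ?_ le_sup_right
  refine le_trans ?_ (adjoin_le_range_mul₃_sup
    (adjoin_range_of_lift_surjective (PosAlg.lift_gen_surjective A d P))
    (U.ofSym_mul_ofPos A d ρ) (U.ofNeg_mul_ofSym A d ρ) (fun a _ hb => mul_mem_hPow a hb)
    (fun a _ hb => mem_hPow_mul a hb) (fun i l => ?_)
    (Set.range (SymmetricAlgebra.ι k⟦X⟧ h)))
  · refine Algebra.adjoin_mono ((U.range_gen_subset A d ρ).trans ?_)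
    rw [Set.union_comm (Set.range fun i => U.ofPos A d ρ (PosAlg.gen A d P i))]
  · obtain ⟨s, hs⟩ := U.exists_commutator_sub_mem A d ρ l i
    refine ⟨-s, ?_⟩
    rw [← Submodule.neg_mem_iff, map_neg]
    convert hs using 1
    abel

/-- No commutator of an E with an F occurs in a Borel part, so the product equals the generated
subalgebra even before closing. -/
theorem U.hClosure_range_neg_sym :
    hClosure (LinearMap.range (mul₂ (U.ofNeg A d ρ).toLinearMap (U.ofSym A d ρ).toLinearMap)) =
      Subalgebra.toSubmodule (borelNeg A d ρ) := by
  rw [range_mul₂_left (adjoin_range_of_lift_surjective (NegAlg.lift_gen_surjective A d P))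
    adjoin_range_ι_symmetricAlgebra (U.ofSym_mul_ofNeg A d ρ), U.ofSym_image_range_ι,
    U.range_ofNeg_gen, borelNeg, toSubmodule_closedAdjoin]

theorem U.hClosure_range_sym_neg :
    hClosure (LinearMap.range (mul₂ (U.ofSym A d ρ).toLinearMap (U.ofNeg A d ρ).toLinearMap)) =
      Subalgebra.toSubmodule (borelNeg A d ρ) := by
  rw [range_mul₂_right (adjoin_range_of_lift_surjective (NegAlg.lift_gen_surjective A d P))
    adjoin_range_ι_symmetricAlgebra (U.ofSym_mul_ofNeg A d ρ), U.ofSym_image_range_ι,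
    U.range_ofNeg_gen, borelNeg, toSubmodule_closedAdjoin]

theorem U.hClosure_range_pos_sym :
    hClosure (LinearMap.range (mul₂ (U.ofPos A d ρ).toLinearMap (U.ofSym A d ρ).toLinearMap)) =
      Subalgebra.toSubmodule (borelPos A d ρ) := by
  rw [range_mul₂_left (adjoin_range_of_lift_surjective (PosAlg.lift_gen_surjective A d P))
    adjoin_range_ι_symmetricAlgebra (U.ofSym_mul_ofPos A d ρ), U.ofSym_image_range_ι,
    U.range_ofPos_gen, borelPos, toSubmodule_closedAdjoin]

theorem U.hClosure_range_sym_pos :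
    hClosure (LinearMap.range (mul₂ (U.ofSym A d ρ).toLinearMap (U.ofPos A d ρ).toLinearMap)) =
      Subalgebra.toSubmodule (borelPos A d ρ) := by
  rw [range_mul₂_right (adjoin_range_of_lift_surjective (PosAlg.lift_gen_surjective A d P))
    adjoin_range_ι_symmetricAlgebra (U.ofSym_mul_ofPos A d ρ), U.ofSym_image_range_ι,
    U.range_ofPos_gen, borelPos, toSubmodule_closedAdjoin]

theorem U.hClosure_range_ofNeg : hClosure (LinearMap.range (U.ofNeg A d ρ).toLinearMap) =
    Subalgebra.toSubmodule (nilNeg A d ρ) := by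
  rw [range_toLinearMap_eq_adjoin _
    (adjoin_range_of_lift_surjective (NegAlg.lift_gen_surjective A d P)), ← Set.range_comp, nilNeg,
    toSubmodule_closedAdjoin, ← U.range_ofNeg_gen]
  rfl

theorem U.hClosure_range_ofPos : hClosure (LinearMap.range (U.ofPos A d ρ).toLinearMap) =
    Subalgebra.toSubmodule (nilPos A d ρ) := by
  rw [range_toLinearMap_eq_adjoin _
    (adjoin_range_of_lift_surjective (PosAlg.lift_gen_surjective A d P)), ← Set.range_comp, nilPos,
    toSubmodule_closedAdjoin, ← U.range_ofPos_gen]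
  rfl

theorem U.hClosure_range_ofSym : hClosure (LinearMap.range (U.ofSym A d ρ).toLinearMap) =
    Subalgebra.toSubmodule (cartan A d ρ) := by
  rw [range_toLinearMap_eq_adjoin _ adjoin_range_ι_symmetricAlgebra, U.ofSym_image_range_ι, cartan,
    toSubmodule_closedAdjoin]

variable [Module.Free k⟦X⟧ h] (hA : IsSymmetrizableGCM A d) (hP : IsCartanType A d P)

include hA hP

theorem U.reflectsHPow_neg_sym : ReflectsHPow (k := k) (N := U A d ρ)
    (mul₂ (U.ofNeg A d ρ).toLinearMap (U.ofSym A d ρ).toLinearMap) :=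
  (U.reflectsHPow_neg_pos ρ hA hP).left_of_mul₂ (PosAlg.augmentation A d P)

/-- X⁺ stands to the left of S only in the second triangular order, so the four Borel products draw
on both orders. -/
theorem U.reflectsHPow_pos_sym : ReflectsHPow (k := k) (N := U A d ρ)
    (mul₂ (U.ofPos A d ρ).toLinearMap (U.ofSym A d ρ).toLinearMap) :=
  (U.reflectsHPow_pos_neg ρ hA hP).left_of_mul₂ (NegAlg.augmentation A d P)

theorem U.reflectsHPow_sym_pos : ReflectsHPow (k := k) (N := U A d ρ)
    (mul₂ (U.ofSym A d ρ).toLinearMap (U.ofPos A d ρ).toLinearMap) :=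
  (U.reflectsHPow_neg_pos ρ hA hP).right_of_mul₃ (NegAlg.augmentation A d P)

theorem U.reflectsHPow_sym_neg : ReflectsHPow (k := k) (N := U A d ρ)
    (mul₂ (U.ofSym A d ρ).toLinearMap (U.ofNeg A d ρ).toLinearMap) :=
  (U.reflectsHPow_pos_neg ρ hA hP).right_of_mul₃ (PosAlg.augmentation A d P)

theorem U.isCompletionOf_ofNeg : IsCompletionOf (U.ofNeg A d ρ) (nilNeg A d ρ) :=
  ⟨(U.reflectsHPow_neg_sym A d ρ hA hP).left_of_mul₂ SymmetricAlgebra.algebraMapInv,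
    U.hClosure_range_ofNeg A d ρ⟩

theorem U.isCompletionOf_ofPos : IsCompletionOf (U.ofPos A d ρ) (nilPos A d ρ) :=
  ⟨(U.reflectsHPow_pos_sym A d ρ hA hP).left_of_mul₂ SymmetricAlgebra.algebraMapInv,
    U.hClosure_range_ofPos A d ρ⟩

theorem U.isCompletionOf_ofSym : IsCompletionOf (U.ofSym A d ρ) (cartan A d ρ) :=
  ⟨(U.reflectsHPow_neg_sym A d ρ hA hP).right_of_mul₂ (NegAlg.augmentation A d P),
    U.hClosure_range_ofSym A d ρ⟩

end Main

end MpQUEA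

end

theorem mainTheorem3 {k : Type*} [Field k] [CharZero k] {I : Type*} [Finite I]
    (A : Matrix I I ℤ) (d : I → ℕ) (hA : MpQUEA.IsSymmetrizableGCM A d)
    (P : Matrix I I k⟦X⟧) (hP : MpQUEA.IsCartanType A d P)
    {h : Type*} [AddCommGroup h] [Module k⟦X⟧ h] [Module.Free k⟦X⟧ h] [Module.Finite k⟦X⟧ h]
    (ρ : MpQUEA.Realization P h) :
    -- triangular decompositions of the whole algebra
    (∃ e : MpQUEA.CTensor₃ k (MpQUEA.nilNeg A d ρ) (MpQUEA.cartan A d ρ) (MpQUEA.nilPos A d ρ)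
          ≃ₗ[k⟦X⟧] MpQUEA.U A d ρ,
        IsHomeomorph e ∧
        ∀ (x : MpQUEA.nilNeg A d ρ) (t : MpQUEA.cartan A d ρ) (y : MpQUEA.nilPos A d ρ),
          e (MpQUEA.ctmul₃ k x t y) =
            (x : MpQUEA.U A d ρ) * (t : MpQUEA.U A d ρ) * (y : MpQUEA.U A d ρ)) ∧
    (∃ e : MpQUEA.CTensor₃ k (MpQUEA.nilPos A d ρ) (MpQUEA.cartan A d ρ) (MpQUEA.nilNeg A d ρ)
          ≃ₗ[k⟦X⟧] MpQUEA.U A d ρ,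
        IsHomeomorph e ∧
        ∀ (x : MpQUEA.nilPos A d ρ) (t : MpQUEA.cartan A d ρ) (y : MpQUEA.nilNeg A d ρ),
          e (MpQUEA.ctmul₃ k x t y) =
            (x : MpQUEA.U A d ρ) * (t : MpQUEA.U A d ρ) * (y : MpQUEA.U A d ρ)) ∧
    -- factorizations of the Borel subalgebras
    (∃ e : MpQUEA.CTensor₂ k (MpQUEA.nilNeg A d ρ) (MpQUEA.cartan A d ρ)
          ≃ₗ[k⟦X⟧] MpQUEA.borelNeg A d ρ,
        IsHomeomorph e ∧
        ∀ (x : MpQUEA.nilNeg A d ρ) (t : MpQUEA.cartan A d ρ),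
          (e (MpQUEA.ctmul₂ k x t) : MpQUEA.U A d ρ) =
            (x : MpQUEA.U A d ρ) * (t : MpQUEA.U A d ρ)) ∧
    (∃ e : MpQUEA.CTensor₂ k (MpQUEA.cartan A d ρ) (MpQUEA.nilNeg A d ρ)
          ≃ₗ[k⟦X⟧] MpQUEA.borelNeg A d ρ,
        IsHomeomorph e ∧
        ∀ (t : MpQUEA.cartan A d ρ) (x : MpQUEA.nilNeg A d ρ),
          (e (MpQUEA.ctmul₂ k t x) : MpQUEA.U A d ρ) =
            (t : MpQUEA.U A d ρ) * (x : MpQUEA.U A d ρ)) ∧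
    (∃ e : MpQUEA.CTensor₂ k (MpQUEA.nilPos A d ρ) (MpQUEA.cartan A d ρ)
          ≃ₗ[k⟦X⟧] MpQUEA.borelPos A d ρ,
        IsHomeomorph e ∧
        ∀ (x : MpQUEA.nilPos A d ρ) (t : MpQUEA.cartan A d ρ),
          (e (MpQUEA.ctmul₂ k x t) : MpQUEA.U A d ρ) =
            (x : MpQUEA.U A d ρ) * (t : MpQUEA.U A d ρ)) ∧
    (∃ e : MpQUEA.CTensor₂ k (MpQUEA.cartan A d ρ) (MpQUEA.nilPos A d ρ)
          ≃ₗ[k⟦X⟧] MpQUEA.borelPos A d ρ,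
        IsHomeomorph e ∧
        ∀ (t : MpQUEA.cartan A d ρ) (x : MpQUEA.nilPos A d ρ),
          (e (MpQUEA.ctmul₂ k t x) : MpQUEA.U A d ρ) =
            (t : MpQUEA.U A d ρ) * (x : MpQUEA.U A d ρ)) ∧
    -- the nilpotent subalgebras are presented by the quantum Serre relations alone
    (∃ φ : MpQUEA.UhatNeg A d P ≃ₐ[k⟦X⟧] MpQUEA.nilNeg A d ρ,
        IsHomeomorph φ ∧
        ∀ i, (φ (MpQUEA.UhatNeg.gen A d P i) : MpQUEA.U A d ρ) = MpQUEA.U.gen A d ρ (.F i)) ∧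
    (∃ φ : MpQUEA.UhatPos A d P ≃ₐ[k⟦X⟧] MpQUEA.nilPos A d ρ,
        IsHomeomorph φ ∧
        ∀ i, (φ (MpQUEA.UhatPos.gen A d P i) : MpQUEA.U A d ρ) = MpQUEA.U.gen A d ρ (.E i)) ∧
    -- the Cartan subalgebra is the completed symmetric algebra
    (∃ φ : MpQUEA.UhatZero k h ≃ₐ[k⟦X⟧] MpQUEA.cartan A d ρ,
        IsHomeomorph φ ∧
        ∀ t : h, (φ (MpQUEA.UhatZero.gen k t) : MpQUEA.U A d ρ) =
          MpQUEA.U.gen A d ρ (.T t)) := by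
  have hN := MpQUEA.U.isCompletionOf_ofNeg A d ρ hA hP
  have hE := MpQUEA.U.isCompletionOf_ofPos A d ρ hA hP
  have hT := MpQUEA.U.isCompletionOf_ofSym A d ρ hA hP
  refine ⟨hN.exists_ctensor₃_equiv hT hE (MpQUEA.U.reflectsHPow_neg_pos ρ hA hP)
      (MpQUEA.U.hClosure_range_neg_pos A d ρ),
    hE.exists_ctensor₃_equiv hT hN (MpQUEA.U.reflectsHPow_pos_neg ρ hA hP)
      (MpQUEA.U.hClosure_range_pos_neg A d ρ),
    hN.exists_ctensor₂_equiv hT (MpQUEA.U.reflectsHPow_neg_sym A d ρ hA hP)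
      (MpQUEA.U.hClosure_range_neg_sym A d ρ),
    hT.exists_ctensor₂_equiv hN (MpQUEA.U.reflectsHPow_sym_neg A d ρ hA hP)
      (MpQUEA.U.hClosure_range_sym_neg A d ρ),
    hE.exists_ctensor₂_equiv hT (MpQUEA.U.reflectsHPow_pos_sym A d ρ hA hP)
      (MpQUEA.U.hClosure_range_pos_sym A d ρ),
    hT.exists_ctensor₂_equiv hE (MpQUEA.U.reflectsHPow_sym_pos A d ρ hA hP)
      (MpQUEA.U.hClosure_range_sym_pos A d ρ), ?_, ?_, ?_⟩
  · obtain ⟨φ, hφ, hφ'⟩ := hN.exists_algEquiv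
    exact ⟨φ, hφ, fun i => (hφ' _).trans (MpQUEA.U.ofNeg_gen A d ρ i)⟩
  · obtain ⟨φ, hφ, hφ'⟩ := hE.exists_algEquiv
    exact ⟨φ, hφ, fun i => (hφ' _).trans (MpQUEA.U.ofPos_gen A d ρ i)⟩
  · obtain ⟨φ, hφ, hφ'⟩ := hT.exists_algEquiv
    exact ⟨φ, hφ, fun t => (hφ' _).trans (MpQUEA.U.ofSym_ι A d ρ t)⟩
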